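/- **Model.** Let $(\mathcal X,d)$ be a metric space. A fully dynamic stream is a finite sequence of $m$ updates, each of which inserts a point of $\mathcal X$ that is not active or deletes a point that is active; $P^t$ denotes the set of active points after $t$ updates. Points are presented to the algorithm by names (natural numbers). Let $n$ be an upper bound on $|P^t|$ over all $t$, and let $\Delta\ge 1$ be an upper bound on the aspect ratio: there is $r_{\min}>0$ with $r_{\min}\le d(x,y)\le \Delta\, r_{\min}$ for all $t$ and all distinct $x,y\in P^t$. For $k\ge 1$ and a finite $P\subseteq\mathcal X$, the $k$-centers cost of a set $C$ is $\max_{p\in P}d(p,C)$, where $d(p,C)=\min_{c\in C}d(p,c)$, and $\mathrm{OPT}_k(P)$ is the infimum of this cost over all sets $C\subseteq\mathcal X$ of at most $k$ centers. Algorithms are programs of a deterministic unit-cost RAM with registers and arrays that hold natural numbers (with addition, truncated subtraction and comparison) or exact real numbers (with $+,-,\times,/$ and comparison), which may ask in unit time for the distance between two points that are active (the point being inserted or deleted counts as active). The program receives $k,\varepsilon,\Delta$ before the first update, when the rest of its memory is zero; it knows neither $n$, $m$, $r_{\min}$ nor future updates. Any initialization is charged to the updates. **Theorem.** There is a deterministic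 algorithm such that for every $\varepsilon>0$ there is a constant $K$, depending only on $\varepsilon$, with the following property. For every metric space $(\mathcal X,d)$, every $k\ge1$, every $\Delta\ge 1$, every $n$, and every fully dynamic stream in $\mathcal X$ with at most $n$ active points at any time and aspect ratio at most $\Delta$: 1. after every update the algorithm holds an explicit list of at most $k$ centers, all of them active points, whose $k$-centers cost on the current active set $P^t$ is at most $$(2+\varepsilon)\,\lceil \log_2 (n(1+\varepsilon))\rceil\cdot \mathrm{OPT}_k(P^t);$$ 2. the amortized update time is $O(k\log\Delta\log n\log k)$: the total time for all $m$ updates is at most $K\cdot m\cdot k\,\log(\Delta+1)\log(n+1)\log(k+1)$; 3. the worst-case update time of an insertion is $O(k\log\Delta\log n\log k)$: every insertion takes time at most $K\cdot k\,\log(\Delta+1)\log(n+1)\log(k+1)$; 4. the worst-case update time of a deletion is $O(k^2\log\Delta\log n\log k)$: every deletion takes time at most $K\cdot k^2\,\log(\Delta+1)\log(n+1)\log(k+1)$. -/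

import Mathlib

open scoped ENNReal

/-! ## The k-centers objective -/

namespace KCenter

/-- The `k`-centers cost `max_{p ∈ P} d(p, C)` of a set `C` of centers on a point set `P`,
as an extended nonnegative real (`0` if `P` is empty, `∞` if `C` is empty and `P` is not). -/
noncomputable def cost {X : Type*} [MetricSpace X] (P C : Finset X) : ℝ≥0∞ :=
  ⨆ p ∈ P, Metric.infEDist p (C : Set X)

/-- The optimal `k`-centers cost of `P`: the infimum over all sets of at most `k` centers, which
may be any points of the metric space. -/
noncomputable def opt {X : Type*} [MetricSpace X] (k : ℕ) (P : Finset X) : ℝ≥0∞ :=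
  ⨅ (C : Finset X) (_ : C.card ≤ k), cost P C

end KCenter

/-! ## The machine model

A deterministic uniform-cost RAM that works on natural numbers and on exact real numbers.
It has registers and arrays (random access memories) of either type, and a distance oracle.
Natural numbers can be added, subtracted (truncated) and compared; real numbers can be added,
subtracted, multiplied, divided and compared. There is no conversion of reals to naturals and no
multiplication, division or bit operation on naturals. Programs are finite
pieces of syntax; every operation, every memory access, every test and every oracle call costs one
unit of time. -/

namespace RAM

/-- Expressions of type natural number. A register or an array is addressed by its number, which
is fixed in the program text; the cell of an array is computed. -/
inductive NExp where
  | lit (n : ℕ)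
  | reg (x : ℕ)
  | get (a : ℕ) (i : NExp)
  | add (e f : NExp)
  | sub (e f : NExp)

/-- Expressions of type real number. `dist e f` asks the oracle for the distance between the
points that are named `e` and `f`. -/
inductive RExp where
  | lit (n : ℕ)
  | reg (x : ℕ)
  | get (a : ℕ) (i : NExp)
  | add (e f : RExp)
  | sub (e f : RExp)
  | mul (e f : RExp)
  | div (e f : RExp)
  | dist (e f : NExp)

/-- Tests. -/
inductive BExp where
  | neq (e f : NExp)
  | nle (e f : NExp)
  | rle (e f : RExp)
  | not (b : BExp)
  | and (b c : BExp)

/-- Programs. -/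
inductive Cmd where
  | skip
  | setN (x : ℕ) (e : NExp)
  | setR (x : ℕ) (e : RExp)
  | putN (a : ℕ) (i : NExp) (e : NExp)
  | putR (a : ℕ) (i : NExp) (e : RExp)
  | seq (p q : Cmd)
  | ite (b : BExp) (p q : Cmd)
  | while (b : BExp) (p : Cmd)

/-- The contents of the memory: registers and arrays of natural numbers and of real numbers. -/
@[ext]
structure Store where
  nreg : ℕ → ℕ
  rreg : ℕ → ℝ
  narr : ℕ → ℕ → ℕ
  rarr : ℕ → ℕ → ℝ

namespace NExp

/-- The value of an expression. -/
def eval (s : Store) : NExp → ℕ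
  | lit n => n
  | reg x => s.nreg x
  | get a i => s.narr a (i.eval s)
  | add e f => e.eval s + f.eval s
  | sub e f => e.eval s - f.eval s

/-- The time for the evaluation of an expression: one unit for each node. -/
def time : NExp → ℕ
  | lit _ => 1
  | reg _ => 1
  | get _ i => i.time + 1
  | add e f => e.time + f.time + 1
  | sub e f => e.time + f.time + 1

end NExp

namespace RExp

/-- The value of an expression, where `d` is the distance oracle. -/
noncomputable def eval (d : ℕ → ℕ → ℝ) (s : Store) : RExp → ℝ
  | lit n => n
  | reg x => s.rreg x
  | get a i => s.rarr a (i.eval s)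
  | add e f => e.eval d s + f.eval d s
  | sub e f => e.eval d s - f.eval d s
  | mul e f => e.eval d s * f.eval d s
  | div e f => e.eval d s / f.eval d s
  | dist e f => d (e.eval s) (f.eval s)

/-- The time for the evaluation of an expression: one unit for each node. -/
def time : RExp → ℕ
  | lit _ => 1
  | reg _ => 1
  | get _ i => i.time + 1
  | add e f => e.time + f.time + 1
  | sub e f => e.time + f.time + 1
  | mul e f => e.time + f.time + 1
  | div e f => e.time + f.time + 1
  | dist e f => e.time + f.time + 1

end RExp

namespace BExp

/-- The truth value of a test. -/
def Holds (d : ℕ → ℕ → ℝ) (s : Store) : BExp → Prop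
  | neq e f => e.eval s = f.eval s
  | nle e f => e.eval s ≤ f.eval s
  | rle e f => e.eval d s ≤ f.eval d s
  | not b => ¬ b.Holds d s
  | and b c => b.Holds d s ∧ c.Holds d s

/-- The time for the evaluation of a test: one unit for each node. -/
def time : BExp → ℕ
  | neq e f => e.time + f.time + 1
  | nle e f => e.time + f.time + 1
  | rle e f => e.time + f.time + 1
  | not b => b.time + 1
  | and b c => b.time + c.time + 1

end BExp

namespace Store

/-- Write to a register of type natural number. -/
def setN (s : Store) (x v : ℕ) : Store :=
  { s with nreg := Function.update s.nreg x v }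

/-- Write to a register of type real number. -/
noncomputable def setR (s : Store) (x : ℕ) (v : ℝ) : Store :=
  { s with rreg := Function.update s.rreg x v }

/-- Write to a cell of an array of natural numbers. -/
def putN (s : Store) (a i v : ℕ) : Store :=
  { s with narr := Function.update s.narr a (Function.update (s.narr a) i v) }

/-- Write to a cell of an array of real numbers. -/
noncomputable def putR (s : Store) (a i : ℕ) (v : ℝ) : Store :=
  { s with rarr := Function.update s.rarr a (Function.update (s.rarr a) i v) }

end Store

/-- `Exec d p s t s'`: with the distance oracle `d`, the program `p` started in the store `s` halts
after exactly `t` units of time in the store `s'`. -/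
inductive Exec (d : ℕ → ℕ → ℝ) : Cmd → Store → ℕ → Store → Prop
  | skip (s : Store) : Exec d .skip s 1 s
  | setN (s : Store) (x : ℕ) (e : NExp) :
      Exec d (.setN x e) s (e.time + 1) (s.setN x (e.eval s))
  | setR (s : Store) (x : ℕ) (e : RExp) :
      Exec d (.setR x e) s (e.time + 1) (s.setR x (e.eval d s))
  | putN (s : Store) (a : ℕ) (i e : NExp) :
      Exec d (.putN a i e) s (i.time + e.time + 1) (s.putN a (i.eval s) (e.eval s))
  | putR (s : Store) (a : ℕ) (i : NExp) (e : RExp) :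
      Exec d (.putR a i e) s (i.time + e.time + 1) (s.putR a (i.eval s) (e.eval d s))
  | seq {p q : Cmd} {s s' s'' : Store} {t t' : ℕ} (hp : Exec d p s t s')
      (hq : Exec d q s' t' s'') : Exec d (.seq p q) s (t + t') s''
  | ite_true {b : BExp} {p : Cmd} (q : Cmd) {s s' : Store} {t : ℕ} (hb : b.Holds d s)
      (hp : Exec d p s t s') : Exec d (.ite b p q) s (b.time + t + 1) s'
  | ite_false {b : BExp} (p : Cmd) {q : Cmd} {s s' : Store} {t : ℕ} (hb : ¬ b.Holds d s)
      (hq : Exec d q s t s') : Exec d (.ite b p q) s (b.time + t + 1) s'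
  | while_false {b : BExp} (p : Cmd) {s : Store} (hb : ¬ b.Holds d s) :
      Exec d (.while b p) s (b.time + 1) s
  | while_true {b : BExp} {p : Cmd} {s s' s'' : Store} {t t' : ℕ} (hb : b.Holds d s)
      (hp : Exec d p s t s') (hw : Exec d (.while b p) s' t' s'') :
      Exec d (.while b p) s (b.time + t + t' + 1) s''

/-- The machine is deterministic: the final store and the running time are functions of the program,
the oracle and the initial store. -/
theorem Exec.deterministic {d : ℕ → ℕ → ℝ} {p : Cmd} {s s₁ s₂ : Store} {t₁ t₂ : ℕ}
    (h₁ : Exec d p s t₁ s₁) (h₂ : Exec d p s t₂ s₂) : t₁ = t₂ ∧ s₁ = s₂ := by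
  induction h₁ generalizing t₂ s₂ with
  | skip | setN | setR | putN | putR => cases h₂; exact ⟨rfl, rfl⟩
  | seq _ _ ihp ihq =>
    cases h₂ with
    | seq hp hq =>
      obtain ⟨rfl, rfl⟩ := ihp hp
      obtain ⟨rfl, rfl⟩ := ihq hq
      exact ⟨rfl, rfl⟩
  | ite_true _ hb _ ih =>
    cases h₂ with
    | ite_true _ _ hp => obtain ⟨rfl, rfl⟩ := ih hp; exact ⟨rfl, rfl⟩
    | ite_false _ hb' _ => exact absurd hb hb'
  | ite_false _ hb _ ih =>
    cases h₂ with
    | ite_true _ hb' _ => exact absurd hb' hb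
    | ite_false _ _ hq => obtain ⟨rfl, rfl⟩ := ih hq; exact ⟨rfl, rfl⟩
  | while_false _ hb =>
    cases h₂ with
    | while_false => exact ⟨rfl, rfl⟩
    | while_true hb' _ _ => exact absurd hb' hb
  | while_true hb _ _ ihp ihw =>
    cases h₂ with
    | while_false _ hb' => exact absurd hb hb'
    | while_true _ hp hw =>
      obtain ⟨rfl, rfl⟩ := ihp hp
      obtain ⟨rfl, rfl⟩ := ihw hw
      exact ⟨rfl, rfl⟩

end RAM

/-! ## Fully dynamic streams of points -/

namespace Dynamic

/-- An update of a fully dynamic stream. The machine cannot hold a point of an arbitrary metric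
space, so points are referred to by names, which are natural numbers; a map `pt : ℕ → X` says
which point a name stands for. -/
inductive Update where
  | ins (i : ℕ)
  | del (i : ℕ)

namespace Update

/-- The name of the point that is inserted or deleted. -/
def name : Update → ℕ
  | ins i => i
  | del i => i

/-- The code of the kind of update: `0` for an insertion and `1` for a deletion. -/
def code : Update → ℕ
  | ins _ => 0
  | del _ => 1

/-- The set of active names after an update. -/
def apply (A : Finset ℕ) : Update → Finset ℕ
  | ins i => insert i A
  | del i => A.erase i

/-- An update is legal if it inserts an inactive point or deletes an active point. -/
def Legal (A : Finset ℕ) : Update → Prop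
  | ins i => i ∉ A
  | del i => i ∈ A

end Update

/-- The set of active names after the first `t` updates of a stream. -/
def active (us : List Update) (t : ℕ) : Finset ℕ :=
  (us.take t).foldl Update.apply ∅

/-- Every update of the stream is legal at its time. -/
def Valid (us : List Update) : Prop :=
  ∀ (t : ℕ) (ht : t < us.length), us[t].Legal (active us t)

/-- The points that are active at the same time are pairwise distinct, and at all times all their
distances lie in one interval `[r, Δ r]` with `r > 0`: the aspect ratio is at most `Δ`. -/
def AspectRatioLE {X : Type*} [MetricSpace X] (pt : ℕ → X) (us : List Update) (Δ : ℝ) : Prop :=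
  ∃ r : ℝ, 0 < r ∧ ∀ t ≤ us.length, ∀ i ∈ active us t, ∀ j ∈ active us t, i ≠ j →
    r ≤ dist (pt i) (pt j) ∧ dist (pt i) (pt j) ≤ Δ * r

/-- The distance oracle for the names in `A`; it gives no information about other names. -/
noncomputable def oracle {X : Type*} [MetricSpace X] (pt : ℕ → X) (A : Finset ℕ) (i j : ℕ) : ℝ :=
  if i ∈ A ∧ j ∈ A then dist (pt i) (pt j) else 0

/-- The memory before the first update: register `2` holds `k`, the real registers `0` and `1` hold
`ε` and `Δ`, and everything else is zero. -/
noncomputable def initStore (k : ℕ) (ε Δ : ℝ) : RAM.Store where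
  nreg := Function.update (fun _ => 0) 2 k
  rreg := Function.update (Function.update (fun _ => 0) 0 ε) 1 Δ
  narr := fun _ _ => 0
  rarr := fun _ _ => 0

/-- An update is handed to the machine: its kind in register `0` and the name in register `1`. -/
def feed (u : Update) (s : RAM.Store) : RAM.Store :=
  (s.setN 0 u.code).setN 1 u.name

/-- The names of the centers that the memory holds: their number is in register `3`, and they are
listed in the first cells of array `0`. -/
def centers (s : RAM.Store) : List ℕ :=
  (List.range (s.nreg 3)).map (s.narr 0)

/-- `IsRun P pt k ε Δ us σ τ`: on the stream `us`, the program `P`, which is executed once for every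
update, halts each time; `σ t` is the memory after the first `t` updates, and `τ t` is the time
that is spent on the update `us[t]`. While an update is processed, the oracle answers distance
queries between active points, where the point that is inserted or deleted counts as active. -/
def IsRun {X : Type*} [MetricSpace X] (P : RAM.Cmd) (pt : ℕ → X) (k : ℕ) (ε Δ : ℝ)
    (us : List Update) (σ : ℕ → RAM.Store) (τ : ℕ → ℕ) : Prop :=
  σ 0 = initStore k ε Δ ∧
  ∀ (t : ℕ) (ht : t < us.length),
    RAM.Exec (oracle pt (insert us[t].name (active us t))) P (feed us[t] (σ t)) (τ t) (σ (t + 1))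

end Dynamic

/-! ## A weakest-precondition calculus with running times -/

/-! The algorithm works with the thresholds `θ_g = λ ρ^g`, `g < G`, where `ρ = 1 + ε/2`. The scale
`λ` is the first distance seen between two active points, divided by `2Δ`. So `θ_0` lies below every
distance and `θ_{G-1}` above every distance, and `G = O(log Δ)`. Each guess has a binary tree in
heap numbering, with children `2v` and `2v + 1`. Every active point is stored at a node of its own,
and freed nodes are reused. Hence there are at most `n` nodes, and every path to the root has at
most `⌊log₂ n⌋ + 1` nodes.

The elements of a node are the point stored there and the centers of its two children, at most `1 +
2(k + 1)` in all. Each node runs the greedy rule: an element that is far (distance above the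
threshold) from all centers becomes a center, until there are `k + 1` centers.

Quality. The output is the list of root centers of the first guess `g` in which no node has `k + 1`
centers. There every active point reaches a root center by a chain of near centers, one per level
(`Good.exists_center`), so its distance is at most `(⌊log₂ n⌋ + 1) θ_g`. If `g > 0`, some node of
guess `g - 1` has `k + 1` centers at pairwise distance above `θ_{g-1}`, so `OPT ≥ θ_{g-1} / 2`
(`Good.le_opt`), and the ratio is `2ρ = 2 + ε` per level. If `g = 0`, near points coincide and the
cost is zero. The last guess never overflows (`exists_no_overflow`).

Time. Each element remembers a position `P`: the first `P` centers of its node are known to be far.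
Lists of centers keep their order, so an element never meets a far center twice. A deletion removes
the name from the blocks on one path and rescans them from the bottom up, and an insertion scans the
path in the same way. Each node hands its new centers to its parent. After an insertion at most one
element per node is unsettled, which gives `O(k)` comparisons per node; after a deletion `O(k²)` is
a crude bound.

For the amortized bound the potential is the number of comparisons still possible, `∑ (nC - P)`. A
new center raises it by at most `2k + 3` in its own node and by at most `2k + 3` as a new element of
the parent. The number of centers ever created is the final number, at most `|A| r` per guess, plus
the number removed, at most `r` per deletion and guess, where `r = ⌊log₂ n⌋ + 1`. So the comparisons
are `O(k r G)` per update on average (`wp_insertPath`, `sum_le_of_potential`). The factor `log k` of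
the claim is slack.

The program is verified in a total-correctness calculus that carries the running time; the
combinatorics of blocks and trees is proved apart from the memory. -/

namespace RAM

/-- The program `p` started in `s` halts, and the running time and the final store satisfy `Q`. -/
def wp (d : ℕ → ℕ → ℝ) (p : Cmd) (Q : ℕ → Store → Prop) (s : Store) : Prop :=
  ∃ t s', Exec d p s t s' ∧ Q t s'

/-! ### Write sets and frames. -/

namespace Cmd

/-- The registers of natural numbers that a program may write. -/
def nregs : Cmd → List ℕ
  | skip => []
  | setN x _ => [x]
  | setR _ _ => []
  | putN _ _ _ => []
  | putR _ _ _ => []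
  | seq p q => p.nregs ++ q.nregs
  | ite _ p q => p.nregs ++ q.nregs
  | .while _ p => p.nregs

/-- The registers of real numbers that a program may write. -/
def rregs : Cmd → List ℕ
  | skip => []
  | setN _ _ => []
  | setR x _ => [x]
  | putN _ _ _ => []
  | putR _ _ _ => []
  | seq p q => p.rregs ++ q.rregs
  | ite _ p q => p.rregs ++ q.rregs
  | .while _ p => p.rregs

/-- The arrays of natural numbers that a program may write. -/
def narrs : Cmd → List ℕ
  | skip => []
  | setN _ _ => []
  | setR _ _ => []
  | putN a _ _ => [a]
  | putR _ _ _ => []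
  | seq p q => p.narrs ++ q.narrs
  | ite _ p q => p.narrs ++ q.narrs
  | .while _ p => p.narrs

end Cmd

/-- The stores `s` and `s'` agree on all memory that `p` does not write. -/
structure Frame (p : Cmd) (s s' : Store) : Prop where
  nreg : ∀ x, x ∉ p.nregs → s'.nreg x = s.nreg x
  rreg : ∀ x, x ∉ p.rregs → s'.rreg x = s.rreg x
  narr : ∀ a, a ∉ p.narrs → s'.narr a = s.narr a

theorem Frame.refl (p : Cmd) (s : Store) : Frame p s s :=
  ⟨fun _ _ => rfl, fun _ _ => rfl, fun _ _ => rfl⟩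

theorem Frame.trans {p : Cmd} {s s' s'' : Store} (h : Frame p s s') (h' : Frame p s' s'') :
    Frame p s s'' :=
  ⟨fun x hx => (h'.nreg x hx).trans (h.nreg x hx), fun x hx => (h'.rreg x hx).trans (h.rreg x hx),
    fun x hx => (h'.narr x hx).trans (h.narr x hx)⟩

theorem Frame.mono {p q : Cmd} {s s' : Store} (h : Frame p s s')
    (h1 : ∀ x, x ∈ p.nregs → x ∈ q.nregs) (h2 : ∀ x, x ∈ p.rregs → x ∈ q.rregs)
    (h3 : ∀ x, x ∈ p.narrs → x ∈ q.narrs) : Frame q s s' :=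
  ⟨fun x hx => h.nreg x fun hp => hx (h1 x hp), fun x hx => h.rreg x fun hp => hx (h2 x hp),
    fun x hx => h.narr x fun hp => hx (h3 x hp)⟩

/-- The write sets are computed from the syntax, so later claims that a register or an array is
untouched reduce to decidable facts about short lists. -/
theorem Exec.frame {d : ℕ → ℕ → ℝ} {p : Cmd} {s s' : Store} {t : ℕ} (h : Exec d p s t s') :
    Frame p s s' := by
  induction h with
  | skip s => exact .refl _ _
  | setN s x e =>
    refine ⟨fun y hy => ?_, fun _ _ => rfl, fun _ _ => rfl⟩
    simp only [Cmd.nregs, List.mem_singleton] at hy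
    simp [Store.setN, hy]
  | setR s x e =>
    refine ⟨fun _ _ => rfl, fun y hy => ?_, fun _ _ => rfl⟩
    simp only [Cmd.rregs, List.mem_singleton] at hy
    simp [Store.setR, hy]
  | putN s a i e =>
    refine ⟨fun _ _ => rfl, fun _ _ => rfl, fun y hy => ?_⟩
    simp only [Cmd.narrs, List.mem_singleton] at hy
    simp [Store.putN, hy]
  | putR s a i e => exact ⟨fun _ _ => rfl, fun _ _ => rfl, fun _ _ => rfl⟩
  | seq _ _ ihp ihq =>
    refine .trans (ihp.mono ?_ ?_ ?_) (ihq.mono ?_ ?_ ?_) <;>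
      simp +contextual [Cmd.nregs, Cmd.rregs, Cmd.narrs]
  | ite_true _ _ _ ih | ite_false _ _ _ ih =>
    refine ih.mono ?_ ?_ ?_ <;> simp +contextual [Cmd.nregs, Cmd.rregs, Cmd.narrs]
  | while_false _ _ => exact .refl _ _
  | while_true _ _ _ ihp ihw => exact .trans (ihp.mono (fun _ => id) (fun _ => id) (fun _ => id)) ihw

section wp

variable {d : ℕ → ℕ → ℝ} {Q R : ℕ → Store → Prop} {s : Store}

/-- The frame is passed to the continuation, so the specification of a program part only has to
mention memory that the part changes. -/
theorem wp.mono {p : Cmd} (h : wp d p Q s) (hQ : ∀ t s', Frame p s s' → Q t s' → R t s') :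
    wp d p R s := by
  obtain ⟨t, s', he, hq⟩ := h
  exact ⟨t, s', he, hQ t s' he.frame hq⟩

@[simp] theorem wp_skip : wp d .skip Q s ↔ Q 1 s :=
  ⟨by rintro ⟨_, _, ⟨⟩, h⟩; exact h, fun h => ⟨_, _, .skip s, h⟩⟩

@[simp] theorem wp_setN {x e} : wp d (.setN x e) Q s ↔ Q (e.time + 1) (s.setN x (e.eval s)) :=
  ⟨by rintro ⟨_, _, ⟨⟩, h⟩; exact h, fun h => ⟨_, _, .setN s x e, h⟩⟩

@[simp] theorem wp_setR {x e} : wp d (.setR x e) Q s ↔ Q (e.time + 1) (s.setR x (e.eval d s)) :=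
  ⟨by rintro ⟨_, _, ⟨⟩, h⟩; exact h, fun h => ⟨_, _, .setR s x e, h⟩⟩

@[simp] theorem wp_putN {a i e} :
    wp d (.putN a i e) Q s ↔ Q (i.time + e.time + 1) (s.putN a (i.eval s) (e.eval s)) :=
  ⟨by rintro ⟨_, _, ⟨⟩, h⟩; exact h, fun h => ⟨_, _, .putN s a i e, h⟩⟩

@[simp] theorem wp_seq {p q} :
    wp d (.seq p q) Q s ↔ wp d p (fun t s' => wp d q (fun t' s'' => Q (t + t') s'') s') s := by
  constructor
  · rintro ⟨_, _, ⟨⟩, h⟩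
    exact ⟨_, _, ‹_›, _, _, ‹_›, h⟩
  · rintro ⟨t, s', hp, t', s'', hq, h⟩
    exact ⟨_, _, .seq hp hq, h⟩

@[simp] theorem wp_ite {b p q} :
    wp d (.ite b p q) Q s ↔
      (b.Holds d s → wp d p (fun t s' => Q (b.time + t + 1) s') s) ∧
      (¬ b.Holds d s → wp d q (fun t s' => Q (b.time + t + 1) s') s) := by
  constructor
  · rintro ⟨_, _, he, h⟩
    cases he with
    | ite_true _ hb hp => exact ⟨fun _ => ⟨_, _, hp, h⟩, fun hb' => absurd hb hb'⟩
    | ite_false _ hb hp => exact ⟨fun hb' => absurd hb' hb, fun _ => ⟨_, _, hp, h⟩⟩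
  · rintro ⟨h1, h2⟩
    by_cases hb : b.Holds d s
    · obtain ⟨t, s', hp, h⟩ := h1 hb
      exact ⟨_, _, .ite_true _ hb hp, h⟩
    · obtain ⟨t, s', hp, h⟩ := h2 hb
      exact ⟨_, _, .ite_false _ hb hp, h⟩

/-- Loops: `I t s'` is an invariant of the time `t` spent so far and the store `s'`, and `μ` is a
quantity that decreases in each round. -/
theorem wp_while {b : BExp} {p : Cmd} (I : ℕ → Store → Prop) (μ : Store → ℕ) (h0 : I 0 s)
    (hstep : ∀ t s', Frame p s s' → I t s' → b.Holds d s' →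
      wp d p (fun t' s'' => I (t + (b.time + t' + 1)) s'' ∧ μ s'' < μ s') s')
    (hexit : ∀ t s', Frame p s s' → I t s' → ¬ b.Holds d s' → Q (t + (b.time + 1)) s') :
    wp d (.while b p) Q s := by
  suffices H : ∀ m t s', μ s' = m → Frame p s s' → I t s' →
      wp d (.while b p) (fun t' s'' => Q (t + t') s'') s' by
    simpa using H (μ s) 0 s rfl (.refl _ _) h0
  intro m
  induction m using Nat.strong_induction_on with
  | _ m ih =>
    intro t s' hm hf hI
    by_cases hb : b.Holds d s'
    · obtain ⟨t1, s1, he, hI1, hμ⟩ := hstep t s' hf hI hb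
      obtain ⟨t2, s2, he2, hQ⟩ := ih _ (hm ▸ hμ) _ s1 rfl (hf.trans he.frame) hI1
      refine ⟨_, _, .while_true hb he he2, ?_⟩
      convert hQ using 1
      ring
    · exact ⟨_, _, .while_false _ hb, hexit t s' hf hI hb⟩

end wp

section store

variable (s : Store) (x y a b i j v : ℕ) (r : ℝ)

@[simp] theorem setN_nreg : (s.setN x v).nreg y = if y = x then v else s.nreg y := by
  simp [Store.setN, Function.update_apply]
@[simp] theorem setN_rreg : (s.setN x v).rreg = s.rreg := rfl
@[simp] theorem setN_narr : (s.setN x v).narr = s.narr := rfl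
@[simp] theorem setR_nreg : (s.setR x r).nreg = s.nreg := rfl
@[simp] theorem setR_rreg : (s.setR x r).rreg y = if y = x then r else s.rreg y := by
  simp [Store.setR, Function.update_apply]
@[simp] theorem setR_narr : (s.setR x r).narr = s.narr := rfl
@[simp] theorem putN_nreg : (s.putN a i v).nreg = s.nreg := rfl
@[simp] theorem putN_rreg : (s.putN a i v).rreg = s.rreg := rfl
@[simp] theorem putN_narr :
    (s.putN a i v).narr b j = if b = a then (if j = i then v else s.narr b j) else s.narr b j := by
  by_cases h : b = a
  · subst h; simp [Store.putN, Function.update_apply]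
  · simp [Store.putN, h]

theorem putN_narr_ne (h : b ≠ a) : (s.putN a i v).narr b = s.narr b := by
  simp [Store.putN, h]

end store

attribute [simp] NExp.eval NExp.time RExp.eval RExp.time BExp.Holds BExp.time

end RAM

/-! ## The removal of a name from a block -/

namespace RAM

infixr:60 " ;; " => Cmd.seq

end RAM

namespace DynKCenter

open RAM

/-- The index of the entry `j` of a list from which the entry `i` was removed. -/
def skipIdx (i j : ℕ) : ℕ := if j < i then j else j + 1

/-- Removes the name in register `1` from the list of centers of the block at register `10`;
register `13` receives the position of the name, or the length of the list. -/
def delCentersLoop : Cmd :=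
  .while (.nle (.add (.reg 11) (.lit 1)) (.get 6 (.reg 10)))
    (.ite (.neq (.get 7 (.add (.reg 10) (.reg 11))) (.reg 1))
      (.setN 13 (.reg 12))
      (.putN 7 (.add (.reg 10) (.reg 12)) (.get 7 (.add (.reg 10) (.reg 11))) ;;
        .setN 12 (.add (.reg 12) (.lit 1))) ;;
    .setN 11 (.add (.reg 11) (.lit 1)))

/-- Compaction in place: register `11` reads, register `12` writes behind it, and the order of the
survivors is kept. The entries are distinct, so at most one is dropped; `i = n` encodes that the
name does not occur. -/
theorem wp_delCentersLoop {d : ℕ → ℕ → ℝ} {s : Store} {A n p : ℕ} (hA : s.nreg 10 = A)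
    (hp : s.nreg 1 = p) (h11 : s.nreg 11 = 0) (h12 : s.nreg 12 = 0) (h13 : s.nreg 13 = n)
    (hn : s.narr 6 A = n)
    (hinj : ∀ i < n, ∀ j < n, s.narr 7 (A + i) = s.narr 7 (A + j) → i = j) :
    wp d delCentersLoop (fun t s' => t ≤ 40 * n + 10 ∧
      ∃ i, i ≤ n ∧ s'.nreg 13 = i ∧ s'.nreg 12 = (if i < n then n - 1 else n) ∧
        (∀ j < n, s.narr 7 (A + j) = p ↔ j = i) ∧
        (∀ j < s'.nreg 12, s'.narr 7 (A + j) = s.narr 7 (A + skipIdx i j)) ∧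
        (∀ y, y < A ∨ A + n ≤ y → s'.narr 7 y = s.narr 7 y)) s := by
  -- Either the name has not been met and register `13` still holds its initial value `n`, or it was
  -- met at position `13` and the write index is one behind the read index.
  refine wp_while (fun t s' => t ≤ 40 * s'.nreg 11 ∧ s'.nreg 11 ≤ n ∧
    ((s'.nreg 13 = n ∧ s'.nreg 12 = s'.nreg 11 ∧ ∀ x < s'.nreg 11, s.narr 7 (A + x) ≠ p) ∨
      (s'.nreg 13 < s'.nreg 11 ∧ s'.nreg 12 + 1 = s'.nreg 11 ∧
        s.narr 7 (A + s'.nreg 13) = p)) ∧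
    (∀ x < s'.nreg 12, s'.narr 7 (A + x) = s.narr 7 (A + skipIdx (s'.nreg 13) x)) ∧
    (∀ y, y < A ∨ A + s'.nreg 11 ≤ y → s'.narr 7 y = s.narr 7 y))
    (fun s' => n - s'.nreg 11) ?_ ?_ ?_
  · simp [h11, h12, h13]
  · rintro t s' hf ⟨ht, hj, hcase, hC, hout⟩ hb
    have f10 := hf.nreg 10 (by decide)
    have f1 := hf.nreg 1 (by decide)
    have f6 := hf.narr 6 (by decide)
    rw [hA] at f10
    rw [hp] at f1
    simp [f10, f6, hn] at hb
    have hcj : s'.narr 7 (A + s'.nreg 11) = s.narr 7 (A + s'.nreg 11) := hout _ (by omega)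
    simp only [wp_seq, wp_ite, wp_setN, wp_putN]
    simp only [BExp.Holds, NExp.eval, BExp.time, NExp.time, setN_nreg, putN_nreg, f10, f1, hcj,
      setN_narr]
    refine ⟨fun he => ?_, fun he => ?_⟩
    · simp
      refine ⟨⟨by omega, by omega, .inr ⟨?_, ?_, ?_⟩, ?_, ?_⟩, by omega⟩
      · rcases hcase with h | h
        · omega
        · have := hinj (s'.nreg 11) (by omega) (s'.nreg 13) (by omega) (by rw [he, h.2.2])
          omega
      · rcases hcase with h | h
        · omega
        · have := hinj (s'.nreg 11) (by omega) (s'.nreg 13) (by omega) (by rw [he, h.2.2])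
          omega
      · rcases hcase with h | h
        · rw [h.2.1, he]
        · have := hinj (s'.nreg 11) (by omega) (s'.nreg 13) (by omega) (by rw [he, h.2.2])
          omega
      · rcases hcase with h | h
        · intro x hx
          rw [hC x hx]
          rw [skipIdx, skipIdx, if_pos (by omega), if_pos (by omega)]
        · have := hinj (s'.nreg 11) (by omega) (s'.nreg 13) (by omega) (by rw [he, h.2.2])
          omega
      · intro y hy
        exact hout y (by omega)
    · simp
      refine ⟨⟨by omega, by omega, ?_, ?_, ?_⟩, by omega⟩
      · rcases hcase with h | h
        · refine .inl ⟨h.1, by omega, fun x hx => ?_⟩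
          rcases Nat.lt_succ_iff_lt_or_eq.1 (Nat.lt_succ_of_le hx) with h' | rfl
          · exact h.2.2 x h'
          · exact he
        · exact .inr ⟨by omega, by omega, h.2.2⟩
      · intro x hx
        split_ifs with h1
        · subst h1
          rcases hcase with h | h
          · rw [skipIdx, if_pos (by omega), h.2.1]
          · rw [skipIdx, if_neg (by omega), h.2.1]
        · exact hC x (by omega)
      · intro y hy
        have : y ≠ A + s'.nreg 12 := by omega
        simp only [this, if_false]
        exact hout y (by omega)
  · rintro t s' hf ⟨ht, hj, hcase, hC, hout⟩ hb
    have f10 := hf.nreg 10 (by decide)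
    have f6 := hf.narr 6 (by decide)
    rw [hA] at f10
    simp [f10, f6, hn] at hb
    have hjn : s'.nreg 11 = n := by omega
    rw [hjn] at hcase hout
    refine ⟨by simp; omega, s'.nreg 13, ?_, rfl, ?_, ?_, hC, hout⟩
    · omega
    · rcases hcase with h | h
      · simp [h]
      · simp [h.1]; omega
    · rcases hcase with h | h
      · intro j hj
        exact ⟨fun h' => absurd h' (h.2.2 j hj), by omega⟩
      · intro j hj
        exact ⟨fun h' => hinj _ hj _ (by omega) (by rw [h', h.2.2]), fun h' => h' ▸ h.2.2⟩


/-- The new position of an element whose list of centers lost the entry `i`. -/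
def decPos (i q : ℕ) : ℕ := q - (1 - (i + 1 - q))

/-- Truncated subtraction replaces a branch. A center lost before the recorded position shifts it
down. A center lost at or after it leaves it, and an element assigned to the lost center resumes its
search at the successor. For `i = nC`, when no center is lost, valid positions do not change. -/
theorem decPos_eq (i q : ℕ) : decPos i q = if i < q then q - 1 else q := by
  unfold decPos
  split_ifs <;> omega

/-- Removes the name in register `1` from the list of elements of the block at register `10` and
corrects the positions, where register `13` holds the former position of the name among the
centers. -/
def delElemsLoop : Cmd :=
  .while (.nle (.add (.reg 11) (.lit 1)) (.get 8 (.reg 10)))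
    (.ite (.neq (.get 9 (.add (.reg 10) (.reg 11))) (.reg 1))
      .skip
      (.putN 9 (.add (.reg 10) (.reg 12)) (.get 9 (.add (.reg 10) (.reg 11))) ;;
        .putN 10 (.add (.reg 10) (.reg 12))
          (.sub (.get 10 (.add (.reg 10) (.reg 11)))
            (.sub (.lit 1) (.sub (.add (.reg 13) (.lit 1))
              (.get 10 (.add (.reg 10) (.reg 11)))))) ;;
        .setN 12 (.add (.reg 12) (.lit 1))) ;;
    .setN 11 (.add (.reg 11) (.lit 1)))

theorem wp_delElemsLoop {d : ℕ → ℕ → ℝ} {s : Store} {A n p i : ℕ} (hA : s.nreg 10 = A)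
    (hp : s.nreg 1 = p) (h11 : s.nreg 11 = 0) (h12 : s.nreg 12 = 0) (h13 : s.nreg 13 = i)
    (hn : s.narr 8 A = n)
    (hinj : ∀ i < n, ∀ j < n, s.narr 9 (A + i) = s.narr 9 (A + j) → i = j) :
    wp d delElemsLoop (fun t s' => t ≤ 60 * n + 10 ∧
      ∃ l, l ≤ n ∧ s'.nreg 12 = (if l < n then n - 1 else n) ∧
        (∀ j < n, s.narr 9 (A + j) = p ↔ j = l) ∧
        (∀ j < s'.nreg 12, s'.narr 9 (A + j) = s.narr 9 (A + skipIdx l j) ∧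
          s'.narr 10 (A + j) = decPos i (s.narr 10 (A + skipIdx l j))) ∧
        (∀ y, y < A ∨ A + n ≤ y → s'.narr 9 y = s.narr 9 y ∧ s'.narr 10 y = s.narr 10 y)) s := by
  refine wp_while (fun t s' => t ≤ 60 * s'.nreg 11 ∧ s'.nreg 11 ≤ n ∧ ∃ l,
    ((l = n ∧ s'.nreg 12 = s'.nreg 11 ∧ ∀ x < s'.nreg 11, s.narr 9 (A + x) ≠ p) ∨
      (l < s'.nreg 11 ∧ s'.nreg 12 + 1 = s'.nreg 11 ∧ s.narr 9 (A + l) = p)) ∧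
    (∀ x < s'.nreg 12, s'.narr 9 (A + x) = s.narr 9 (A + skipIdx l x) ∧
      s'.narr 10 (A + x) = decPos i (s.narr 10 (A + skipIdx l x))) ∧
    (∀ y, y < A ∨ A + s'.nreg 11 ≤ y → s'.narr 9 y = s.narr 9 y ∧ s'.narr 10 y = s.narr 10 y))
    (fun s' => n - s'.nreg 11) ?_ ?_ ?_
  · simp [h11, h12]
  · rintro t s' hf ⟨ht, hj, l, hcase, hU, hout⟩ hb
    have f10 := hf.nreg 10 (by decide)
    have f1 := hf.nreg 1 (by decide)
    have f13 := hf.nreg 13 (by decide)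
    have f8 := hf.narr 8 (by decide)
    rw [hA] at f10
    rw [hp] at f1
    rw [h13] at f13
    simp [f10, f8, hn] at hb
    have hcj : s'.narr 9 (A + s'.nreg 11) = s.narr 9 (A + s'.nreg 11) := (hout _ (by omega)).1
    have hpj : s'.narr 10 (A + s'.nreg 11) = s.narr 10 (A + s'.nreg 11) := (hout _ (by omega)).2
    simp only [wp_seq, wp_ite, wp_setN, wp_putN, wp_skip]
    simp only [BExp.Holds, NExp.eval, BExp.time, NExp.time, setN_nreg, putN_nreg, f10, f1, f13, hcj,
      setN_narr]
    refine ⟨fun he => ?_, fun he => ?_⟩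
    · simp
      have hw : l = n ∧ s'.nreg 12 = s'.nreg 11 ∧ ∀ x < s'.nreg 11, s.narr 9 (A + x) ≠ p := by
        rcases hcase with h | h
        · exact h
        · have := hinj (s'.nreg 11) (by omega) l (by omega) (by rw [he, h.2.2])
          omega
      refine ⟨⟨by omega, by omega, s'.nreg 11, .inr ⟨by omega, by omega, he⟩, ?_, ?_⟩, by omega⟩
      · intro x hx
        have := hU x hx
        rwa [skipIdx, if_pos (by omega)] at this ⊢
      · intro y hy
        exact hout y (by omega)
    · simp
      refine ⟨⟨by omega, by omega, l, ?_, ?_, ?_⟩, by omega⟩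
      · rcases hcase with h | h
        · refine .inl ⟨h.1, by omega, fun x hx => ?_⟩
          rcases Nat.lt_succ_iff_lt_or_eq.1 (Nat.lt_succ_of_le hx) with h' | rfl
          · exact h.2.2 x h'
          · exact he
        · exact .inr ⟨by omega, by omega, h.2.2⟩
      · intro x hx
        by_cases h1 : x = s'.nreg 12
        · subst h1
          have : skipIdx l (s'.nreg 12) = s'.nreg 11 := by
            rcases hcase with h | h
            · rw [skipIdx, if_pos (by omega), h.2.1]
            · rw [skipIdx, if_neg (by omega), h.2.1]
          simp [this, hpj, decPos]
        · simp only [h1, if_false]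
          exact hU x (by omega)
      · intro y hy
        have : y ≠ A + s'.nreg 12 := by omega
        simp only [this, if_false]
        exact hout y (by omega)
  · rintro t s' hf ⟨ht, hj, l, hcase, hU, hout⟩ hb
    have f10 := hf.nreg 10 (by decide)
    have f8 := hf.narr 8 (by decide)
    rw [hA] at f10
    simp [f10, f8, hn] at hb
    have hjn : s'.nreg 11 = n := by omega
    rw [hjn] at hcase hout
    refine ⟨by simp; omega, l, by omega, ?_, ?_, hU, hout⟩
    · rcases hcase with h | h
      · simp [h]
      · simp [h.1]; omega
    · rcases hcase with h | h
      · intro j hj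
        exact ⟨fun h' => absurd h' (h.2.2 j hj), by omega⟩
      · intro j hj
        exact ⟨fun h' => hinj _ hj _ (by omega) (by rw [h', h.2.2]), fun h' => h' ▸ h.2.2⟩

/-! ### Blocks in memory and the removal of a name. -/

/-- The part of the data structure that belongs to one guess and one node of the tree: a list `C` of
`nC` centers and a list `U` of `nU` elements, where `P` says for each element how many of the
centers are known to be far from it. -/
@[ext]
structure Blk where
  nC : ℕ
  C : ℕ → ℕ
  nU : ℕ
  U : ℕ → ℕ
  P : ℕ → ℕ

/-- The block at the address `A`. -/
def blk (k : ℕ) (s : Store) (A : ℕ) : Blk where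
  nC := s.narr 6 A
  C j := if j < k + k + 3 then s.narr 7 (A + j) else 0
  nU := s.narr 8 A
  U j := if j < k + k + 3 then s.narr 9 (A + j) else 0
  P j := if j < k + k + 3 then s.narr 10 (A + j) else 0

/-- The stores agree outside of the block at the address `A` and array `5`. -/
def OutsideEq (k A : ℕ) (s s' : Store) : Prop :=
  ∀ a ≠ 5, ∀ y, y < A ∨ A + (k + k + 3) ≤ y → s'.narr a y = s.narr a y

/-- The fields of `blk` are cut off to zero beyond the width `k + k + 3`, so agreement on that
window gives equality of blocks as functions. -/
theorem OutsideEq.blk_eq {k A B : ℕ} {s s' : Store} (h : OutsideEq k A s s')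
    (hB : B + (k + k + 3) ≤ A ∨ A + (k + k + 3) ≤ B) : blk k s' B = blk k s B := by
  have h0 : ∀ a ≠ 5, s'.narr a B = s.narr a B := fun a ha => h a ha B (by omega)
  have h1 : ∀ a ≠ 5, ∀ j < k + k + 3, s'.narr a (B + j) = s.narr a (B + j) :=
    fun a ha j hj => h a ha _ (by omega)
  ext j
  · exact h0 6 (by decide)
  · simp only [blk]; split_ifs with hj; exacts [h1 7 (by decide) j hj, rfl]
  · exact h0 8 (by decide)
  · simp only [blk]; split_ifs with hj; exacts [h1 9 (by decide) j hj, rfl]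
  · simp only [blk]; split_ifs with hj; exacts [h1 10 (by decide) j hj, rfl]

theorem OutsideEq.trans {k A : ℕ} {s s' s'' : Store} (h : OutsideEq k A s s')
    (h' : OutsideEq k A s' s'') : OutsideEq k A s s'' :=
  fun a ha y hy => (h' a ha y hy).trans (h a ha y hy)

/-- The block `b'` arises from `b` by the removal of the name `p`. -/
def Removed (p : ℕ) (b b' : Blk) : Prop :=
  ∃ i ≤ b.nC, ∃ l ≤ b.nU, (∀ j < b.nC, b.C j = p ↔ j = i) ∧ (∀ j < b.nU, b.U j = p ↔ j = l) ∧
    b'.nC = (if i < b.nC then b.nC - 1 else b.nC) ∧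
    b'.nU = (if l < b.nU then b.nU - 1 else b.nU) ∧
    (∀ j < b'.nC, b'.C j = b.C (skipIdx i j)) ∧
    ∀ j < b'.nU, b'.U j = b.U (skipIdx l j) ∧ b'.P j = decPos i (b.P (skipIdx l j))

/-- Finds the block of the node in register `9`. -/
def locate : Cmd :=
  .setN 10 (.add (.add (.get 4 (.reg 9)) (.reg 6)) (.lit 1))

/-- Subtracts the overflow of the current block from the overflow counter of the guess. -/
def subOverflow : Cmd :=
  .putN 5 (.reg 6) (.sub (.get 5 (.reg 6)) (.sub (.get 6 (.reg 10)) (.reg 2)))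

/-- Adds the overflow of the current block to the overflow counter of the guess. -/
def addOverflow : Cmd :=
  .putN 5 (.reg 6) (.add (.get 5 (.reg 6)) (.sub (.get 6 (.reg 10)) (.reg 2)))

/-- Removes the name in register `1` from the block of the node in register `9`. -/
def removeNode : Cmd :=
  locate ;; subOverflow ;; .setN 11 (.lit 0) ;; .setN 12 (.lit 0) ;; .setN 13 (.get 6 (.reg 10)) ;;
  delCentersLoop ;; .putN 6 (.reg 10) (.reg 12) ;; addOverflow ;;
  .setN 11 (.lit 0) ;; .setN 12 (.lit 0) ;; delElemsLoop ;; .putN 8 (.reg 10) (.reg 12)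

/-- The overflow counter is kept as a running sum: the old contribution `nC - k` of this block is
taken out first and the new one is added after the removal. -/
theorem wp_removeNode {d : ℕ → ℕ → ℝ} {s : Store} {A k p : ℕ} (hk : s.nreg 2 = k)
    (hA : s.narr 4 (s.nreg 9) + s.nreg 6 + 1 = A) (hp : s.nreg 1 = p)
    (hC : (blk k s A).nC ≤ k + 1) (hU : (blk k s A).nU ≤ k + k + 3)
    (hCi : ∀ i < (blk k s A).nC, ∀ j < (blk k s A).nC,
      (blk k s A).C i = (blk k s A).C j → i = j)
    (hUi : ∀ i < (blk k s A).nU, ∀ j < (blk k s A).nU,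
      (blk k s A).U i = (blk k s A).U j → i = j) :
    wp d removeNode (fun t s' => t ≤ 200 * (k + k + 3) ∧ Removed p (blk k s A) (blk k s' A) ∧
      OutsideEq k A s s' ∧ (∀ y ≠ s.nreg 6, s'.narr 5 y = s.narr 5 y) ∧
      s'.narr 5 (s.nreg 6) = s.narr 5 (s.nreg 6) - ((blk k s A).nC - k) +
        ((blk k s' A).nC - k)) s := by
  have hC' : s.narr 6 A ≤ k + 1 := hC
  have hU' : s.narr 8 A ≤ k + k + 3 := hU
  have hW : ∀ j < s.narr 6 A, j < k + k + 3 := fun j hj => by omega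
  have hW' : ∀ j < s.narr 8 A, j < k + k + 3 := fun j hj => by omega
  simp only [removeNode, locate, subOverflow, addOverflow, wp_seq, wp_setN, wp_putN]
  simp only [NExp.eval, setN_nreg, hA, hk]
  refine (wp_delCentersLoop (A := A) (n := s.narr 6 A) (p := p) (by simp) (by simp [hp]) (by simp)
    (by simp) (by simp) (by simp) ?_).mono ?_
  · intro i hi j hj h
    refine hCi i hi j hj ?_
    simpa [blk, hW i hi, hW j hj] using h
  rintro t1 s1 f1 ⟨ht1, i, hi, h13, h12, hip, hCs, hCo⟩
  simp only [setN_narr, putN_narr, setN_nreg, putN_nreg] at hip hCs hCo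
  have g2 := f1.nreg 2 (by decide)
  have g10 := f1.nreg 10 (by decide)
  have g6 := f1.nreg 6 (by decide)
  have g1 := f1.nreg 1 (by decide)
  have a8 := fun y => congrFun (f1.narr 8 (by decide)) y
  have a9 := fun y => congrFun (f1.narr 9 (by decide)) y
  have a10 := fun y => congrFun (f1.narr 10 (by decide)) y
  have a6 := fun y => congrFun (f1.narr 6 (by decide)) y
  have a5 := fun y => congrFun (f1.narr 5 (by decide)) y
  simp [hk, hp] at g2 g10 g6 g1 a8 a9 a10 a6 a5
  refine (wp_delElemsLoop (A := A) (n := s.narr 8 A) (p := p) (i := i) (by simp [g10])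
    (by simp [g1]) (by simp) (by simp) (by simp [h13]) (by simp [a8]) ?_).mono ?_
  · intro i hi j hj h
    refine hUi i hi j hj ?_
    simpa [blk, hW' i hi, hW' j hj, a9] using h
  rintro t2 s2 f2 ⟨ht2, l, hl, h12', hlp, hUs, hUo⟩
  have b10 := f2.nreg 10 (by decide)
  have c7 := fun y => congrFun (f2.narr 7 (by decide)) y
  have c8 := fun y => congrFun (f2.narr 8 (by decide)) y
  have c6 := fun y => congrFun (f2.narr 6 (by decide)) y
  have c5 := fun y => congrFun (f2.narr 5 (by decide)) y
  simp [g10, g2, g6, a5, a6, a8, h12] at b10 c7 c8 c6 c5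
  simp [a9, a10] at hlp hUs hUo hip hCs hCo
  have hskip : ∀ i j n, i ≤ n → j < (if i < n then n - 1 else n) → skipIdx i j < n := by
    intro i j n hi hj
    unfold skipIdx
    split_ifs at hj ⊢ <;> omega
  refine ⟨by simp; omega, ⟨i, hi, l, hl, ?_, ?_, ?_, ?_, ?_, ?_⟩, ?_, ?_, ?_⟩
  · intro j hj
    simpa [blk, hW j hj] using hip j hj
  · intro j hj
    simpa [blk, hW' j hj] using hlp j hj
  · simp [blk, c6, b10]; rfl
  · simp [blk, b10, h12']; rfl
  · intro j hj
    replace hj : j < if i < s.narr 6 A then s.narr 6 A - 1 else s.narr 6 A := by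
      simpa [blk, c6, b10] using hj
    have h1 := hskip i j _ hi hj
    have h2 : j < s.narr 6 A := by split_ifs at hj <;> omega
    simp [blk, hW _ h1, hW _ h2, c7]
    exact hCs j (h12 ▸ hj)
  · intro j hj
    replace hj : j < if l < s.narr 8 A then s.narr 8 A - 1 else s.narr 8 A := by
      simpa [blk, b10, h12'] using hj
    have h1 := hskip l j _ hl hj
    have h2 : j < s.narr 8 A := by split_ifs at hj <;> omega
    simp [blk, hW' _ h1, hW' _ h2]
    exact hUs j (h12' ▸ hj)
  · intro a ha y hy
    simp only [putN_narr, b10]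
    have hyA : y ≠ A := by omega
    by_cases e8 : a = 8
    · subst e8; simp [hyA, c8]
    by_cases e9 : a = 9
    · subst e9; simpa using (hUo y (by omega)).1
    by_cases e10 : a = 10
    · subst e10; simpa using (hUo y (by omega)).2
    by_cases e7 : a = 7
    · subst e7; simp [c7]; exact hCo y (by omega)
    by_cases e6 : a = 6
    · subst e6; simp [c6, hyA]
    have q2 := congrFun (f2.narr a (by simp [delElemsLoop, Cmd.narrs]; omega)) y
    have q1 := congrFun (f1.narr a (by simp [delCentersLoop, Cmd.narrs]; omega)) y
    simp [e6, ha] at q2 q1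
    simp [e8, q2, q1]
  · intro y hy
    simp [c5, hy]
  · simp [c5, blk, c6, b10]

end DynKCenter

namespace DynKCenter
open RAM

/-! ## The combinatorics of a block -/

/-- Membership in the list of centers. -/
def Blk.memC (b : Blk) (e : ℕ) : Prop := ∃ j < b.nC, b.C j = e

/-- Membership in the list of elements. -/
def Blk.memU (b : Blk) (e : ℕ) : Prop := ∃ j < b.nU, b.U j = e

/-- The number of comparisons between an element and a center that may still be made. -/
def Blk.pending (b : Blk) : ℕ := ∑ j ∈ Finset.range b.nU, (b.nC - b.P j)

/-- The invariants of a block that always hold. -/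
structure Weak (near : ℕ → ℕ → Prop) (k : ℕ) (b : Blk) : Prop where
  injU : ∀ i < b.nU, ∀ j < b.nU, b.U i = b.U j → i = j
  sub : ∀ e, b.memC e → b.memU e
  nC_le : b.nC ≤ k + 1
  farC : ∀ j < b.nC, ∀ i < j, ¬ near (b.C i) (b.C j)
  pos_le : ∀ i < b.nU, b.P i ≤ b.nC
  farP : ∀ i < b.nU, ∀ j < b.P i, ¬ near (b.U i) (b.C j)

/-- The element `i` of a block is assigned to a near center, or it waits because there are too many
centers. -/
def Settled (near : ℕ → ℕ → Prop) (k : ℕ) (b : Blk) (i : ℕ) : Prop :=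
  (b.P i < b.nC ∧ near (b.U i) (b.C (b.P i))) ∨ (b.P i = b.nC ∧ b.nC = k + 1)

variable {near : ℕ → ℕ → Prop} {k p : ℕ} {b b' : Blk}

/-- Two equal entries would be centers that are far from each other, against reflexivity of `near`.
-/
theorem Weak.injC (h : Weak near k b) (hr : ∀ e, near e e) :
    ∀ i < b.nC, ∀ j < b.nC, b.C i = b.C j → i = j := by
  intro i hi j hj hij
  rcases lt_trichotomy i j with h' | h' | h'
  · exact absurd (hij ▸ hr _) (h.farC j hj i h')
  · exact h'
  · exact absurd (hij ▸ hr _) (h.farC i hi j h')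

theorem Weak.congr_near {near' : ℕ → ℕ → Prop} (h : Weak near k b)
    (hn : ∀ e f, b.memU e → b.memU f → (near' e f → near e f)) : Weak near' k b where
  injU := h.injU
  sub := h.sub
  nC_le := h.nC_le
  farC j hj i hi hc := h.farC j hj i hi
    (hn _ _ (h.sub _ ⟨i, by omega, rfl⟩) (h.sub _ ⟨j, hj, rfl⟩) hc)
  pos_le := h.pos_le
  farP i hi j hj hc := h.farP i hi j hj (hn _ _ ⟨i, hi, rfl⟩
    (h.sub _ ⟨j, hj.trans_le (h.pos_le i hi), rfl⟩) hc)

theorem skipIdx_lt {i j n : ℕ} (hi : i ≤ n) (hj : j < if i < n then n - 1 else n) :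
    skipIdx i j < n := by
  unfold skipIdx
  split_ifs at hj ⊢ <;> omega

theorem skipIdx_ne (i j : ℕ) : skipIdx i j ≠ i := by
  unfold skipIdx
  split_ifs <;> omega

theorem skipIdx_inj {i j j' : ℕ} (h : skipIdx i j = skipIdx i j') : j = j' := by
  unfold skipIdx at h
  split_ifs at h <;> omega

theorem exists_skipIdx {i j n : ℕ} (hj : j < n) (hij : j ≠ i) (hi : i ≤ n) :
    ∃ j' < (if i < n then n - 1 else n), skipIdx i j' = j := by
  by_cases h : j < i
  · exact ⟨j, by split_ifs <;> omega, by simp [skipIdx, h]⟩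
  · refine ⟨j - 1, by split_ifs <;> omega, ?_⟩
    unfold skipIdx
    split_ifs <;> omega

theorem Removed.memC (h : Removed p b b') (e : ℕ) : b'.memC e ↔ b.memC e ∧ e ≠ p := by
  obtain ⟨i, hi, l, hl, hCp, hUp, hnC, hnU, hC, hU⟩ := h
  constructor
  · rintro ⟨j, hj, rfl⟩
    have := skipIdx_lt hi (hnC ▸ hj)
    rw [hC j hj]
    exact ⟨⟨_, this, rfl⟩, fun h' => skipIdx_ne i j ((hCp _ this).1 h')⟩
  · rintro ⟨⟨j, hj, rfl⟩, hne⟩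
    obtain ⟨j', hj', rfl⟩ := exists_skipIdx hj (fun h' => hne ((hCp j hj).2 h')) hi
    exact ⟨j', hnC ▸ hj', hC _ (hnC ▸ hj')⟩

theorem Removed.memU (h : Removed p b b') (e : ℕ) : b'.memU e ↔ b.memU e ∧ e ≠ p := by
  obtain ⟨i, hi, l, hl, hCp, hUp, hnC, hnU, hC, hU⟩ := h
  constructor
  · rintro ⟨j, hj, rfl⟩
    have := skipIdx_lt hl (hnU ▸ hj)
    rw [(hU j hj).1]
    exact ⟨⟨_, this, rfl⟩, fun h' => skipIdx_ne l j ((hUp _ this).1 h')⟩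
  · rintro ⟨⟨j, hj, rfl⟩, hne⟩
    obtain ⟨j', hj', rfl⟩ := exists_skipIdx hj (fun h' => hne ((hUp j hj).2 h')) hl
    exact ⟨j', hnU ▸ hj', (hU _ (hnU ▸ hj')).1⟩

theorem Removed.nC_le (h : Removed p b b') : b'.nC ≤ b.nC ∧ b.nC ≤ b'.nC + 1 ∧ b'.nU ≤ b.nU := by
  obtain ⟨i, hi, l, hl, hCp, hUp, hnC, hnU, hC, hU⟩ := h
  rw [hnC, hnU]
  split_ifs <;> omega

/-- The surviving centers keep their order and the positions shift along with them, so the centers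
known to be far from an element still form a prefix. -/
theorem Removed.weak (h : Removed p b b') (hb : Weak near k b) : Weak near k b' := by
  have hs : ∀ e, b'.memC e → b'.memU e := fun e he => by
    rw [h.memC] at he
    rw [h.memU]
    exact ⟨hb.sub e he.1, he.2⟩
  have hle := h.nC_le
  obtain ⟨i, hi, l, hl, hCp, hUp, hnC, hnU, hC, hU⟩ := h
  refine ⟨?_, hs, hle.1.trans hb.nC_le, ?_, ?_, ?_⟩
  · intro x hx y hy hxy
    rw [(hU x hx).1, (hU y hy).1] at hxy
    exact skipIdx_inj (hb.injU _ (skipIdx_lt hl (hnU ▸ hx)) _ (skipIdx_lt hl (hnU ▸ hy)) hxy)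
  · intro y hy x hx
    rw [hC y hy, hC x (hx.trans hy)]
    refine hb.farC _ (skipIdx_lt hi (hnC ▸ hy)) _ ?_
    unfold skipIdx
    split_ifs <;> omega
  · intro x hx
    have := hb.pos_le _ (skipIdx_lt hl (hnU ▸ hx))
    rw [(hU x hx).2, decPos_eq, hnC]
    split_ifs <;> omega
  · intro x hx y hy
    have h1 := hb.pos_le _ (skipIdx_lt hl (hnU ▸ hx))
    rw [(hU x hx).2, decPos_eq] at hy
    have hy' : y < b'.nC := by
      rw [hnC]
      split_ifs at hy ⊢ <;> omega
    rw [(hU x hx).1, hC y hy']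
    refine hb.farP _ (skipIdx_lt hl (hnU ▸ hx)) _ ?_
    unfold skipIdx at hy ⊢
    split_ifs at hy ⊢ <;> omega

/-- `skipIdx` embeds the surviving elements into the old ones, and no term `nC - P` grows: when a
center is lost, either `P` drops along with `nC`, or only `nC` drops. Thus deletions never raise the
potential. -/
theorem Removed.pending_le (h : Removed p b b') (hb : Weak near k b) : b'.pending ≤ b.pending := by
  obtain ⟨i, hi, l, hl, hCp, hUp, hnC, hnU, hC, hU⟩ := h
  have h1 : b'.pending ≤ ∑ j ∈ Finset.range b'.nU, (b.nC - b.P (skipIdx l j)) := by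
    refine Finset.sum_le_sum fun j hj => ?_
    rw [Finset.mem_range] at hj
    have := hb.pos_le _ (skipIdx_lt hl (hnU ▸ hj))
    rw [(hU j hj).2, decPos_eq, hnC]
    split_ifs <;> omega
  refine h1.trans ?_
  rw [← Finset.sum_image (f := fun j => b.nC - b.P j) (fun x _ y _ h => skipIdx_inj h)]
  refine Finset.sum_le_sum_of_subset fun x hx => ?_
  simp only [Finset.mem_image, Finset.mem_range] at hx ⊢
  obtain ⟨j, hj, rfl⟩ := hx
  exact skipIdx_lt hl (hnU ▸ hj)

/-! ### Appending elements to a block. -/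

/-- The block `b'` arises from `b` by appending the elements `f 0, …, f (m - 1)`. -/
structure Pushed (f : ℕ → ℕ) (m : ℕ) (b b' : Blk) : Prop where
  nC : b'.nC = b.nC
  C : b'.C = b.C
  nU : b'.nU = b.nU + m
  old : ∀ i < b.nU, b'.U i = b.U i ∧ b'.P i = b.P i
  new : ∀ i < m, b'.U (b.nU + i) = f i ∧ b'.P (b.nU + i) = 0

variable {f : ℕ → ℕ} {m : ℕ}

theorem Pushed.memC (h : Pushed f m b b') (e : ℕ) : b'.memC e ↔ b.memC e := by
  simp [Blk.memC, h.nC, h.C]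

theorem Pushed.memU (h : Pushed f m b b') (e : ℕ) :
    b'.memU e ↔ b.memU e ∨ ∃ i < m, f i = e := by
  constructor
  · rintro ⟨j, hj, rfl⟩
    rw [h.nU] at hj
    by_cases hj' : j < b.nU
    · exact .inl ⟨j, hj', (h.old j hj').1.symm⟩
    · refine .inr ⟨j - b.nU, by omega, ?_⟩
      rw [← (h.new (j - b.nU) (by omega)).1]
      congr 1
      omega
  · rintro (⟨j, hj, rfl⟩ | ⟨j, hj, rfl⟩)
    · exact ⟨j, by rw [h.nU]; omega, (h.old j hj).1⟩
    · exact ⟨b.nU + j, by rw [h.nU]; omega, (h.new j hj).1⟩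

theorem Pushed.weak (h : Pushed f m b b') (hb : Weak near k b)
    (hf : ∀ i < m, ∀ j < m, f i = f j → i = j) (hfU : ∀ i < m, ¬ b.memU (f i)) :
    Weak near k b' := by
  have hcase : ∀ i < b'.nU, i < b.nU ∨ ∃ i' < m, i = b.nU + i' := by
    intro i hi
    rw [h.nU] at hi
    by_cases hi' : i < b.nU
    · exact .inl hi'
    · exact .inr ⟨i - b.nU, by omega, by omega⟩
  refine ⟨?_, ?_, by rw [h.nC]; exact hb.nC_le, ?_, ?_, ?_⟩
  · intro i hi j hj hij
    rcases hcase i hi with h1 | ⟨i, h1, rfl⟩ <;> rcases hcase j hj with h2 | ⟨j, h2, rfl⟩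
    · rw [(h.old i h1).1, (h.old j h2).1] at hij
      exact hb.injU i h1 j h2 hij
    · rw [(h.old i h1).1, (h.new j h2).1] at hij
      exact absurd ⟨i, h1, hij⟩ (hfU j h2)
    · rw [(h.new i h1).1, (h.old j h2).1] at hij
      exact absurd ⟨j, h2, hij.symm⟩ (hfU i h1)
    · rw [(h.new i h1).1, (h.new j h2).1] at hij
      rw [hf i h1 j h2 hij]
  · intro e he
    rw [h.memC] at he
    rw [h.memU]
    exact .inl (hb.sub e he)
  · rw [h.nC, h.C]
    exact hb.farC
  · intro i hi
    rw [h.nC]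
    rcases hcase i hi with h1 | ⟨i, h1, rfl⟩
    · rw [(h.old i h1).2]
      exact hb.pos_le i h1
    · rw [(h.new i h1).2]
      exact Nat.zero_le _
  · intro i hi j hj
    rw [h.C]
    rcases hcase i hi with h1 | ⟨i, h1, rfl⟩
    · rw [(h.old i h1).1]
      rw [(h.old i h1).2] at hj
      exact hb.farP i h1 j hj
    · rw [(h.new i h1).2] at hj
      omega

/-- New elements start at position `0`, so each of them may have to be compared with all centers
present. -/
theorem Pushed.pending (h : Pushed f m b b') : b'.pending = b.pending + m * b.nC := by
  unfold Blk.pending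
  rw [h.nU, Finset.sum_range_add, h.nC]
  congr 1
  · refine Finset.sum_congr rfl fun i hi => ?_
    rw [(h.old i (Finset.mem_range.1 hi)).2]
  · rw [Finset.sum_congr rfl fun i hi => by rw [(h.new i (Finset.mem_range.1 hi)).2]]
    simp

theorem Pushed.settled (h : Pushed f m b b') {i : ℕ} (hi : i < b.nU)
    (hs : Settled near k b i) : Settled near k b' i := by
  unfold Settled at hs ⊢
  rwa [h.nC, h.C, (h.old i hi).1, (h.old i hi).2]

/-! ### The greedy scan of a block. -/

/-- `q` is the position of the first center that is near to the element `j`, or the number of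
centers if there is none; the centers before the recorded position are not considered. -/
structure Search (near : ℕ → ℕ → Prop) (b : Blk) (j q : ℕ) : Prop where
  le : b.P j ≤ q
  le_nC : q ≤ b.nC
  far : ∀ i, b.P j ≤ i → i < q → ¬ near (b.U j) (b.C i)
  near : q < b.nC → near (b.U j) (b.C q)

/-- Records the position `q` for the element `j`, which becomes a center if no center is near and
there are at most `k` centers. -/
def Blk.settle (k j q : ℕ) (b : Blk) : Blk where
  nC := if b.nC ≤ q ∧ b.nC ≤ k then b.nC + 1 else b.nC
  C := if b.nC ≤ q ∧ b.nC ≤ k then Function.update b.C b.nC (b.U j) else b.C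
  nU := b.nU
  U := b.U
  P := Function.update b.P j q

open Classical in
/-- The number of unsettled elements among the first `j` elements. -/
noncomputable def unsettled (near : ℕ → ℕ → Prop) (k : ℕ) (b : Blk) (j : ℕ) : ℕ :=
  ((Finset.range j).filter fun i => ¬ Settled near k b i).card

theorem unsettled_succ_of_settled {j : ℕ} (h : Settled near k b j) :
    unsettled near k b (j + 1) = unsettled near k b j := by
  classical
  simp [unsettled, Finset.range_add_one, Finset.filter_insert, h]

theorem unsettled_succ_of_not_settled {j : ℕ} (h : ¬ Settled near k b j) :
    unsettled near k b (j + 1) = unsettled near k b j + 1 := by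
  classical
  simp [unsettled, Finset.range_add_one, Finset.filter_insert, h]

theorem unsettled_le (near : ℕ → ℕ → Prop) (k : ℕ) (b : Blk) (j : ℕ) :
    unsettled near k b j ≤ j := by
  classical
  exact (Finset.card_filter_le _ _).trans (by simp)

/-- Appending changes neither the centers nor the old elements, so only the appended elements can be
unsettled. This is the source of the worst-case bound for insertions. -/
theorem Pushed.unsettled_le (h : Pushed f m b b') (hs : ∀ i < b.nU, Settled near k b i) :
    unsettled near k b' b'.nU ≤ m := by
  classical
  have : (Finset.range b'.nU).filter (fun i => ¬ Settled near k b' i) ⊆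
      (Finset.range m).image (b.nU + ·) := by
    intro i hi
    simp only [Finset.mem_filter, Finset.mem_range, Finset.mem_image] at hi ⊢
    by_cases hi' : i < b.nU
    · exact absurd (h.settled hi' (hs i hi')) hi.2
    · have := h.nU
      exact ⟨i - b.nU, by omega, by omega⟩
  exact (Finset.card_le_card this).trans (Finset.card_image_le.trans (by simp))

/-- The state `b` of a block after its first `j` elements have been scanned, which took `c`
comparisons with far centers; `b₀` is the state before. -/
structure Scanned (near : ℕ → ℕ → Prop) (k : ℕ) (b₀ : Blk) (j : ℕ) (b : Blk) (c : ℕ) : Prop where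
  weak : Weak near k b
  nU : b.nU = b₀.nU
  U : b.U = b₀.U
  settled : ∀ i < j, Settled near k b i
  P : ∀ i, j ≤ i → b.P i = b₀.P i
  nC_le : b₀.nC ≤ b.nC
  C : ∀ i < b₀.nC, b.C i = b₀.C i
  pending : c + b.pending ≤ b₀.pending + b₀.nU * (b.nC - b₀.nC)
  comparisons : c ≤ (k + 1) * unsettled near k b₀ j
  new : b.nC - b₀.nC ≤ unsettled near k b₀ j

theorem Scanned.refl (h : Weak near k b) : Scanned near k b 0 b 0 :=
  ⟨h, rfl, rfl, by simp, fun _ _ => rfl, le_rfl, fun _ _ => rfl, by simp, by simp, by simp⟩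

/-- Moving an element from position `P j` to `q` pays for exactly the `q - P j` comparisons with far
centers that were made. -/
theorem sum_sub_update {n j q N : ℕ} {P : ℕ → ℕ} (hj : j < n) (h : P j ≤ q) (hq : q ≤ N) :
    (q - P j) + ∑ i ∈ Finset.range n, (N - Function.update P j q i) =
      ∑ i ∈ Finset.range n, (N - P i) := by
  have hj' := Finset.mem_range.2 hj
  rw [← Finset.add_sum_erase _ _ hj', ← Finset.add_sum_erase _ (fun i => N - P i) hj',
    Finset.sum_congr rfl (g := fun i => N - P i)]
  · simp
    omega
  · intro i hi
    rw [Function.update_of_ne (Finset.ne_of_mem_erase hi)]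

theorem Weak.settle {j q : ℕ} (hb : Weak near k b) (hs : ∀ e f, near e f → near f e)
    (hj : j < b.nU) (hq : Search near b j q) : Weak near k (b.settle k j q) := by
  have hfar : ∀ i < q, ¬ near (b.U j) (b.C i) := fun i hi => by
    by_cases h : i < b.P j
    · exact hb.farP j hj i h
    · exact hq.far i (by omega) hi
  unfold Blk.settle
  split_ifs with hc
  · have hqn : q = b.nC := by have := hq.le_nC; omega
    refine ⟨hb.injU, ?_, by dsimp only; omega, ?_, ?_, ?_⟩
    · rintro e ⟨i, hi, rfl⟩
      dsimp only at hi ⊢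
      by_cases h : i = b.nC
      · subst h
        exact ⟨j, hj, by simp⟩
      · rw [Function.update_of_ne h]
        exact hb.sub _ ⟨i, by omega, rfl⟩
    · intro y hy x hx
      dsimp only at hy ⊢
      rw [Function.update_of_ne (show x ≠ b.nC by omega)]
      by_cases h : y = b.nC
      · subst h
        rw [Function.update_self]
        exact fun h' => hfar x (by omega) (hs _ _ h')
      · rw [Function.update_of_ne h]
        exact hb.farC y (by omega) x hx
    · intro i hi
      dsimp only at hi ⊢
      by_cases h : i = j
      · subst h; rw [Function.update_self]; omega
      · rw [Function.update_of_ne h]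
        exact (hb.pos_le i hi).trans (Nat.le_succ _)
    · intro i hi y hy
      dsimp only at hi hy ⊢
      by_cases h : i = j
      · subst h
        rw [Function.update_self] at hy
        rw [Function.update_of_ne (by omega)]
        exact hfar y hy
      · rw [Function.update_of_ne h] at hy
        have := hb.pos_le i hi
        rw [Function.update_of_ne (by omega)]
        exact hb.farP i hi y hy
  · refine ⟨hb.injU, hb.sub, hb.nC_le, hb.farC, ?_, ?_⟩
    · intro i hi
      dsimp only at hi ⊢
      by_cases h : i = j
      · subst h; rw [Function.update_self]; exact hq.le_nC
      · rw [Function.update_of_ne h]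
        exact hb.pos_le i hi
    · intro i hi y hy
      dsimp only at hi hy ⊢
      by_cases h : i = j
      · subst h
        rw [Function.update_self] at hy
        exact hfar y hy
      · rw [Function.update_of_ne h] at hy
        exact hb.farP i hi y hy

/-- A settled element makes no comparison with a far center and founds no new center. -/
theorem Search.eq_of_settled {j q : ℕ} (hq : Search near b j q) (hs : Settled near k b j) :
    q = b.P j ∧ ¬ (b.nC ≤ q ∧ b.nC ≤ k) := by
  have h1 := hq.le
  have h2 := hq.le_nC
  rcases hs with ⟨h, h'⟩ | ⟨h, h'⟩
  · have : q = b.P j := by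
      by_contra hne
      exact hq.far _ le_rfl (by omega) h'
    omega
  · omega

/-- Comparisons are charged twice over: to the decrease of the pending count, for the amortized
bound, and to the unsettled elements with at most `k + 1` each, for the worst case. -/
theorem Scanned.step {b₀ : Blk} {j q c : ℕ} (h : Scanned near k b₀ j b c)
    (hr : ∀ e, near e e) (hs : ∀ e f, near e f → near f e)
    (hj : j < b₀.nU) (hq : Search near b j q) :
    Scanned near k b₀ (j + 1) (b.settle k j q) (c + (q - b.P j)) := by
  have hjb : j < b.nU := h.nU ▸ hj
  have hpend : (q - b.P j) + (b.settle k j q).pending ≤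
      b.pending + b.nU * ((b.settle k j q).nC - b.nC) := by
    have := sum_sub_update hjb hq.le hq.le_nC
    unfold Blk.settle Blk.pending
    dsimp only
    split_ifs with hc
    · have h2 : ∑ i ∈ Finset.range b.nU, (b.nC + 1 - Function.update b.P j q i) ≤
          ∑ i ∈ Finset.range b.nU, ((b.nC - Function.update b.P j q i) + 1) :=
        Finset.sum_le_sum fun i _ => by omega
      rw [Finset.sum_add_distrib] at h2
      simp only [Finset.sum_const, Finset.card_range, smul_eq_mul, mul_one,
        add_tsub_cancel_left] at h2 ⊢
      omega
    · omega
  have hnC : b.nC ≤ (b.settle k j q).nC ∧ (b.settle k j q).nC ≤ b.nC + 1 := by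
    unfold Blk.settle; dsimp only; split_ifs <;> omega
  have hfin : c + (q - b.P j) ≤ (k + 1) * unsettled near k b₀ (j + 1) ∧
      (b.settle k j q).nC - b₀.nC ≤ unsettled near k b₀ (j + 1) := by
    -- Old centers keep their positions during a scan, and a block that already had `k + 1` centers
    -- gains none.
    have hs0 : Settled near k b₀ j → Settled near k b j := by
      have := h.nC_le
      have := h.weak.nC_le
      rintro (⟨h1, h2⟩ | ⟨h1, h2⟩)
      · left
        rw [h.P j le_rfl, h.U, h.C _ h1]
        exact ⟨by omega, h2⟩
      · right
        rw [h.P j le_rfl]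
        omega
    have h1 := h.comparisons
    have h2 := h.new
    have h3 := h.nC_le
    by_cases hset : Settled near k b₀ j
    · obtain ⟨h4, h5⟩ := hq.eq_of_settled (hs0 hset)
      rw [unsettled_succ_of_settled hset]
      refine ⟨by omega, ?_⟩
      unfold Blk.settle
      dsimp only
      rw [if_neg h5]
      exact h2
    · rw [unsettled_succ_of_not_settled hset, mul_add]
      have := hq.le_nC
      have := h.weak.nC_le
      exact ⟨by omega, by omega⟩
  refine ⟨h.weak.settle hs hjb hq, h.nU, h.U, ?_, ?_, h.nC_le.trans hnC.1, ?_, ?_, hfin.1, hfin.2⟩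
  · intro i hi
    rcases Nat.lt_succ_iff_lt_or_eq.1 hi with hi' | rfl
    · rcases h.settled i hi' with ⟨h1, h2⟩ | ⟨h1, h2⟩
      · left
        unfold Blk.settle
        dsimp only
        rw [Function.update_of_ne hi'.ne]
        split_ifs
        · rw [Function.update_of_ne h1.ne]
          exact ⟨by omega, h2⟩
        · exact ⟨h1, h2⟩
      · right
        unfold Blk.settle
        dsimp only
        rw [Function.update_of_ne hi'.ne, if_neg (by omega)]
        exact ⟨h1, h2⟩
    · unfold Blk.settle Settled
      dsimp only
      rw [Function.update_self]
      have := hq.le_nC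
      split_ifs with hc
      · have : q = b.nC := by omega
        subst this
        rw [Function.update_self]
        exact .inl ⟨by omega, hr _⟩
      · by_cases hlt : q < b.nC
        · exact .inl ⟨hlt, hq.near hlt⟩
        · have := h.weak.nC_le
          exact .inr (by omega)
  · intro i hi
    unfold Blk.settle
    dsimp only
    rw [Function.update_of_ne (by omega)]
    exact h.P i (by omega)
  · intro i hi
    have := h.nC_le
    rw [← h.C i hi]
    unfold Blk.settle
    dsimp only
    split_ifs
    · rw [Function.update_of_ne (by omega)]
    · rfl
  · have h1 := h.pending
    have h2 := h.nC_le
    have : (b.settle k j q).nC - b₀.nC = ((b.settle k j q).nC - b.nC) + (b.nC - b₀.nC) := by omega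
    rw [this, mul_add]
    rw [h.nU] at hpend
    omega

theorem Scanned.memU {b₀ : Blk} {j c : ℕ} (h : Scanned near k b₀ j b c) (e : ℕ) :
    b.memU e ↔ b₀.memU e := by
  simp [Blk.memU, h.nU, h.U]

theorem Scanned.memC {b₀ : Blk} {j c : ℕ} (h : Scanned near k b₀ j b c) (e : ℕ) :
    b.memC e ↔ b₀.memC e ∨ ∃ i < b.nC - b₀.nC, b.C (b₀.nC + i) = e := by
  have := h.nC_le
  constructor
  · rintro ⟨i, hi, rfl⟩
    by_cases hi' : i < b₀.nC
    · exact .inl ⟨i, hi', (h.C i hi').symm⟩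
    · exact .inr ⟨i - b₀.nC, by omega, by congr 1; omega⟩
  · rintro (⟨i, hi, rfl⟩ | ⟨i, hi, rfl⟩)
    · exact ⟨i, by omega, h.C i hi⟩
    · exact ⟨_, by omega, rfl⟩

end DynKCenter

namespace DynKCenter
open RAM

/-! ## The treatment of one node -/

/-- Appends the centers from position `14` up to position `15` of the block at register `16` to the
elements of the block at register `10`. -/
def pushLoop : Cmd :=
  .while (.nle (.add (.reg 14) (.lit 1)) (.reg 15))
    (.putN 9 (.add (.reg 10) (.get 8 (.reg 10))) (.get 7 (.add (.reg 16) (.reg 14))) ;;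
    .putN 10 (.add (.reg 10) (.get 8 (.reg 10))) (.lit 0) ;;
    .putN 8 (.reg 10) (.add (.get 8 (.reg 10)) (.lit 1)) ;;
    .setN 14 (.add (.reg 14) (.lit 1)))

theorem wp_pushLoop {d : ℕ → ℕ → ℝ} {s : Store} {A k lo hi src : ℕ} (hA : s.nreg 10 = A)
    (hlo : s.nreg 14 = lo) (hhi : s.nreg 15 = hi) (hsrc : s.nreg 16 = src) (hle : lo ≤ hi)
    (hn : (blk k s A).nU + (hi - lo) ≤ k + k + 3) :
    wp d pushLoop (fun t s' => t ≤ 60 * (hi - lo) + 10 ∧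
      Pushed (fun i => s.narr 7 (src + lo + i)) (hi - lo) (blk k s A) (blk k s' A) ∧
      OutsideEq k A s s') s := by
  obtain ⟨n, hn0⟩ : ∃ n, s.narr 8 A = n := ⟨_, rfl⟩
  replace hn : n + (hi - lo) ≤ k + k + 3 := hn0 ▸ hn
  refine wp_while (fun t s' => ∃ m, s'.nreg 14 = lo + m ∧ m ≤ hi - lo ∧ t ≤ 60 * m ∧
    s'.narr 8 A = n + m ∧ (∀ y ≠ A, s'.narr 8 y = s.narr 8 y) ∧
    (∀ i < m, s'.narr 9 (A + n + i) = s.narr 7 (src + lo + i) ∧ s'.narr 10 (A + n + i) = 0) ∧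
    (∀ y, y < A + n ∨ A + n + m ≤ y → s'.narr 9 y = s.narr 9 y ∧ s'.narr 10 y = s.narr 10 y))
    (fun s' => hi - s'.nreg 14) ?_ ?_ ?_
  · exact ⟨0, by simp [hlo], by omega, by omega, by simp [hn0], by simp, by simp, by simp⟩
  · rintro t s' hf ⟨m, hm, hmle, ht, h8, h8o, hnew, hout⟩ hb
    have f10 := hf.nreg 10 (by decide)
    have f15 := hf.nreg 15 (by decide)
    have f16 := hf.nreg 16 (by decide)
    have f7 := fun y => congrFun (hf.narr 7 (by decide)) y
    rw [hA] at f10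
    rw [hhi] at f15
    rw [hsrc] at f16
    simp [hm, f15] at hb
    simp [f10, f16, hm, h8, f7]
    refine ⟨⟨m + 1, by omega, by omega, by omega, by omega, ?_, ?_, ?_⟩, by omega⟩
    · intro y hy
      simp [hy, h8o y hy]
    · intro i hi
      by_cases h : i = m
      · subst h
        simp [Nat.add_assoc]
      · have h1 : A + n + i ≠ A + (n + m) := by omega
        simp only [h1, if_false]
        simpa using hnew i (by omega)
    · intro y hy
      have h1 : y ≠ A + (n + m) := by omega
      simp only [h1, if_false]
      exact hout y (by omega)
  · rintro t s' hf ⟨m, hm, hmle, ht, h8, h8o, hnew, hout⟩ hb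
    have f15 := hf.nreg 15 (by decide)
    have f7 := fun y => congrFun (hf.narr 7 (by decide)) y
    have f6 := fun y => congrFun (hf.narr 6 (by decide)) y
    rw [hhi] at f15
    simp [hm, f15] at hb
    obtain rfl : m = hi - lo := by omega
    refine ⟨by simp; omega, ⟨?_, ?_, ?_, ?_, ?_⟩, ?_⟩
    · simp [blk, f6]
    · simp [blk, f7]
    · simp [blk, h8, hn0]
    · intro i hi
      replace hi : i < n := hn0 ▸ hi
      have h1 := hout (A + i) (by omega)
      simp [blk, h1]
    · intro i hi
      have h1 := hnew i hi
      have h2 : n + i < k + k + 3 := by omega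
      rw [Nat.add_assoc] at h1
      simp [blk, hn0, h2, h1]
    · intro a ha y hy
      have hyA : y ≠ A := by omega
      by_cases e8 : a = 8
      · subst e8; exact h8o y hyA
      by_cases e9 : a = 9
      · subst e9; exact (hout y (by omega)).1
      by_cases e10 : a = 10
      · subst e10; exact (hout y (by omega)).2
      exact congrFun (hf.narr a (by simp [Cmd.narrs]; omega)) y

/-- Advances the position in register `17` to the next center that is near to the element in
register `11`. -/
def searchLoop : Cmd :=
  .while (.and (.nle (.add (.reg 17) (.lit 1)) (.get 6 (.reg 10)))
      (.not (.rle (.dist (.get 9 (.add (.reg 10) (.reg 11))) (.get 7 (.add (.reg 10) (.reg 17))))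
        (.reg 4))))
    (.setN 17 (.add (.reg 17) (.lit 1)))

theorem wp_searchLoop {d : ℕ → ℕ → ℝ} {s : Store} {A j q n : ℕ} (hA : s.nreg 10 = A)
    (hj : s.nreg 11 = j) (hq : s.nreg 17 = q) (hn : s.narr 6 A = n) (hqn : q ≤ n) :
    wp d searchLoop (fun t s' => ∃ q', s'.nreg 17 = q' ∧ t ≤ 40 * (q' - q) + 40 ∧ q ≤ q' ∧
      q' ≤ n ∧ (∀ i, q ≤ i → i < q' → ¬ d (s.narr 9 (A + j)) (s.narr 7 (A + i)) ≤ s.rreg 4) ∧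
      (q' < n → d (s.narr 9 (A + j)) (s.narr 7 (A + q')) ≤ s.rreg 4)) s := by
  refine wp_while (fun t s' => ∃ q', s'.nreg 17 = q' ∧ t ≤ 40 * (q' - q) ∧ q ≤ q' ∧ q' ≤ n ∧
    (∀ i, q ≤ i → i < q' → ¬ d (s.narr 9 (A + j)) (s.narr 7 (A + i)) ≤ s.rreg 4))
    (fun s' => n - s'.nreg 17) ?_ ?_ ?_
  · exact ⟨q, hq, by simp, le_rfl, hqn, fun i h h' => by omega⟩
  · rintro t s' hf ⟨q', hq', ht, h1, h2, hfar⟩ hb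
    have f10 := hf.nreg 10 (by decide)
    have f11 := hf.nreg 11 (by decide)
    have f4 := hf.rreg 4 (by decide)
    simp [f10, f11, hA, hj, hq', hf.narr 6 (by decide), hf.narr 7 (by decide),
      hf.narr 9 (by decide), hn, f4] at hb
    simp [hq']
    refine ⟨⟨by omega, by omega, by omega, fun i h h' => ?_⟩, by omega⟩
    rcases Nat.lt_succ_iff_lt_or_eq.1 (Nat.lt_succ_of_le h') with h'' | rfl
    · exact not_le.1 (hfar i h h'')
    · exact hb.2
  · rintro t s' hf ⟨q', hq', ht, h1, h2, hfar⟩ hb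
    have f10 := hf.nreg 10 (by decide)
    have f11 := hf.nreg 11 (by decide)
    have f4 := hf.rreg 4 (by decide)
    simp [f10, f11, hA, hj, hq', hf.narr 6 (by decide), hf.narr 7 (by decide),
      hf.narr 9 (by decide), hn, f4] at hb
    exact ⟨q', hq', by simp; omega, h1, h2, hfar, fun h => hb (by omega)⟩

/-- Assigns the element in register `11` to a near center or makes it a center. -/
def scanBody : Cmd :=
  .setN 17 (.get 10 (.add (.reg 10) (.reg 11))) ;;
  searchLoop ;;
  .putN 10 (.add (.reg 10) (.reg 11)) (.reg 17) ;;
  .ite (.and (.nle (.get 6 (.reg 10)) (.reg 17)) (.nle (.get 6 (.reg 10)) (.reg 2)))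
    (.putN 7 (.add (.reg 10) (.get 6 (.reg 10))) (.get 9 (.add (.reg 10) (.reg 11))) ;;
      .putN 6 (.reg 10) (.add (.get 6 (.reg 10)) (.lit 1)))
    .skip ;;
  .setN 11 (.add (.reg 11) (.lit 1))

/-- The search starts at the recorded position, not at `0`; this is what bounds the time by `q - P
j`. The invariants place every cell that is read or written inside the window of the block, which is
how the memory operation matches `Blk.settle`. -/
theorem wp_scanBody {d : ℕ → ℕ → ℝ} {near : ℕ → ℕ → Prop} {s : Store} {A k j : ℕ}
    (hk : s.nreg 2 = k) (hA : s.nreg 10 = A) (hj : s.nreg 11 = j)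
    (hw : Weak near k (blk k s A)) (hU : (blk k s A).nU ≤ k + k + 3) (hjU : j < (blk k s A).nU)
    (hd : ∀ e f, (blk k s A).memU e → (blk k s A).memU f → (d e f ≤ s.rreg 4 ↔ near e f)) :
    wp d scanBody (fun t s' => ∃ q, Search near (blk k s A) j q ∧
      t ≤ 40 * (q - (blk k s A).P j) + 100 ∧ blk k s' A = (blk k s A).settle k j q ∧
      s'.nreg 11 = j + 1 ∧ OutsideEq k A s s') s := by
  have hjW : j < k + k + 3 := by omega
  have hPle := hw.pos_le j hjU
  have hP : (blk k s A).P j = s.narr 10 (A + j) := by simp [blk, hjW]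
  have hUj : (blk k s A).U j = s.narr 9 (A + j) := by simp [blk, hjW]
  have hnC : (blk k s A).nC = s.narr 6 A := rfl
  have hnCk := hw.nC_le
  have hC : ∀ i < s.narr 6 A, (blk k s A).C i = s.narr 7 (A + i) := fun i hi => by
    have : i < k + k + 3 := by omega
    simp [blk, this]
  rw [hP, hnC] at hPle
  simp only [scanBody, wp_seq, wp_setN, wp_putN, wp_ite, wp_skip]
  refine (wp_searchLoop (A := A) (j := j) (q := s.narr 10 (A + j)) (n := s.narr 6 A) (by simp [hA])
    (by simp [hj]) (by simp [hA, hj]) (by simp) hPle).mono ?_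
  rintro t s1 hf ⟨q, hq, ht, h1, h2, hfar, hnear⟩
  simp only [setN_narr, setN_rreg] at hfar hnear
  have hS : Search near (blk k s A) j q := by
    have hconv : ∀ i < s.narr 6 A, d (s.narr 9 (A + j)) (s.narr 7 (A + i)) ≤ s.rreg 4 ↔
        near ((blk k s A).U j) ((blk k s A).C i) := fun i hi => by
      rw [← hUj, ← hC i hi]
      exact hd _ _ ⟨j, hjU, rfl⟩ (hw.sub _ ⟨i, hi, rfl⟩)
    refine ⟨hP ▸ h1, h2, fun i hi hiq => ?_, fun h => ?_⟩
    · rw [← hconv i (by omega)]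
      exact hfar i (hP ▸ hi) hiq
    · rw [← hconv q h]
      exact hnear h
  have g2 := hf.nreg 2 (by decide)
  have g10 := hf.nreg 10 (by decide)
  have g11 := hf.nreg 11 (by decide)
  have a : ∀ a y, s1.narr a y = s.narr a y := fun a y => congrFun (hf.narr a (by simp [searchLoop, Cmd.narrs])) y
  simp [hk, hA, hj] at g2 g10 g11
  simp [g2, g10, g11, a, hq]
  refine ⟨fun hc1 hc2 => ?_, fun hc => ?_⟩
  · refine ⟨q, hS, by omega, ?_, ?_⟩
    · have hc : (blk k s A).nC ≤ q ∧ (blk k s A).nC ≤ k := ⟨hc1, hc2⟩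
      unfold Blk.settle
      rw [if_pos hc, if_pos hc]
      ext i
      · simp [blk]
      · by_cases hi : i = s.narr 6 A
        · have : s.narr 6 A < k + k + 3 := by omega
          simp [blk, hi, this, hjW]
        · simp [blk, hi, a]
      · simp [blk, a]
      · simp [blk, a]
      · by_cases hi : i = j <;> simp [blk, hi, hjW, a, Function.update_apply]
    · intro b hb y hy
      have y1 : y ≠ A := by omega
      have y2 : y ≠ A + j := by omega
      have y3 : y ≠ A + s.narr 6 A := by omega
      simp [y1, y2, y3, a]
  · refine ⟨q, hS, by omega, ?_, ?_⟩
    · have hc : ¬ ((blk k s A).nC ≤ q ∧ (blk k s A).nC ≤ k) := fun h => absurd (hc h.1) (by have := h.2; rw [hnC] at this; omega)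
      unfold Blk.settle
      rw [if_neg hc, if_neg hc]
      ext i
      · simp [blk, a]
      · simp [blk, a]
      · simp [blk, a]
      · simp [blk, a]
      · by_cases hi : i = j <;> simp [blk, hi, hjW, a, Function.update_apply]
    · intro b hb y hy
      have y2 : y ≠ A + j := by omega
      simp [y2, a]

/-- Scans all elements of the block at register `10`. -/
def scanLoop : Cmd :=
  .while (.nle (.add (.reg 11) (.lit 1)) (.get 8 (.reg 10))) scanBody

theorem wp_scanLoop {d : ℕ → ℕ → ℝ} {near : ℕ → ℕ → Prop} {s : Store} {A k : ℕ}
    (hr : ∀ e, near e e) (hs : ∀ e f, near e f → near f e)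
    (hk : s.nreg 2 = k) (hA : s.nreg 10 = A) (hj : s.nreg 11 = 0)
    (hw : Weak near k (blk k s A)) (hU : (blk k s A).nU ≤ k + k + 3)
    (hd : ∀ e f, (blk k s A).memU e → (blk k s A).memU f → (d e f ≤ s.rreg 4 ↔ near e f)) :
    wp d scanLoop (fun t s' => ∃ c, t ≤ 120 * (blk k s A).nU + 40 * c + 10 ∧
      Scanned near k (blk k s A) (blk k s A).nU (blk k s' A) c ∧ OutsideEq k A s s') s := by
  refine wp_while (fun t s' => ∃ c, t ≤ 120 * s'.nreg 11 + 40 * c ∧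
    s'.nreg 11 ≤ (blk k s A).nU ∧ Scanned near k (blk k s A) (s'.nreg 11) (blk k s' A) c ∧
    OutsideEq k A s s') (fun s' => (blk k s A).nU - s'.nreg 11) ?_ ?_ ?_
  · exact ⟨0, by simp, by simp [hj], hj ▸ .refl hw, fun _ _ _ _ => rfl⟩
  · rintro t s' hf ⟨c, ht, hjle, hsc, ho⟩ hb
    have f2 := hf.nreg 2 (by decide)
    have f10 := hf.nreg 10 (by decide)
    have f4 := hf.rreg 4 (by decide)
    have hU' := hsc.nU
    have hb' : s'.nreg 11 < (blk k s A).nU := by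
      rw [← hU']
      simpa [f10, hA, blk] using hb
    refine (wp_scanBody (f2.trans hk) (f10.trans hA) rfl hsc.weak (hU' ▸ hU) (hU' ▸ hb')
      (fun e f he hf => ?_)).mono ?_
    · rw [f4]
      exact hd e f ((hsc.memU e).1 he) ((hsc.memU f).1 hf)
    · rintro t2 s2 - ⟨q, hq, ht2, hset, h11, ho2⟩
      refine ⟨⟨c + (q - (blk k s' A).P (s'.nreg 11)), by simp; omega, by omega, ?_,
        ho.trans ho2⟩, by omega⟩
      rw [hset, h11]
      exact hsc.step hr hs hb' hq
  · rintro t s' hf ⟨c, ht, hjle, hsc, ho⟩ hb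
    have f10 := hf.nreg 10 (by decide)
    have hU' := hsc.nU
    have hb' : ¬ s'.nreg 11 < (blk k s A).nU := by
      rw [← hU']
      simpa [f10, hA, blk] using hb
    have : s'.nreg 11 = (blk k s A).nU := by omega
    rw [this] at hsc
    exact ⟨c, by simp; omega, hsc, ho⟩

/-- Appends new elements to the block of the node in register `9` and scans it; afterwards the new
centers are described by the registers `14`, `15` and `16`. -/
def processNode : Cmd :=
  locate ;; pushLoop ;; subOverflow ;; .setN 14 (.get 6 (.reg 10)) ;; .setN 11 (.lit 0) ;;
  scanLoop ;; .setN 15 (.get 6 (.reg 10)) ;; addOverflow ;; .setN 16 (.reg 10)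

/-- `S` is a set of names on which the oracle is faithful; in the tree it is the set of active
names. On exit the registers `14`, `15` and `16` delimit exactly the centers appended by this scan,
in the form in which the parent expects its new elements. -/
theorem wp_processNode {d : ℕ → ℕ → ℝ} {near : ℕ → ℕ → Prop} {s : Store} {A k lo hi src : ℕ}
    (hr : ∀ e, near e e) (hs : ∀ e f, near e f → near f e)
    (hk : s.nreg 2 = k) (hA : s.narr 4 (s.nreg 9) + s.nreg 6 + 1 = A)
    (hlo : s.nreg 14 = lo) (hhi : s.nreg 15 = hi) (hsrc : s.nreg 16 = src) (hle : lo ≤ hi)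
    (hn : (blk k s A).nU + (hi - lo) ≤ k + k + 3) (hw : Weak near k (blk k s A))
    (hf : ∀ i < hi - lo, ∀ j < hi - lo,
      s.narr 7 (src + lo + i) = s.narr 7 (src + lo + j) → i = j)
    (hfU : ∀ i < hi - lo, ¬ (blk k s A).memU (s.narr 7 (src + lo + i)))
    {S : ℕ → Prop} (hS : ∀ e, (blk k s A).memU e → S e)
    (hS' : ∀ i < hi - lo, S (s.narr 7 (src + lo + i)))
    (hd : ∀ e f, S e → S f → (d e f ≤ s.rreg 4 ↔ near e f)) :
    wp d processNode (fun t s' => ∃ b₁ c, t ≤ 300 * (k + k + 3) + 40 * c ∧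
      Pushed (fun i => s.narr 7 (src + lo + i)) (hi - lo) (blk k s A) b₁ ∧
      Scanned near k b₁ b₁.nU (blk k s' A) c ∧
      OutsideEq k A s s' ∧ (∀ y ≠ s.nreg 6, s'.narr 5 y = s.narr 5 y) ∧
      s'.narr 5 (s.nreg 6) = s.narr 5 (s.nreg 6) - ((blk k s A).nC - k) +
        ((blk k s' A).nC - k) ∧
      s'.nreg 14 = (blk k s A).nC ∧ s'.nreg 15 = (blk k s' A).nC ∧ s'.nreg 16 = A) s := by
  simp only [processNode, locate, subOverflow, addOverflow, wp_seq, wp_setN, wp_putN]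
  simp only [NExp.eval, setN_nreg, hA]
  have hb0 : blk k (s.setN 10 A) A = blk k s A := by simp [blk]
  refine (wp_pushLoop (k := k) (A := A) (lo := lo) (hi := hi) (src := src) (by simp) (by simp [hlo]) (by simp [hhi]) (by simp [hsrc])
    hle (by rwa [hb0])).mono ?_
  rintro t1 s1 f1 ⟨ht1, hpush, ho1⟩
  simp only [setN_narr, hb0] at hpush
  have hw1 := hpush.weak hw hf hfU
  have g2 := f1.nreg 2 (by decide)
  have g6 := f1.nreg 6 (by decide)
  have g10 := f1.nreg 10 (by decide)
  have r4 := f1.rreg 4 (by decide)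
  have a6 := fun y => congrFun (f1.narr 6 (by decide)) y
  have a5 := fun y => congrFun (f1.narr 5 (by decide)) y
  simp [hk] at g2 g6 g10 r4 a6 a5
  generalize hs2 : (Store.setN _ 11 0) = s2
  have hb2 : blk k s2 A = blk k s1 A := by simp [← hs2, blk]
  have hU1 : (blk k s1 A).nU ≤ k + k + 3 := by rw [hpush.nU]; exact hn
  refine (wp_scanLoop (k := k) (A := A) hr hs (by simp [← hs2, g2]) (by simp [← hs2, g10])
    (by simp [← hs2]) (hb2 ▸ hw1) (hb2 ▸ hU1) ?_).mono ?_
  · intro e f he hf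
    rw [hb2, hpush.memU] at he hf
    have h4 : s2.rreg 4 = s.rreg 4 := by simp [← hs2, r4]
    rw [h4]
    refine hd e f ?_ ?_
    · rcases he with he | ⟨i, hi, rfl⟩
      exacts [hS e he, hS' i hi]
    · rcases hf with he | ⟨i, hi, rfl⟩
      exacts [hS f he, hS' i hi]
  rintro t3 s3 f3 ⟨c, ht3, hsc, ho3⟩
  rw [hb2] at hsc ht3
  have h10 := f3.nreg 10 (by decide)
  have h6 := f3.nreg 6 (by decide)
  have h2 := f3.nreg 2 (by decide)
  have h14 := f3.nreg 14 (by decide)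
  have b5 := fun y => congrFun (f3.narr 5 (by decide)) y
  simp [← hs2, g10, g6, g2, a6, a5] at h10 h6 h2 h14 b5
  have hbf : ∀ a b c e, blk k (((s3.setN 15 a).putN 5 b c).setN 16 e) A = blk k s3 A := by
    intros; simp [blk]
  refine ⟨blk k s1 A, c, ?_, hpush, ?_, ?_, ?_, ?_, ?_, ?_, ?_⟩
  · simp; omega
  · rwa [hbf]
  · intro a ha y hy
    have q3 := ho3 a ha y hy
    have q1 := ho1 a ha y hy
    simp [← hs2, ha] at q3 q1
    simp [ha, q3, q1]
  · intro y hy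
    simp [h6, hy, b5]
  · simp [h6, h10, h2, b5, blk]
  · simp [h14, blk]
  · simp [h10, blk]
  · simp [h10]

end DynKCenter

namespace DynKCenter
open RAM

/-! ## The tree of blocks of one guess -/

/-- The node `v` is `x` or an ancestor of `x` in the binary tree in which the children of `v` are
`2 * v` and `2 * v + 1`. -/
def Under (v x : ℕ) : Prop := ∃ i, x / 2 ^ i = v

theorem under_self (v : ℕ) : Under v v := ⟨0, by simp⟩

theorem Under.half {v x : ℕ} (h : Under v x) : Under (v / 2) x := by
  obtain ⟨i, rfl⟩ := h
  exact ⟨i + 1, by rw [pow_succ, Nat.div_div_eq_div_mul]⟩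

theorem Under.le {v x : ℕ} (h : Under v x) : v ≤ x := by
  obtain ⟨i, rfl⟩ := h
  exact Nat.div_le_self _ _

theorem under_iff {w v : ℕ} : Under w v ↔ w = v ∨ Under w (v / 2) := by
  constructor
  · rintro ⟨i, rfl⟩
    cases i with
    | zero => exact .inl (by simp)
    | succ i => exact .inr ⟨i, by rw [pow_succ, mul_comm, Nat.div_div_eq_div_mul]⟩
  · rintro (rfl | ⟨i, rfl⟩)
    · exact under_self _
    · exact ⟨i + 1, by rw [pow_succ, mul_comm, Nat.div_div_eq_div_mul]⟩

/-- The ancestors of `x` are its iterated halves, and below any proper ancestor the path passes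
through a single child. The bound on `a` excludes the pair `0`, `1`, whose halves coincide although
both lie on the path. -/
theorem Under.siblings {a b x : ℕ} (ha : Under a x) (hb : Under b x) (hab : a / 2 = b / 2)
    (h : 2 ≤ a) (hne : a ≠ b) : False := by
  obtain ⟨i, rfl⟩ := ha
  obtain ⟨j, rfl⟩ := hb
  have key : ∀ i j : ℕ, i < j → 2 ≤ x / 2 ^ i → x / 2 ^ i / 2 = x / 2 ^ j / 2 → False := by
    intro i j hij hx h'
    obtain ⟨l, rfl⟩ := Nat.exists_eq_add_of_lt hij
    have h1 : x / 2 ^ (i + l + 1) = x / 2 ^ i / 2 / 2 ^ l := by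
      rw [Nat.div_div_eq_div_mul, Nat.div_div_eq_div_mul]
      ring_nf
    have h2 : x / 2 ^ (i + l + 1) ≤ x / 2 ^ i / 2 := h1 ▸ Nat.div_le_self _ _
    omega
  rcases lt_trichotomy i j with h1 | rfl | h1
  · exact key i j h1 h hab
  · exact hne rfl
  · exact key j i h1 (by omega) hab.symm

theorem under_zero {w : ℕ} : Under w 0 ↔ w = 0 := by simp [Under, eq_comm]

/-- The invariants of the tree `T` of one guess, where `A` is the set of active names, `slot` says
which node a name is stored at, and the names with `new` still have to be added to the node `v`. -/
structure Tree (near : ℕ → ℕ → Prop) (k N : ℕ) (A : Finset ℕ) (slot : ℕ → ℕ) (v : ℕ)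
    (new : ℕ → Prop) (T : ℕ → Blk) : Prop where
  weak : ∀ w, 1 ≤ w → Weak near k (T w)
  empty : ∀ w, N < w → (T w).nU = 0
  mem : ∀ w, 1 ≤ w → ∀ e, ((T w).memU e ∨ (w = v ∧ new e)) ↔
    ((e ∈ A ∧ slot e = w) ∨ (T (2 * w)).memC e ∨ (T (2 * w + 1)).memC e)
  fresh : 1 ≤ v → ∀ e, new e → ¬ (T v).memU e

variable {near : ℕ → ℕ → Prop} {k N v : ℕ} {A : Finset ℕ} {slot : ℕ → ℕ} {new : ℕ → Prop}
  {T : ℕ → Blk}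

/-- Downward along the tree: an element of `w` is stored at `w` or is a center, hence an element, of
a child. Nodes beyond `N` are empty, so `N - w` decreases. -/
theorem Tree.memU_or (h : Tree near k N A slot v new T) (w : ℕ) (hw : 1 ≤ w) (e : ℕ)
    (he : (T w).memU e ∨ (w = v ∧ new e)) : e ∈ A ∧ Under w (slot e) := by
  induction hd : N - w using Nat.strong_induction_on generalizing w with
  | _ m ih =>
    have hC : ∀ u, (u = 2 * w ∨ u = 2 * w + 1) → (T u).memC e → e ∈ A ∧ Under w (slot e) := by
      intro u hu hue
      have hue' := (h.weak u (by omega)).sub e hue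
      have huN : u ≤ N := by
        by_contra hN
        obtain ⟨j, hj, -⟩ := hue'
        rw [h.empty u (by omega)] at hj
        omega
      have := ih (N - u) (by omega) u (by omega) (.inl hue') rfl
      refine ⟨this.1, ?_⟩
      have h2 := this.2.half
      rwa [show u / 2 = w by omega] at h2
    rcases (h.mem w hw e).1 he with h1 | h1 | h1
    · exact ⟨h1.1, h1.2 ▸ under_self _⟩
    · exact hC _ (.inl rfl) h1
    · exact hC _ (.inr rfl) h1

theorem Tree.memU_under (h : Tree near k N A slot v new T) {w : ℕ} (hw : 1 ≤ w) {e : ℕ}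
    (he : (T w).memU e) : e ∈ A ∧ Under w (slot e) := h.memU_or w hw e (.inl he)

theorem Tree.memC_under (h : Tree near k N A slot v new T) {w : ℕ} (hw : 1 ≤ w) {e : ℕ}
    (he : (T w).memC e) : e ∈ A ∧ Under w (slot e) := h.memU_under hw ((h.weak w hw).sub e he)

/-- One stored name, because `slot` is injective, and at most `k + 1` centers from each child give
`1 + 2 (k + 1) = k + k + 3`. The names still to be added are counted too, so the block never
outgrows its memory while they are appended. -/
theorem Tree.size (h : Tree near k N A slot v new T) (hslot : Set.InjOn slot A) {f : ℕ → ℕ} {m : ℕ}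
    (hnew : ∀ e, new e ↔ ∃ i < m, f i = e) (hf : ∀ i < m, ∀ j < m, f i = f j → i = j)
    (hv : 1 ≤ v) : (T v).nU + m ≤ k + k + 3 := by
  classical
  set g : ℕ → ℕ := fun i => if i < (T v).nU then (T v).U i else f (i - (T v).nU) with hg
  have hinj : Set.InjOn g (Finset.range ((T v).nU + m)) := by
    intro i hi j hj hij
    simp only [Finset.coe_range, Set.mem_Iio] at hi hj
    have hfr : ∀ x y, x < (T v).nU → y < m → (T v).U x ≠ f y := fun x y hx hy hxy =>
      h.fresh hv (f y) ((hnew _).2 ⟨y, hy, rfl⟩) ⟨x, hx, hxy⟩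
    simp only [hg] at hij
    split_ifs at hij with h1 h2 h2
    · exact (h.weak v hv).injU i h1 j h2 hij
    · exact absurd hij (hfr _ _ h1 (by omega))
    · exact absurd hij.symm (hfr _ _ h2 (by omega))
    · have := hf _ (by omega) _ (by omega) hij
      omega
  have hsub : (Finset.range ((T v).nU + m)).image g ⊆ (A.filter fun e => slot e = v) ∪
      ((Finset.range (T (2 * v)).nC).image (T (2 * v)).C ∪
        (Finset.range (T (2 * v + 1)).nC).image (T (2 * v + 1)).C) := by
    intro e he
    simp only [Finset.mem_image, Finset.mem_range] at he
    obtain ⟨i, hi, rfl⟩ := he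
    have : (T v).memU (g i) ∨ (v = v ∧ new (g i)) := by
      by_cases h1 : i < (T v).nU
      · exact .inl ⟨i, h1, by simp [hg, h1]⟩
      · exact .inr ⟨rfl, (hnew _).2 ⟨i - (T v).nU, by omega, by simp [hg, h1]⟩⟩
    have := (h.mem v hv _).1 this
    simpa [Blk.memC] using this
  have h1 := Finset.card_le_card hsub
  rw [Finset.card_image_of_injOn hinj, Finset.card_range] at h1
  have h2 : (A.filter fun e => slot e = v).card ≤ 1 := by
    rw [Finset.card_le_one]
    intro a ha b hb
    simp only [Finset.mem_filter] at ha hb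
    exact hslot ha.1 hb.1 (ha.2.trans hb.2.symm)
  have h3 : ((Finset.range (T (2 * v)).nC).image (T (2 * v)).C).card ≤ k + 1 :=
    Finset.card_image_le.trans (by simpa using (h.weak (2 * v) (by omega)).nC_le)
  have h4 : ((Finset.range (T (2 * v + 1)).nC).image (T (2 * v + 1)).C).card ≤ k + 1 :=
    Finset.card_image_le.trans (by simpa using (h.weak (2 * v + 1) (by omega)).nC_le)
  have h5 := Finset.card_union_le (A.filter fun e => slot e = v)
    ((Finset.range (T (2 * v)).nC).image (T (2 * v)).C ∪
        (Finset.range (T (2 * v + 1)).nC).image (T (2 * v + 1)).C)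
  have h6 := Finset.card_union_le ((Finset.range (T (2 * v)).nC).image (T (2 * v)).C)
    ((Finset.range (T (2 * v + 1)).nC).image (T (2 * v + 1)).C)
  omega

theorem Tree.nU_le (h : Tree near k N A slot v new T) (hslot : Set.InjOn slot A) {w : ℕ}
    (hw : 1 ≤ w) (hne : v = 0) : (T w).nU ≤ k + k + 3 := by
  have h' : Tree near k N A slot w (fun _ => False) T :=
    ⟨h.weak, h.empty, fun u hu e => by rw [← h.mem u hu e]; simp; omega, by simp⟩
  simpa using h'.size hslot (f := id) (m := 0) (by simp) (by simp) hw

/-- The tree after the node `v` has received its new elements and has been scanned. -/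
theorem Tree.step (h : Tree near k N A slot v new T) (hr : ∀ e, near e e) {f : ℕ → ℕ} {m c : ℕ}
    (hnew : ∀ e, new e ↔ ∃ i < m, f i = e) (hv : 1 ≤ v) (hvN : v ≤ N) {b₁ b' : Blk}
    (hp : Pushed f m (T v) b₁) (hsc : Scanned near k b₁ b₁.nU b' c) :
    Tree near k N A slot (v / 2)
      (fun e => ∃ i < b'.nC - (T v).nC, b'.C ((T v).nC + i) = e) (Function.update T v b') := by
  have hU : ∀ e, b'.memU e ↔ (T v).memU e ∨ new e := fun e => by
    rw [hsc.memU, hp.memU, hnew]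
  have hC : ∀ e, b'.memC e ↔ (T v).memC e ∨
      ∃ i < b'.nC - (T v).nC, b'.C ((T v).nC + i) = e := fun e => by
    rw [hsc.memC, hp.memC, hp.nC]
  have hCle := hsc.nC_le
  rw [hp.nC] at hCle
  have hT : ∀ w, w ≠ v → Function.update T v b' w = T w := fun w hw => by
    rw [Function.update_of_ne hw]
  have hTv : Function.update T v b' v = b' := by simp
  refine ⟨?_, ?_, ?_, ?_⟩
  · intro w hw
    by_cases hwv : w = v
    · rw [hwv, hTv]; exact hsc.weak
    · rw [hT w hwv]; exact h.weak w hw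
  · intro w hw
    rw [hT w (by omega)]
    exact h.empty w hw
  · intro w hw e
    have hm := h.mem w hw e
    by_cases hwv : w = v
    · subst hwv
      rw [hTv, hT (2 * w) (by omega), hT (2 * w + 1) (by omega), ← hm, hU]
      simp
      omega
    · rw [hT w hwv]
      simp only [hwv, false_and, or_false] at hm
      by_cases hwu : w = v / 2
      · rw [hm, and_iff_right hwu]
        have : v = 2 * w ∨ v = 2 * w + 1 := by omega
        rcases this with hv2 | hv2
        · have e1 : Function.update T v b' (2 * w) = b' := by rw [← hv2, hTv]
          have e2 : T (2 * w) = T v := by rw [← hv2]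
          rw [e1, e2, hT (2 * w + 1) (by omega), hC, or_assoc, or_assoc, or_assoc,
            or_comm (b := (T (2 * w + 1)).memC e)]
        · have e1 : Function.update T v b' (2 * w + 1) = b' := by rw [← hv2, hTv]
          have e2 : T (2 * w + 1) = T v := by rw [← hv2]
          rw [e1, e2, hT (2 * w) (by omega), hC, or_assoc, or_assoc]
      · rw [hT (2 * w) (by omega), hT (2 * w + 1) (by omega), ← hm]
        simp [hwu]
  · rintro hv2 e ⟨i, hi, rfl⟩ hmem
    rw [hT _ (by omega)] at hmem
    have hin : b'.memU (b'.C ((T v).nC + i)) := hsc.weak.sub _ ⟨_, by omega, rfl⟩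
    have hun : Under v (slot (b'.C ((T v).nC + i))) := by
      rw [hU] at hin
      exact (h.memU_or v hv _ (by simpa using hin)).2
    have hold : ¬ (T v).memC (b'.C ((T v).nC + i)) := by
      rintro ⟨j, hj, hji⟩
      have h1 := hsc.C j (by rw [hp.nC]; exact hj)
      rw [hp.C] at h1
      have := hsc.weak.injC hr j (by omega) _ (by omega) (h1.trans hji)
      omega
    have hsib : ∀ u, u / 2 = v / 2 → u ≠ v → ¬ (T u).memC (b'.C ((T v).nC + i)) := by
      intro u hu hne hmem'
      exact Under.siblings (h.memC_under (by omega) hmem').2 hun hu (by omega) hne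
    -- A name already in the parent would be stored there, but its node lies under `v`. Or it would
    -- be an old center of `v`, but centers are distinct. Or it would come from the sibling, but no
    -- name is stored under both siblings.
    rcases (h.mem (v / 2) hv2 _).1 (.inl hmem) with h1 | h1 | h1
    · have := hun.le
      omega
    · by_cases hv3 : 2 * (v / 2) = v
      · rw [hv3] at h1; exact hold h1
      · exact hsib _ (by omega) hv3 h1
    · by_cases hv3 : 2 * (v / 2) + 1 = v
      · rw [hv3] at h1; exact hold h1
      · exact hsib _ (by omega) hv3 h1

theorem Tree.finish (h : Tree near k N A slot 0 new T) :
    Tree near k N A slot 0 (fun _ => False) T :=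
  ⟨h.weak, h.empty, fun w hw e => by
    rw [← h.mem w hw e]
    simp only [show w ≠ 0 by omega, false_and], by simp⟩

/-- After a deletion the path is rescanned with nothing to add, so the scan may begin at any node.
-/
theorem Tree.start (h : Tree near k N A slot 0 (fun _ => False) T) (v : ℕ) (hnew : ∀ e, ¬ new e) :
    Tree near k N A slot v new T :=
  ⟨h.weak, h.empty, fun w hw e => by
    rw [← h.mem w hw e]
    simp [hnew], fun _ e he => absurd he (hnew e)⟩

/-- The tree after the removal of the active name `p` from all blocks. -/
theorem Tree.remove (h : Tree near k N A slot 0 (fun _ => False) T) {p : ℕ} {T' : ℕ → Blk}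
    (h1 : ∀ w, 1 ≤ w → Under w (slot p) → Removed p (T w) (T' w))
    (h2 : ∀ w, ¬ Under w (slot p) → T' w = T w) :
    Tree near k N (A.erase p) slot 0 (fun _ => False) T' := by
  have hU : ∀ w, 1 ≤ w → ∀ e, (T' w).memU e ↔ (T w).memU e ∧ e ≠ p := by
    intro w hw e
    by_cases hu : Under w (slot p)
    · exact (h1 w hw hu).memU e
    · rw [h2 w hu]
      refine ⟨fun he => ⟨he, ?_⟩, fun he => he.1⟩
      rintro rfl
      exact hu (h.memU_under hw he).2
  have hC : ∀ w, 1 ≤ w → ∀ e, (T' w).memC e ↔ (T w).memC e ∧ e ≠ p := by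
    intro w hw e
    by_cases hu : Under w (slot p)
    · exact (h1 w hw hu).memC e
    · rw [h2 w hu]
      refine ⟨fun he => ⟨he, ?_⟩, fun he => he.1⟩
      rintro rfl
      exact hu (h.memC_under hw he).2
  refine ⟨?_, ?_, ?_, by simp⟩
  · intro w hw
    by_cases hu : Under w (slot p)
    · exact (h1 w hw hu).weak (h.weak w hw)
    · rw [h2 w hu]; exact h.weak w hw
  · intro w hw
    by_cases hu : Under w (slot p)
    · have h3 := (h1 w (by omega) hu).nC_le.2.2
      have h4 := h.empty w hw
      omega
    · rw [h2 w hu]; exact h.empty w hw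
  · intro w hw e
    have hm := h.mem w hw e
    rw [hU w hw, hC (2 * w) (by omega), hC (2 * w + 1) (by omega), Finset.mem_erase]
    simp only [and_false, or_false] at hm ⊢
    rw [hm]
    tauto

/-- The tree when the name `p` is about to be inserted at the unoccupied node `v`. -/
theorem Tree.insert (h : Tree near k N A slot 0 (fun _ => False) T) {p N' : ℕ} (hp : p ∉ A)
    (hN : N ≤ N') (hnew : ∀ e, new e ↔ e = p) :
    Tree near k N' (insert p A) (Function.update slot p v) v new T := by
  refine ⟨h.weak, fun w hw => h.empty w (by omega), ?_, ?_⟩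
  · intro w hw e
    have hm := h.mem w hw e
    simp only [and_false, or_false] at hm
    rw [hm, hnew]
    by_cases hep : e = p
    · subst hep
      simp [hp]
      tauto
    · simp [hep]
  · intro hv e he hmem
    rw [hnew] at he
    exact hp (he ▸ (h.memU_under hv hmem).1)

/-! ### Sums over the nodes and the number of centers. -/

theorem sum_update_add {g : Blk → ℕ} {n : ℕ} (T : ℕ → Blk) (b : Blk) (hv : 1 ≤ v) (hn : v ≤ n) :
    ∑ w ∈ Finset.Icc 1 n, g (Function.update T v b w) + g (T v) =
      ∑ w ∈ Finset.Icc 1 n, g (T w) + g b := by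
  have hv' : v ∈ Finset.Icc 1 n := Finset.mem_Icc.2 ⟨hv, hn⟩
  rw [← Finset.add_sum_erase _ _ hv', ← Finset.add_sum_erase _ (fun w => g (T w)) hv',
    Finset.sum_congr rfl (g := fun w => g (T w))]
  · simp
    omega
  · intro w hw
    rw [Function.update_of_ne (Finset.ne_of_mem_erase hw)]

/-- The total number of centers, over all nodes up to `n`. -/
def centerCount (n : ℕ) (T : ℕ → Blk) : ℕ := ∑ w ∈ Finset.Icc 1 n, (T w).nC

/-- The total number of comparisons that may still be made. -/
def pendingCount (n : ℕ) (T : ℕ → Blk) : ℕ := ∑ w ∈ Finset.Icc 1 n, (T w).pending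

/-- The total overflow of the blocks, which may have one center more than allowed. -/
def overflow (k n : ℕ) (T : ℕ → Blk) : ℕ := ∑ w ∈ Finset.Icc 1 n, ((T w).nC - k)

theorem card_under_le {x r : ℕ} (hx : x < 2 ^ r) (n : ℕ) [DecidablePred fun w => Under w x] :
    ((Finset.Icc 1 n).filter fun w => Under w x).card ≤ r := by
  have : ((Finset.Icc 1 n).filter fun w => Under w x) ⊆
      (Finset.range r).image fun i => x / 2 ^ i := by
    intro w hw
    simp only [Finset.mem_filter, Finset.mem_Icc, Finset.mem_image, Finset.mem_range] at hw ⊢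
    obtain ⟨⟨hw1, -⟩, i, hi⟩ := hw
    refine ⟨i, ?_, hi⟩
    by_contra hri
    have : x / 2 ^ i = 0 := Nat.div_eq_of_lt (hx.trans_le (Nat.pow_le_pow_right (by omega) (by omega)))
    omega
  exact (Finset.card_le_card this).trans (Finset.card_image_le.trans (by simp))

/-- Double counting of pairs of a node and a center: the centers of `w` are distinct active names
stored under `w`, and a node below `2 ^ r` has at most `r` ancestors, itself included. -/
theorem Tree.centerCount_le (h : Tree near k N A slot v new T) (hr : ∀ e, near e e) {r n : ℕ}
    (hslot : ∀ e ∈ A, slot e < 2 ^ r) : centerCount n T ≤ A.card * r := by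
  classical
  have h1 : ∀ w ∈ Finset.Icc 1 n, (T w).nC ≤ (A.filter fun e => Under w (slot e)).card := by
    intro w hw
    have hw1 := (Finset.mem_Icc.1 hw).1
    have hinj : Set.InjOn (T w).C (Finset.range (T w).nC) := fun i hi j hj hij =>
      (h.weak w hw1).injC hr i (by simpa using hi) j (by simpa using hj) hij
    have := Finset.card_image_of_injOn hinj
    rw [Finset.card_range] at this
    rw [← this]
    refine Finset.card_le_card fun e he => ?_
    simp only [Finset.mem_image, Finset.mem_range] at he
    obtain ⟨i, hi, rfl⟩ := he
    simpa using h.memC_under hw1 ⟨i, hi, rfl⟩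
  calc centerCount n T ≤ ∑ w ∈ Finset.Icc 1 n, (A.filter fun e => Under w (slot e)).card :=
        Finset.sum_le_sum h1
    _ = ∑ e ∈ A, ((Finset.Icc 1 n).filter fun w => Under w (slot e)).card := by
        simp only [Finset.card_filter]
        exact Finset.sum_comm
    _ ≤ ∑ _e ∈ A, r := Finset.sum_le_sum fun e he => card_under_le (hslot e he) n
    _ = A.card * r := by simp

end DynKCenter

namespace DynKCenter
open RAM

/-! ## The update of the tree of one guess -/

/-- The address of the block of the guess `g` and the node `v`, if there are `G` guesses. -/
def addr (k G g v : ℕ) : ℕ := ((v - 1) * G + g) * (k + k + 3) + 1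

/-- The tree of the guess `g`. -/
def tree (k G : ℕ) (s : Store) (g : ℕ) : ℕ → Blk := fun v => blk k s (addr k G g v)

/-- The arrays `3` and `4` hold the parents of the nodes and the addresses of their blocks. -/
structure Layout (k G N : ℕ) (s : Store) : Prop where
  parent : ∀ v, 1 ≤ v → v ≤ N → s.narr 3 v = v / 2
  base : ∀ v, 1 ≤ v → v ≤ N → s.narr 4 v = (v - 1) * G * (k + k + 3)

theorem Layout.congr {k G N : ℕ} {s s' : Store} (h : Layout k G N s) (h3 : s'.narr 3 = s.narr 3)
    (h4 : s'.narr 4 = s.narr 4) : Layout k G N s' :=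
  ⟨fun v hv hN => by rw [h3, h.parent v hv hN], fun v hv hN => by rw [h4, h.base v hv hN]⟩

/-- The pair of a guess and a node is recovered from `(v - 1) * G + g` by division with remainder.
Different codes give disjoint windows. -/
theorem addr_disjoint {k G g g' v v' : ℕ} (hg : g < G) (hg' : g' < G) (hv : 1 ≤ v) (hv' : 1 ≤ v')
    (hne : ¬ (g = g' ∧ v = v')) :
    addr k G g' v' + (k + k + 3) ≤ addr k G g v ∨ addr k G g v + (k + k + 3) ≤ addr k G g' v' := by
  have hx : (v - 1) * G + g ≠ (v' - 1) * G + g' := by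
    intro h
    have hm := congrArg (· % G) h
    have hd := congrArg (· / G) h
    have hG : 0 < G := by omega
    simp only [Nat.mul_add_mod_self_right, Nat.mod_eq_of_lt hg, Nat.mod_eq_of_lt hg'] at hm
    simp only [Nat.mul_comm _ G, Nat.mul_add_div hG, Nat.div_eq_of_lt hg, Nat.div_eq_of_lt hg',
      add_zero] at hd
    exact hne ⟨hm, by omega⟩
  unfold addr
  rcases lt_or_gt_of_ne hx with h | h
  · right
    have := Nat.mul_le_mul_right (k + k + 3) (Nat.succ_le_of_lt h)
    rw [Nat.succ_mul] at this
    omega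
  · left
    have := Nat.mul_le_mul_right (k + k + 3) (Nat.succ_le_of_lt h)
    rw [Nat.succ_mul] at this
    omega

theorem tree_update {k G g v : ℕ} {s s' : Store} (hg : g < G) (hv : 1 ≤ v)
    (h : OutsideEq k (addr k G g v) s s') {w : ℕ} (hw : 1 ≤ w) :
    tree k G s' g w = Function.update (tree k G s g) v (blk k s' (addr k G g v)) w := by
  by_cases hwv : w = v
  · subst hwv; simp [tree]
  · rw [Function.update_of_ne hwv]
    exact h.blk_eq (addr_disjoint hg hg hv hw (by tauto))

theorem tree_ne {k G g g' v : ℕ} {s s' : Store} (hg : g < G) (hv : 1 ≤ v)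
    (h : OutsideEq k (addr k G g v) s s') (hg' : g' < G) (hne : g' ≠ g) {w : ℕ} (hw : 1 ≤ w) :
    tree k G s' g' w = tree k G s g' w :=
  h.blk_eq (addr_disjoint hg hg' hv hw (by tauto))

variable {near : ℕ → ℕ → Prop} {k N v : ℕ} {A : Finset ℕ} {slot : ℕ → ℕ} {new : ℕ → Prop}
  {T : ℕ → Blk}

theorem Tree.congr {T' : ℕ → Blk} (h : Tree near k N A slot v new T)
    (hT : ∀ w, 1 ≤ w → T' w = T w) : Tree near k N A slot v new T' where
  weak w hw := by rw [hT w hw]; exact h.weak w hw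
  empty w hw := by rw [hT w (by omega)]; exact h.empty w hw
  mem w hw e := by
    rw [hT w hw, hT (2 * w) (by omega), hT (2 * w + 1) (by omega)]; exact h.mem w hw e
  fresh hv e he := by rw [hT v hv]; exact h.fresh hv e he

theorem sum_congr_tree {n : ℕ} {T T' : ℕ → Blk} (g : Blk → ℕ) (hT : ∀ w, 1 ≤ w → T' w = T w) :
    ∑ w ∈ Finset.Icc 1 n, g (T' w) = ∑ w ∈ Finset.Icc 1 n, g (T w) :=
  Finset.sum_congr rfl fun w hw => by rw [hT w (Finset.mem_Icc.1 hw).1]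

/-- Removes the name in register `1` from all blocks on the path from the node in register `9` to
the root. -/
def removePath : Cmd :=
  .while (.nle (.lit 1) (.reg 9)) (removeNode ;; .setN 9 (.get 3 (.reg 9)))

/-- Each of the at most `r` nodes on the path loses at most one center, and pending counts do not
grow. Only the weak invariants survive on the path; settledness is restored by the rescan that
follows. -/
theorem wp_removePath {d : ℕ → ℕ → ℝ} {s : Store} {G g n p x r : ℕ}
    (hk : s.nreg 2 = k) (hg : g < G) (hoff : s.nreg 6 = g * (k + k + 3)) (hp : s.nreg 1 = p)
    (hx : s.nreg 9 = x) (hr : ∀ e, near e e) (hL : Layout k G N s) (hxN : x ≤ N) (hNn : N ≤ n)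
    (hxr : x < 2 ^ r) (hw : ∀ w, 1 ≤ w → Weak near k (tree k G s g w))
    (hsz : ∀ w, 1 ≤ w → (tree k G s g w).nU ≤ k + k + 3)
    (hov : s.narr 5 (g * (k + k + 3)) = overflow k n (tree k G s g)) :
    wp d removePath (fun t s' => t ≤ r * (300 * (k + k + 3)) + 10 ∧
      (∀ w, 1 ≤ w → Under w x → Removed p (tree k G s g w) (tree k G s' g w)) ∧
      (∀ w, 1 ≤ w → ¬ Under w x → tree k G s' g w = tree k G s g w) ∧
      (∀ g' < G, g' ≠ g → ∀ w, 1 ≤ w → tree k G s' g' w = tree k G s g' w) ∧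
      (∀ y ≠ g * (k + k + 3), s'.narr 5 y = s.narr 5 y) ∧
      s'.narr 5 (g * (k + k + 3)) = overflow k n (tree k G s' g) ∧
      pendingCount n (tree k G s' g) ≤ pendingCount n (tree k G s g) ∧
      centerCount n (tree k G s g) ≤ centerCount n (tree k G s' g) + r) s := by
  -- `st` counts the rounds; the bound `v < 2 ^ (r - st)` limits it by `r`. Nodes of the path that
  -- are still above or at `v` are unchanged.
  refine wp_while (fun t s' => ∃ v st, s'.nreg 9 = v ∧ v ≤ N ∧ st ≤ r ∧ v < 2 ^ (r - st) ∧
      (v = 0 ∨ Under v x) ∧ t ≤ st * (300 * (k + k + 3)) ∧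
      (∀ w, 1 ≤ w → Under w x → ¬ Under w v → Removed p (tree k G s g w) (tree k G s' g w)) ∧
      (∀ w, 1 ≤ w → (¬ Under w x ∨ Under w v) → tree k G s' g w = tree k G s g w) ∧
      (∀ g' < G, g' ≠ g → ∀ w, 1 ≤ w → tree k G s' g' w = tree k G s g' w) ∧
      (∀ y ≠ g * (k + k + 3), s'.narr 5 y = s.narr 5 y) ∧
      s'.narr 5 (g * (k + k + 3)) = overflow k n (tree k G s' g) ∧
      pendingCount n (tree k G s' g) ≤ pendingCount n (tree k G s g) ∧
      centerCount n (tree k G s g) ≤ centerCount n (tree k G s' g) + st)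
    (fun s' => s'.nreg 9) ?_ ?_ ?_
  · refine ⟨x, 0, hx, hxN, by omega, by simpa using hxr, .inr (under_self x), by omega, ?_, ?_, ?_, ?_, hov,
      le_rfl, by omega⟩
    · intro w _ h h'; exact absurd h h'
    all_goals intros; rfl
  · rintro t s' hf ⟨v, st, hv, hvN, hst, hvr, hvx, ht, hrem, hsame, hoth, h5, hov', hpe, hce⟩ hb
    have f2 := hf.nreg 2 (by decide)
    have f1 := hf.nreg 1 (by decide)
    have f6 := hf.nreg 6 (by decide)
    rw [hk] at f2
    rw [hp] at f1
    rw [hoff] at f6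
    have hv1 : 1 ≤ v := by simpa [hv] using hb
    have hvx : Under v x := hvx.resolve_left (by omega)
    have hst' : st < r := by
      by_contra h
      have : r - st = 0 := by omega
      rw [this] at hvr
      omega
    have hTv := hsame v hv1 (.inr (under_self v))
    have hbase : s'.narr 4 v = (v - 1) * G * (k + k + 3) := by
      rw [hf.narr 4 (by decide)]; exact hL.base v hv1 hvN
    have hpar : s'.narr 3 v = v / 2 := by
      rw [hf.narr 3 (by decide)]; exact hL.parent v hv1 hvN
    have hwv : Weak near k (tree k G s' g v) := hTv ▸ hw v hv1
    simp only [wp_seq, wp_setN]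
    refine (wp_removeNode (A := addr k G g v) f2 ?_ f1 hwv.nC_le ?_ (hwv.injC hr)
      hwv.injU).mono ?_
    · rw [hv, f6, hbase]; unfold addr; ring
    · have := hsz v hv1
      rwa [← hTv] at this
    rintro t2 s2 f ⟨ht2, hR, ho, h52, h52'⟩
    have g9 := f.nreg 9 (by decide)
    have g3 := f.narr 3 (by decide)
    rw [hv] at g9
    generalize hs3 : s2.setN 9 _ = s3
    have hblk : ∀ B, blk k s3 B = blk k s2 B := fun B => by simp [← hs3, blk]
    have htr : ∀ g', tree k G s3 g' = tree k G s2 g' := fun g' => by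
      funext w; exact hblk _
    have h9 : s3.nreg 9 = v / 2 := by simp [← hs3, g9, g3, hpar]
    have hup : ∀ w, 1 ≤ w → tree k G s3 g w =
        Function.update (tree k G s' g) v (blk k s2 (addr k G g v)) w := fun w hw1 => by
      rw [htr]; exact tree_update hg hv1 ho hw1
    have hupv : tree k G s3 g v = blk k s2 (addr k G g v) := by rw [hup v hv1]; simp
    have hR' : Removed p (tree k G s' g v) (blk k s2 (addr k G g v)) := hR
    have hle := hR'.nC_le
    rw [f6] at h52 h52'
    refine ⟨⟨v / 2, st + 1, h9, by omega, hst', ?_, .inr hvx.half, ?_, ?_, ?_, ?_, ?_, ?_, ?_, ?_⟩,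
      by omega⟩
    · have : r - st = (r - (st + 1)) + 1 := by omega
      rw [this, pow_succ] at hvr
      omega
    · simp only [BExp.time, NExp.time, Nat.add_mul, Nat.one_mul]
      omega
    · intro w hw1 hwx hwv2
      by_cases hwv' : w = v
      · subst hwv'
        rw [hupv, ← hTv]
        exact hR'
      · rw [hup w hw1, Function.update_of_ne hwv']
        refine hrem w hw1 hwx fun h => ?_
        rcases under_iff.1 h with h | h
        exacts [hwv' h, hwv2 h]
    · intro w hw1 hor
      have hwv' : w ≠ v := by
        rintro rfl
        rcases hor with h | h
        · exact h hvx
        · have := h.le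
          omega
      rw [hup w hw1, Function.update_of_ne hwv']
      refine hsame w hw1 (hor.imp_right fun h => under_iff.2 (.inr h))
    · intro g' hg' hne w hw1
      rw [htr, tree_ne hg hv1 ho hg' hne hw1]
      exact hoth g' hg' hne w hw1
    · intro y hy
      rw [← hs3, setN_narr, h52 y hy, h5 y hy]
    · rw [← hs3, setN_narr, h52', hov', hs3]
      unfold overflow
      rw [sum_congr_tree (fun b => b.nC - k) hup]
      have h1 := sum_update_add (g := fun b => b.nC - k) (n := n) (tree k G s' g)
        (blk k s2 (addr k G g v)) hv1 (by omega)
      have h2 : (tree k G s' g v).nC - k ≤ ∑ w ∈ Finset.Icc 1 n, ((tree k G s' g w).nC - k) :=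
        Finset.single_le_sum (f := fun w => (tree k G s' g w).nC - k) (fun _ _ => Nat.zero_le _)
          (Finset.mem_Icc.2 ⟨hv1, by omega⟩)
      have h3 : (blk k s' (addr k G g v)).nC = (tree k G s' g v).nC := rfl
      rw [h3]
      omega
    · refine le_trans ?_ hpe
      unfold pendingCount
      rw [sum_congr_tree Blk.pending hup]
      have h1 := sum_update_add (g := Blk.pending) (n := n) (tree k G s' g)
        (blk k s2 (addr k G g v)) hv1 (by omega)
      have h2 := hR'.pending_le hwv
      omega
    · have h1 := sum_update_add (g := Blk.nC) (n := n) (tree k G s' g)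
        (blk k s2 (addr k G g v)) hv1 (by omega)
      have h4 : centerCount n (tree k G s3 g) = ∑ w ∈ Finset.Icc 1 n,
          (Function.update (tree k G s' g) v (blk k s2 (addr k G g v)) w).nC :=
        sum_congr_tree Blk.nC hup
      unfold centerCount at h4 hce ⊢
      omega
  · rintro t s' hf ⟨v, st, hv, hvN, hst, hvr, hvx, ht, hrem, hsame, hoth, h5, hov', hpe, hce⟩ hb
    have hv0 : v = 0 := by
      have : ¬ 1 ≤ v := by simpa [hv] using hb
      omega
    subst hv0
    refine ⟨?_, ?_, ?_, hoth, h5, hov', hpe, by omega⟩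
    · have := Nat.mul_le_mul_right (300 * (k + k + 3)) hst
      simp only [BExp.time, NExp.time]
      linarith
    · intro w hw1 hwx
      exact hrem w hw1 hwx fun h => by rw [under_zero] at h; omega
    · intro w hw1 hwx
      exact hsame w hw1 (.inl hwx)

end DynKCenter

/-! ### New centers on the way to the root. -/

namespace DynKCenter
open RAM

/-- Adds the new elements that are described by the registers `14`, `15` and `16` to the block of
the node in register `9`, scans the blocks on the path from this node to the root, and hands the new
centers of each block to the next one. -/
def insertPath : Cmd :=
  .while (.nle (.lit 1) (.reg 9)) (processNode ;; .setN 9 (.get 3 (.reg 9)))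

variable {near : ℕ → ℕ → Prop} {k N : ℕ} {A : Finset ℕ} {slot : ℕ → ℕ}

/-- The flag `J` marks an insertion: all blocks are settled beforehand and at most one element is
new, so by induction each node has at most one unsettled element and hands up at most one new
center. In the last clause every new center is worth `2 (k + k + 3)`, which covers its own block and
its arrival in the parent. -/
theorem wp_insertPath {d : ℕ → ℕ → ℝ} {s : Store} {G g n x r lo hi src : ℕ} {J : Prop}
    (hk : s.nreg 2 = k) (hg : g < G) (hoff : s.nreg 6 = g * (k + k + 3))
    (hx : s.nreg 9 = x) (hlo : s.nreg 14 = lo) (hhi : s.nreg 15 = hi) (hsrc : s.nreg 16 = src)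
    (hle : lo ≤ hi) (hr : ∀ e, near e e) (hs : ∀ e f, near e f → near f e)
    (hL : Layout k G N s) (hxN : x ≤ N) (hNn : N ≤ n) (hxr : x < 2 ^ r) (hslot : Set.InjOn slot A)
    (hT : Tree near k N A slot x (fun e => ∃ i < hi - lo, s.narr 7 (src + lo + i) = e)
      (tree k G s g))
    (hinj : ∀ i < hi - lo, ∀ j < hi - lo,
      s.narr 7 (src + lo + i) = s.narr 7 (src + lo + j) → i = j)
    (hset : ∀ w, 1 ≤ w → ¬ Under w x → ∀ i < (tree k G s g w).nU,
      Settled near k (tree k G s g w) i)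
    (hov : s.narr 5 (g * (k + k + 3)) = overflow k n (tree k G s g))
    (hd : ∀ e ∈ A, ∀ f ∈ A, (d e f ≤ s.rreg 4 ↔ near e f))
    (hJ : J → hi - lo ≤ 1 ∧ ∀ w, 1 ≤ w → ∀ i < (tree k G s g w).nU,
      Settled near k (tree k G s g w) i) :
    wp d insertPath (fun t s' => ∃ c, t ≤ r * (400 * (k + k + 3)) + 40 * c + 10 ∧
      Tree near k N A slot 0 (fun _ => False) (tree k G s' g) ∧
      (∀ w, 1 ≤ w → ∀ i < (tree k G s' g w).nU, Settled near k (tree k G s' g w) i) ∧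
      (∀ g' < G, g' ≠ g → ∀ w, 1 ≤ w → tree k G s' g' w = tree k G s g' w) ∧
      (∀ y ≠ g * (k + k + 3), s'.narr 5 y = s.narr 5 y) ∧
      s'.narr 5 (g * (k + k + 3)) = overflow k n (tree k G s' g) ∧
      c ≤ r * ((k + 1) * (k + k + 3)) ∧ (J → c ≤ r * (k + 1)) ∧
      c + pendingCount n (tree k G s' g) + 2 * ((k + k + 3) * centerCount n (tree k G s g)) ≤
        pendingCount n (tree k G s g) + (k + k + 3) * (hi - lo) +
          2 * ((k + k + 3) * centerCount n (tree k G s' g))) s := by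
  -- The `hi' - lo'` centers just created below `v` have not yet been added there; the term `(k + k
  -- + 3) * (hi' - lo')` reserves the pending comparisons that they will cause. Blocks outside the
  -- rest of the path are settled.
  refine wp_while (fun t s' => ∃ v st lo' hi' src' c, s'.nreg 9 = v ∧ s'.nreg 14 = lo' ∧
      s'.nreg 15 = hi' ∧ s'.nreg 16 = src' ∧ lo' ≤ hi' ∧ v ≤ N ∧ st ≤ r ∧ v < 2 ^ (r - st) ∧
      t ≤ st * (400 * (k + k + 3)) + 40 * c ∧
      Tree near k N A slot v (fun e => ∃ i < hi' - lo', s'.narr 7 (src' + lo' + i) = e)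
        (tree k G s' g) ∧
      (∀ i < hi' - lo', ∀ j < hi' - lo',
        s'.narr 7 (src' + lo' + i) = s'.narr 7 (src' + lo' + j) → i = j) ∧
      (∀ w, 1 ≤ w → ¬ Under w v → ∀ i < (tree k G s' g w).nU,
        Settled near k (tree k G s' g w) i) ∧
      (∀ g' < G, g' ≠ g → ∀ w, 1 ≤ w → tree k G s' g' w = tree k G s g' w) ∧
      (∀ y ≠ g * (k + k + 3), s'.narr 5 y = s.narr 5 y) ∧
      s'.narr 5 (g * (k + k + 3)) = overflow k n (tree k G s' g) ∧
      (J → hi' - lo' ≤ 1 ∧ ∀ w, 1 ≤ w → ∀ i < (tree k G s' g w).nU,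
        Settled near k (tree k G s' g w) i) ∧
      c ≤ st * ((k + 1) * (k + k + 3)) ∧ (J → c ≤ st * (k + 1)) ∧
      c + pendingCount n (tree k G s' g) + (k + k + 3) * (hi' - lo') +
          2 * ((k + k + 3) * centerCount n (tree k G s g)) ≤
        pendingCount n (tree k G s g) + (k + k + 3) * (hi - lo) +
          2 * ((k + k + 3) * centerCount n (tree k G s' g)))
    (fun s' => s'.nreg 9) ?_ ?_ ?_
  · exact ⟨x, 0, lo, hi, src, 0, hx, hlo, hhi, hsrc, hle, hxN, by omega, by simpa using hxr,
      by omega, hT, hinj, hset, by intros; rfl, by intros; rfl, hov, hJ, by omega,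
      fun _ => by omega, by omega⟩
  · rintro t s' hf ⟨v, st, lo', hi', src', c, hv, hlo', hhi', hsrc', hle', hvN, hst, hvr, ht, hT',
      hinj', hset', hoth, h5, hov', hJ', hc, hcJ, hpot⟩ hb
    have f2 := hf.nreg 2 (by decide)
    have f6 := hf.nreg 6 (by decide)
    have f4 := hf.rreg 4 (by decide)
    rw [hk] at f2
    rw [hoff] at f6
    have hv1 : 1 ≤ v := by simpa [hv] using hb
    have hst' : st < r := by
      by_contra h
      have : r - st = 0 := by omega
      rw [this] at hvr
      omega
    have hbase : s'.narr 4 v = (v - 1) * G * (k + k + 3) := by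
      rw [hf.narr 4 (by decide)]; exact hL.base v hv1 hvN
    have hpar : s'.narr 3 v = v / 2 := by
      rw [hf.narr 3 (by decide)]; exact hL.parent v hv1 hvN
    have hsz := hT'.size hslot (fun e => Iff.rfl) hinj' hv1
    have hwv := hT'.weak v hv1
    simp only [wp_seq, wp_setN]
    refine (wp_processNode (near := near) (A := addr k G g v) (S := fun e => e ∈ A) hr hs f2 ?_
      hlo' hhi' hsrc' hle' hsz hwv hinj' ?_ ?_ ?_ ?_).mono ?_
    · rw [hv, f6, hbase]; unfold addr; ring
    · exact fun i hi => hT'.fresh hv1 _ ⟨i, hi, rfl⟩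
    · exact fun e he => (hT'.memU_under hv1 he).1
    · exact fun i hi => (hT'.memU_or v hv1 _ (.inr ⟨rfl, i, hi, rfl⟩)).1
    · intro e f he hf'
      rw [f4]
      exact hd e he f hf'
    rintro t2 s2 f ⟨b₁, c1, ht2, hpush, hsc, ho, h52, h52', g14, g15, g16⟩
    have g9 := f.nreg 9 (by decide)
    have g3 := f.narr 3 (by decide)
    rw [hv] at g9
    have hstep := hT'.step hr (fun e => Iff.rfl) hv1 hvN hpush hsc
    generalize hs3 : s2.setN 9 _ = s3
    have htr : ∀ g', tree k G s3 g' = tree k G s2 g' := fun g' => by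
      funext w; simp [← hs3, tree, blk]
    have h9 : s3.nreg 9 = v / 2 := by simp [← hs3, g9, g3, hpar]
    have hup : ∀ w, 1 ≤ w → tree k G s3 g w =
        Function.update (tree k G s' g) v (blk k s2 (addr k G g v)) w := fun w hw1 => by
      rw [htr]; exact tree_update hg hv1 ho hw1
    generalize hb' : blk k s2 (addr k G g v) = b' at *
    have hbv : blk k s' (addr k G g v) = tree k G s' g v := rfl
    rw [hbv] at hpush h52' g14
    clear hbv
    generalize hbb : tree k G s' g v = b at *
    have hnC := hsc.nC_le
    rw [hpush.nC] at hnC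
    have hnCk := hsc.weak.nC_le
    have hCnew : ∀ i < b'.nC - b.nC,
        s3.narr 7 (addr k G g v + b.nC + i) = b'.C (b.nC + i) := fun i hi => by
      have : b.nC + i < k + k + 3 := by omega
      rw [← hb', ← hs3, setN_narr, Nat.add_assoc]
      exact (if_pos this).symm
    rw [f6] at h52 h52'
    have hun := unsettled_le near k b₁ b₁.nU
    have hb1U : b₁.nU ≤ k + k + 3 := by rw [hpush.nU]; exact hsz
    have hc1 := hsc.comparisons
    have hc1new := hsc.new
    rw [hpush.nC] at hc1new
    have hJ1 : J → unsettled near k b₁ b₁.nU ≤ 1 := fun hj => by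
      refine (hpush.unsettled_le fun i hi => ?_).trans (hJ' hj).1
      have := (hJ' hj).2 v hv1 i
      rw [hbb] at this
      exact this hi
    have hsetv : ∀ i < b'.nU, Settled near k b' i := fun i hi => hsc.settled i (hsc.nU ▸ hi)
    refine ⟨⟨v / 2, st + 1, b.nC, b'.nC, addr k G g v, c + c1, h9, by simp [← hs3, g14],
      by simp [← hs3, g15], by simp [← hs3, g16], hnC, by omega, hst', ?_, ?_, ?_, ?_, ?_, ?_, ?_,
      ?_, ?_, ?_, ?_, ?_⟩, by omega⟩
    · have : r - st = (r - (st + 1)) + 1 := by omega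
      rw [this, pow_succ] at hvr
      omega
    · simp only [BExp.time, NExp.time, Nat.add_mul, Nat.one_mul]
      omega
    · have heq : (fun e => ∃ i < b'.nC - b.nC, s3.narr 7 (addr k G g v + b.nC + i) = e) =
          fun e => ∃ i < b'.nC - b.nC, b'.C (b.nC + i) = e := by
        funext e
        refine propext ⟨?_, ?_⟩
        · rintro ⟨i, hi, rfl⟩; exact ⟨i, hi, (hCnew i hi).symm⟩
        · rintro ⟨i, hi, rfl⟩; exact ⟨i, hi, hCnew i hi⟩
      rw [heq]
      exact hstep.congr hup
    · intro i hi j hj hij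
      rw [hCnew i hi, hCnew j hj] at hij
      have := hsc.weak.injC hr _ (by omega) _ (by omega) hij
      omega
    · intro w hw1 hnw
      rw [hup w hw1]
      by_cases hwv' : w = v
      · subst hwv'
        rw [Function.update_self]
        exact hsetv
      · rw [Function.update_of_ne hwv']
        exact hset' w hw1 fun h => (under_iff.1 h).elim hwv' hnw
    · intro g' hg' hne w hw1
      rw [htr, tree_ne hg hv1 ho hg' hne hw1]
      exact hoth g' hg' hne w hw1
    · intro y hy
      rw [← hs3, setN_narr, h52 y hy, h5 y hy]
    · rw [← hs3, setN_narr, h52', hov', hs3]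
      unfold overflow
      rw [sum_congr_tree (fun b => b.nC - k) hup]
      have h1 := sum_update_add (g := fun b => b.nC - k) (n := n) (tree k G s' g) b' hv1 (by omega)
      have h2 : (tree k G s' g v).nC - k ≤ ∑ w ∈ Finset.Icc 1 n, ((tree k G s' g w).nC - k) :=
        Finset.single_le_sum (f := fun w => (tree k G s' g w).nC - k) (fun _ _ => Nat.zero_le _)
          (Finset.mem_Icc.2 ⟨hv1, by omega⟩)
      rw [hbb] at h1 h2
      omega
    · intro hj
      refine ⟨by have := hJ1 hj; omega, fun w hw1 => ?_⟩
      rw [hup w hw1]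
      by_cases hwv' : w = v
      · subst hwv'
        rw [Function.update_self]
        exact hsetv
      · rw [Function.update_of_ne hwv']
        exact (hJ' hj).2 w hw1
    · have := Nat.mul_le_mul_left (k + 1) (hun.trans hb1U)
      rw [Nat.add_mul, Nat.one_mul]
      omega
    · intro hj
      have h1 := Nat.mul_le_mul_left (k + 1) (hJ1 hj)
      have h2 := hcJ hj
      rw [Nat.add_mul, Nat.one_mul]
      omega
    · have hp1 := hsc.pending
      rw [hpush.pending, hpush.nC] at hp1
      have h1 := sum_update_add (g := Blk.pending) (n := n) (tree k G s' g) b' hv1 (by omega)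
      have h2 := sum_update_add (g := Blk.nC) (n := n) (tree k G s' g) b' hv1 (by omega)
      have h3 : pendingCount n (tree k G s3 g) = ∑ w ∈ Finset.Icc 1 n,
          (Function.update (tree k G s' g) v b' w).pending := sum_congr_tree Blk.pending hup
      have h4 : centerCount n (tree k G s3 g) = ∑ w ∈ Finset.Icc 1 n,
          (Function.update (tree k G s' g) v b' w).nC := sum_congr_tree Blk.nC hup
      rw [← h3, hbb] at h1
      rw [← h4, hbb] at h2
      have h5 := Nat.mul_le_mul_right (b'.nC - b.nC) hb1U
      -- This spends the reserve of the previous round; the `b'.nC - b.nC` centers created now fill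
      -- it again.
      have h6 : (hi' - lo') * b.nC ≤ (k + k + 3) * (hi' - lo') := by
        rw [mul_comm]
        exact Nat.mul_le_mul_right _ (by omega)
      have h7 : centerCount n (tree k G s3 g) = centerCount n (tree k G s' g) + (b'.nC - b.nC) := by
        unfold centerCount at h2 ⊢
        omega
      rw [h7, Nat.mul_add]
      unfold pendingCount at h1 hpot ⊢
      omega
  · rintro t s' hf ⟨v, st, lo', hi', src', c, hv, hlo', hhi', hsrc', hle', hvN, hst, hvr, ht, hT',
      hinj', hset', hoth, h5, hov', hJ', hc, hcJ, hpot⟩ hb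
    have hv0 : v = 0 := by
      have : ¬ 1 ≤ v := by simpa [hv] using hb
      omega
    subst hv0
    refine ⟨c, ?_, hT'.finish, ?_, hoth, h5, hov', hc.trans (Nat.mul_le_mul_right _ hst),
      fun hj => (hcJ hj).trans (Nat.mul_le_mul_right _ hst), by omega⟩
    · have := Nat.mul_le_mul_right (400 * (k + k + 3)) hst
      simp only [BExp.time, NExp.time]
      linarith
    · intro w hw1
      exact hset' w hw1 fun h => by rw [under_zero] at h; omega

end DynKCenter

namespace DynKCenter
open RAM

/-! ## The update of all guesses -/

/-- Updates the tree of the guess whose threshold is the product of the real registers `2` and `3`,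
and moves on to the next guess. -/
def guessBody : Cmd :=
  .setR 4 (.mul (.reg 2) (.reg 3)) ;;
  .putN 7 (.lit 0) (.reg 1) ;;
  .setN 9 (.reg 8) ;;
  .ite (.neq (.reg 0) (.lit 1)) (removePath ;; .setN 9 (.reg 8)) .skip ;;
  .setN 16 (.lit 0) ;; .setN 14 (.lit 0) ;; .setN 15 (.sub (.lit 1) (.reg 0)) ;;
  insertPath ;;
  .setN 6 (.add (.reg 6) (.add (.add (.reg 2) (.reg 2)) (.lit 3))) ;;
  .setR 3 (.mul (.reg 3) (.add (.lit 1) (.div (.reg 0) (.lit 2))))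

theorem blk_putN_zero {k A v : ℕ} (s : Store) (hA : 1 ≤ A) : blk k (s.putN 7 0 v) A = blk k s A := by
  have : A ≠ 0 := by omega
  ext j <;> simp [blk, this]

theorem tree_putN_zero {k G v : ℕ} (s : Store) (g : ℕ) :
    tree k G (s.putN 7 0 v) g = tree k G s g := by
  funext w
  exact blk_putN_zero s (by unfold addr; omega)

theorem tree_setN {k G x v : ℕ} (s : Store) (g : ℕ) : tree k G (s.setN x v) g = tree k G s g := by
  funext w; simp [tree, blk]

theorem tree_setR {k G x : ℕ} {v : ℝ} (s : Store) (g : ℕ) :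
    tree k G (s.setR x v) g = tree k G s g := by
  funext w; simp [tree, blk]

theorem tree_putN {k G a i v : ℕ} (s : Store) (g : ℕ) (ha : a < 6) :
    tree k G (s.putN a i v) g = tree k G s g := by
  funext w
  simp [tree, blk, show 6 ≠ a by omega, show 7 ≠ a by omega, show 8 ≠ a by omega,
    show 9 ≠ a by omega, show 10 ≠ a by omega]

/-- The names whose distance is at most `r`. -/
def Near (D : ℕ → ℕ → ℝ) (r : ℝ) (e f : ℕ) : Prop := D e f ≤ r

/-- The invariants of the data of the guess `g` between two updates. -/
structure Good (near : ℕ → ℕ → Prop) (k G N n : ℕ) (A : Finset ℕ) (slot : ℕ → ℕ) (s : Store)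
    (g : ℕ) : Prop where
  tree : Tree near k N A slot 0 (fun _ => False) (tree k G s g)
  settled : ∀ w, 1 ≤ w → ∀ i < (DynKCenter.tree k G s g w).nU,
    Settled near k (DynKCenter.tree k G s g w) i
  overflow : s.narr 5 (g * (k + k + 3)) = overflow k n (DynKCenter.tree k G s g)

theorem Good.congr {near : ℕ → ℕ → Prop} {k G N n : ℕ} {A : Finset ℕ} {slot : ℕ → ℕ} {s s' : Store}
    {g : ℕ} (h : Good near k G N n A slot s g)
    (hT : ∀ w, 1 ≤ w → DynKCenter.tree k G s' g w = DynKCenter.tree k G s g w)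
    (h5 : s'.narr 5 (g * (k + k + 3)) = s.narr 5 (g * (k + k + 3))) :
    Good near k G N n A slot s' g where
  tree := h.tree.congr hT
  settled w hw := by rw [hT w hw]; exact h.settled w hw
  overflow := by
    rw [h5, h.overflow]
    exact (sum_congr_tree (fun b => b.nC - k) hT).symm

/-- The effect of the update of the name `p`, which is stored at the node `x`, on the set of active
names and their nodes; `code` is the kind of the update. -/
def Change (code p x : ℕ) (A A' : Finset ℕ) (slot slot' : ℕ → ℕ) : Prop :=
  (code = 0 ∧ p ∉ A ∧ A' = insert p A ∧ slot' = Function.update slot p x) ∨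
    (code = 1 ∧ p ∈ A ∧ A' = A.erase p ∧ slot' = slot ∧ slot p = x)

/-- The most comparisons per node and center in an update. -/
def workFactor (k code : ℕ) : ℕ := if code = 0 then 1 else k + k + 3

/-- The tree of the guess `g` has been updated in time `t`. -/
def GuessUpdated (D : ℕ → ℕ → ℝ) (k G N n : ℕ) (A : Finset ℕ) (slot : ℕ → ℕ) (g r : ℕ) (s : Store)
    (t : ℕ) (s' : Store) : Prop :=
  ∃ c, t ≤ r * (700 * (k + k + 3)) + 40 * c + 100 ∧
    Good (Near D (s.rreg 2 * s.rreg 3)) k G N n A slot s' g ∧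
    (∀ g' < G, g' ≠ g → ∀ w, 1 ≤ w → tree k G s' g' w = tree k G s g' w) ∧
    (∀ y ≠ g * (k + k + 3), s'.narr 5 y = s.narr 5 y) ∧
    c ≤ r * ((k + 1) * workFactor k (s.nreg 0)) ∧
    c + pendingCount n (tree k G s' g) + 2 * ((k + k + 3) * centerCount n (tree k G s g)) ≤
      pendingCount n (tree k G s g) + 2 * ((k + k + 3) * centerCount n (tree k G s' g)) +
        2 * ((k + k + 3) * (r + 1)) ∧
    s'.nreg 6 = (g + 1) * (k + k + 3) ∧
    s'.rreg 3 = s.rreg 3 * (1 + s.rreg 0 / 2)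

/-- Blocks start at address `1`, so cell `0` of array `7` is free to hold the inserted name: it
poses as a source block with one new center (`lo = 0`, `hi = 1`), and the first node is treated like
all others. All blocks are settled, hence `J := True`. -/
theorem wp_guessBody_insert {d D : ℕ → ℕ → ℝ} {s : Store} {k G N N' g n p x r : ℕ}
    {A : Finset ℕ} {slot : ℕ → ℕ}
    (hD0 : ∀ e, D e e = 0) (hDs : ∀ e f, D e f = D f e)
    (hD : ∀ e ∈ (insert p A), ∀ f ∈ (insert p A), d e f = D e f) (hthr : 0 ≤ s.rreg 2 * s.rreg 3)
    (hk : s.nreg 2 = k) (hg : g < G) (hoff : s.nreg 6 = g * (k + k + 3)) (hp : s.nreg 1 = p)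
    (hx : s.nreg 8 = x) (h0 : s.nreg 0 = 0) (hpA : p ∉ A)
    (hL : Layout k G N' s) (hxN : x ≤ N') (hNN : N ≤ N') (hNn : N' ≤ n) (hxr : x < 2 ^ r)
    (hslot' : Set.InjOn (Function.update slot p x) ((insert p A : Finset ℕ) : Set ℕ))
    (hT : Good (Near D (s.rreg 2 * s.rreg 3)) k G N n A slot s g) :
    wp d guessBody (GuessUpdated D k G N' n (insert p A) (Function.update slot p x) g r s) s := by
  have hr : ∀ e, Near D (s.rreg 2 * s.rreg 3) e e := fun e => by
    unfold Near; rw [hD0]; exact hthr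
  have hs : ∀ e f, Near D (s.rreg 2 * s.rreg 3) e f → Near D (s.rreg 2 * s.rreg 3) f e :=
    fun e f h => by unfold Near at *; rwa [hDs]
  simp only [guessBody, wp_seq, wp_setN, wp_putN, wp_setR, wp_ite, wp_skip]
  refine ⟨fun hb => absurd hb (by simp [h0]), fun _ => ?_⟩
  generalize hs1 : Store.setN _ 15 _ = s1
  have htr : ∀ g', tree k G s1 g' = tree k G s g' := fun g' => by
    simp only [← hs1, tree_setN, NExp.eval, tree_putN_zero, tree_setR]
  have h5 : s1.narr 5 = s.narr 5 := by funext y; simp [← hs1]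
  have h7 : s1.narr 7 0 = p := by simp [← hs1, hp]
  have hL1 : Layout k G N' s1 := hL.congr (by funext y; simp [← hs1]) (by funext y; simp [← hs1])
  refine (wp_insertPath (near := Near D (s.rreg 2 * s.rreg 3)) (J := True) (n := n)
    (lo := 0) (hi := 1) (src := 0) (A := insert p A) (slot := Function.update slot p x)
    (by simpa [← hs1] using hk) hg (by simpa [← hs1] using hoff)
    (x := x) (by simpa [← hs1] using hx) (by simp [← hs1]) (by simp [← hs1, h0]) (by simp [← hs1])
    (by omega) hr hs hL1 hxN hNn hxr hslot' ?_ (by omega) ?_ ?_ ?_ ?_).mono ?_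
  · rw [htr]
    refine hT.tree.insert hpA hNN fun e => ?_
    simp only [zero_add]
    constructor
    · rintro ⟨i, hi, rfl⟩
      rw [show i = 0 by omega, h7]
    · rintro rfl
      exact ⟨0, by omega, h7⟩
  · rw [htr]
    exact fun w hw _ => hT.settled w hw
  · rw [htr, h5]
    exact hT.overflow
  · intro e he f hf
    rw [hD e he f hf]
    simp [← hs1, Near]
  · rw [htr]
    exact fun _ => ⟨by omega, hT.settled⟩
  · rintro t2 s2 f2 ⟨c, ht, hTr, hset, hoth, h52, hov, -, hcJ, hpot⟩
    rw [htr] at hpot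
    generalize hs3 : Store.setR _ 3 _ = s3
    have htr3 : ∀ g', tree k G s3 g' = tree k G s2 g' := fun g' => by
      simp only [← hs3, tree_setN, tree_setR]
    have h53 : s3.narr 5 = s2.narr 5 := by simp [← hs3]
    have f6 := f2.nreg 6 (by decide)
    have f2' := f2.nreg 2 (by decide)
    have r0 := f2.rreg 0 (by decide)
    have r3 := f2.rreg 3 (by decide)
    simp [← hs1, hk, hoff] at f6 f2' r0 r3
    refine ⟨c, ?_, ⟨by rwa [htr3], by rwa [htr3], by rwa [htr3, h53]⟩, ?_, ?_, ?_, ?_, ?_, ?_⟩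
    · simp only [NExp.time, RExp.time, BExp.time]
      have : r * (400 * (k + k + 3)) ≤ r * (700 * (k + k + 3)) :=
        Nat.mul_le_mul_left _ (Nat.mul_le_mul_right _ (by norm_num))
      omega
    · intro g' hg' hne w hw
      rw [htr3, hoth g' hg' hne w hw, htr]
    · intro y hy
      rw [h53, h52 y hy, h5]
    · simpa [workFactor, h0] using hcJ trivial
    · rw [htr3]
      have := Nat.mul_le_mul_left (k + k + 3) (show 1 ≤ r + 1 by omega)
      omega
    · simp [← hs3, f6, f2']; ring
    · simp [← hs3, r0, r3]

/-- The removal may unsettle many elements on the path, hence `J := False`. The up to `r` centers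
lost appear as the slack `2 (k + k + 3) (r + 1)` of the potential inequality. -/
theorem wp_guessBody_erase {d D : ℕ → ℕ → ℝ} {s : Store} {k G N N' g n p x r : ℕ}
    {A : Finset ℕ} {slot' : ℕ → ℕ}
    (hD0 : ∀ e, D e e = 0) (hDs : ∀ e f, D e f = D f e)
    (hD : ∀ e ∈ (A.erase p), ∀ f ∈ (A.erase p), d e f = D e f) (hthr : 0 ≤ s.rreg 2 * s.rreg 3)
    (hk : s.nreg 2 = k) (hg : g < G) (hoff : s.nreg 6 = g * (k + k + 3)) (hp : s.nreg 1 = p)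
    (hx : s.nreg 8 = x) (h0 : s.nreg 0 = 1) (hpx : slot' p = x)
    (hL : Layout k G N' s) (hxN : x ≤ N') (hNN : N ≤ N') (hNn : N' ≤ n) (hxr : x < 2 ^ r)
    (hslot : Set.InjOn slot' A) (hslot' : Set.InjOn slot' ((A.erase p : Finset ℕ) : Set ℕ))
    (hT : Good (Near D (s.rreg 2 * s.rreg 3)) k G N n A slot' s g) :
    wp d guessBody (GuessUpdated D k G N' n (A.erase p) slot' g r s) s := by
  have hr : ∀ e, Near D (s.rreg 2 * s.rreg 3) e e := fun e => by
    unfold Near; rw [hD0]; exact hthr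
  have hs : ∀ e f, Near D (s.rreg 2 * s.rreg 3) e f → Near D (s.rreg 2 * s.rreg 3) f e :=
    fun e f h => by unfold Near at *; rwa [hDs]
  simp only [guessBody, wp_seq, wp_setN, wp_putN, wp_setR, wp_ite, wp_skip]
  refine ⟨fun _ => ?_, fun hb => absurd (show s.nreg 0 = 1 from h0) (by simpa using hb)⟩
  generalize hs1 : Store.setN _ 9 _ = s1
  have htr : ∀ g', tree k G s1 g' = tree k G s g' := fun g' => by
    simp only [← hs1, tree_setN, NExp.eval, tree_putN_zero, tree_setR]
  have h5 : s1.narr 5 = s.narr 5 := by funext y; simp [← hs1]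
  have hL1 : Layout k G N' s1 := hL.congr (by funext y; simp [← hs1]) (by funext y; simp [← hs1])
  refine (wp_removePath (near := Near D (s.rreg 2 * s.rreg 3)) (k := k) (G := G) (g := g)
    (n := n) (p := p) (x := x) (r := r) (N := N')
    (by simpa [← hs1] using hk) hg (by simpa [← hs1] using hoff)
    (by simpa [← hs1] using hp) (by simpa [← hs1] using hx) hr hL1 hxN hNn hxr ?_ ?_ ?_).mono ?_
  · rw [htr]; exact hT.tree.weak
  · rw [htr]; exact fun w hw => hT.tree.nU_le hslot hw rfl
  · rw [htr, h5]; exact hT.overflow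
  rintro t2 s2 f2 ⟨ht2, hrem, hsame, hoth2, h52, hov2, hpe2, hce2⟩
  rw [htr] at hrem hsame hpe2 hce2
  have g0 := f2.nreg 0 (by decide)
  have g2 := f2.nreg 2 (by decide)
  have g6 := f2.nreg 6 (by decide)
  have g8 := f2.nreg 8 (by decide)
  have r0 := f2.rreg 0 (by decide)
  have r3 := f2.rreg 3 (by decide)
  have r4 := f2.rreg 4 (by decide)
  have a3 := f2.narr 3 (by decide)
  have a4 := f2.narr 4 (by decide)
  simp [← hs1, hk, hoff, hx, h0] at g0 g2 g6 g8 r0 r3 r4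
  generalize hs3 : Store.setN _ 15 _ = s3
  have htr3 : ∀ g', tree k G s3 g' = tree k G s2 g' := fun g' => by
    simp only [← hs3, tree_setN]
  have h53 : s3.narr 5 = s2.narr 5 := by simp [← hs3]
  have hL3 : Layout k G N' s3 := hL1.congr (by simp [← hs3, a3]) (by simp [← hs3, a4])
  have hTree : Tree (Near D (s.rreg 2 * s.rreg 3)) k N' (A.erase p) slot' 0 (fun _ => False)
      (tree k G s2 g) := by
    have h1 : Tree (Near D (s.rreg 2 * s.rreg 3)) k N' A slot' 0 (fun _ => False)
      (tree k G s g) := ⟨hT.tree.weak, fun w hw => hT.tree.empty w (by omega), hT.tree.mem,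
        hT.tree.fresh⟩
    have h2 := h1.remove (p := p)
      -- The nodes start at `1`; the index `0` is filled with the old value because `hsame` says
      -- nothing about it.
      (T' := fun w => if w = 0 then tree k G s g 0 else tree k G s2 g w) ?_ ?_
    · exact h2.congr fun w hw => by simp [show w ≠ 0 by omega]
    · intro w hw hun
      simp only [show w ≠ 0 by omega, if_false]
      exact hrem w hw (hpx ▸ hun)
    · intro w hun
      by_cases hw : w = 0
      · simp [hw]
      · simp only [hw, if_false]
        exact hsame w (by omega) (hpx ▸ hun)
  refine (wp_insertPath (near := Near D (s.rreg 2 * s.rreg 3)) (J := False) (n := n)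
    (lo := 0) (hi := 0) (src := 0) (A := A.erase p) (slot := slot')
    (by simpa [← hs3] using g2) hg (by simpa [← hs3] using g6)
    (x := x) (by simpa [← hs3] using g8) (by simp [← hs3]) (by simp [← hs3, g0])
    (by simp [← hs3])
    (by omega) hr hs hL3 hxN hNn hxr hslot' ?_ (by omega) ?_ ?_ ?_ ?_).mono ?_
  · rw [htr3]
    exact hTree.start x (by simp)
  · rw [htr3]
    intro w hw hun
    rw [hsame w hw hun]
    exact hT.settled w hw
  · rw [htr3, h53]
    exact hov2
  · intro e he f hf
    rw [hD e he f hf]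
    simp [← hs3, Near, r4]
  · exact False.elim
  · rintro t4 s4 f4 ⟨c, ht, hTr, hset, hoth, h54, hov, hcw, -, hpot⟩
    rw [htr3] at hpot
    generalize hs5 : Store.setR _ 3 _ = s5
    have htr5 : ∀ g', tree k G s5 g' = tree k G s4 g' := fun g' => by
      simp only [← hs5, tree_setN, tree_setR]
    have h55 : s5.narr 5 = s4.narr 5 := by simp [← hs5]
    have k6 := f4.nreg 6 (by decide)
    have k2 := f4.nreg 2 (by decide)
    have q0 := f4.rreg 0 (by decide)
    have q3 := f4.rreg 3 (by decide)
    simp [← hs3, g6, g2, r0, r3] at k6 k2 q0 q3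
    refine ⟨c, ?_, ⟨by rwa [htr5], by rwa [htr5], by rwa [htr5, h55]⟩, ?_, ?_, ?_, ?_, ?_, ?_⟩
    · simp only [NExp.time, RExp.time, BExp.time]
      have : r * (700 * (k + k + 3)) = r * (400 * (k + k + 3)) + r * (300 * (k + k + 3)) := by
        ring
      omega
    · intro g' hg' hne w hw
      rw [htr5, hoth g' hg' hne w hw, htr3, hoth2 g' hg' hne w hw, htr]
    · intro y hy
      rw [h55, h54 y hy, h53, h52 y hy, h5]
    · simpa [workFactor, h0] using hcw
    · rw [htr5]
      have h1 := Nat.mul_le_mul_left (k + k + 3) hce2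
      have h2 := Nat.mul_le_mul_left (k + k + 3) (Nat.le_succ r)
      rw [Nat.succ_eq_add_one] at h2
      rw [Nat.mul_add] at h1
      omega
    · simp [← hs5, k6, k2]; ring
    · simp [← hs5, q0, q3]

theorem wp_guessBody {d D : ℕ → ℕ → ℝ} {s : Store} {k G N N' g n p x r : ℕ}
    {A A' : Finset ℕ} {slot slot' : ℕ → ℕ}
    (hD0 : ∀ e, D e e = 0) (hDs : ∀ e f, D e f = D f e)
    (hD : ∀ e ∈ A', ∀ f ∈ A', d e f = D e f) (hthr : 0 ≤ s.rreg 2 * s.rreg 3)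
    (hk : s.nreg 2 = k) (hg : g < G) (hoff : s.nreg 6 = g * (k + k + 3)) (hp : s.nreg 1 = p)
    (hx : s.nreg 8 = x) (hu : Change (s.nreg 0) p x A A' slot slot')
    (hL : Layout k G N' s) (hxN : x ≤ N') (hNN : N ≤ N') (hNn : N' ≤ n) (hxr : x < 2 ^ r)
    (hslot : Set.InjOn slot A) (hslot' : Set.InjOn slot' A')
    (hT : Good (Near D (s.rreg 2 * s.rreg 3)) k G N n A slot s g) :
    wp d guessBody (GuessUpdated D k G N' n A' slot' g r s) s := by
  rcases hu with ⟨h0, hpA, rfl, rfl⟩ | ⟨h0, -, rfl, rfl, hpx⟩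
  · exact wp_guessBody_insert hD0 hDs hD hthr hk hg hoff hp hx h0 hpA hL hxN hNN hNn hxr hslot' hT
  · exact wp_guessBody_erase hD0 hDs hD hthr hk hg hoff hp hx h0 hpx hL hxN hNN hNn hxr hslot
      hslot' hT

end DynKCenter

namespace DynKCenter
open RAM

/-! ## The assignment of nodes to names -/

/-- Records the node of an inserted name, and the first distance that is seen, which determines the
smallest threshold. -/
def recordSlot : Cmd :=
  .putN 1 (.reg 1) (.reg 8) ;;
  .ite (.rle (.reg 2) (.lit 0))
    (.setR 2 (.div (.dist (.reg 1) (.reg 7)) (.mul (.lit 2) (.reg 1))) ;; .setN 7 (.reg 1))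
    .skip

/-- Assigns a node to an inserted name or releases the node of a deleted name; the node is left in
register `8`. -/
def allocate : Cmd :=
  .ite (.neq (.reg 0) (.lit 0))
    (.ite (.nle (.lit 1) (.reg 5))
      (.setN 5 (.sub (.reg 5) (.lit 1)) ;; .setN 8 (.get 2 (.reg 5)))
      (.setN 4 (.add (.reg 4) (.lit 1)) ;; .setN 8 (.reg 4) ;;
        .putN 3 (.reg 4) (.add (.get 3 (.sub (.reg 4) (.lit 2)))
          (.sub (.lit 1) (.sub (.lit 2) (.reg 4)))) ;;
        .putN 4 (.reg 4) (.add (.get 4 (.sub (.reg 4) (.lit 1))) (.reg 6))) ;;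
    recordSlot)
    (.setN 8 (.get 1 (.reg 1)) ;; .putN 2 (.reg 5) (.reg 8) ;;
      .setN 5 (.add (.reg 5) (.lit 1)))

/-- The bookkeeping of the nodes: register `4` holds their number, array `1` the nodes of the active
names, and array `2` the unoccupied nodes, whose number is in register `5`. -/
structure Slots (k G n : ℕ) (A : Finset ℕ) (s : Store) : Prop where
  le : s.nreg 4 ≤ n
  card : s.nreg 5 + A.card = s.nreg 4
  free_inj : ∀ i < s.nreg 5, ∀ j < s.nreg 5, s.narr 2 i = s.narr 2 j → i = j
  free_range : ∀ i < s.nreg 5, 1 ≤ s.narr 2 i ∧ s.narr 2 i ≤ s.nreg 4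
  free_ne : ∀ i < s.nreg 5, ∀ e ∈ A, s.narr 1 e ≠ s.narr 2 i
  slot_inj : Set.InjOn (s.narr 1) A
  slot_range : ∀ e ∈ A, 1 ≤ s.narr 1 e ∧ s.narr 1 e ≤ s.nreg 4
  layout : Layout k G (s.nreg 4) s
  parent_zero : s.narr 3 0 = 0
  base_zero : s.narr 4 0 = 0

/-- The real register `2` is zero as long as no two points have been active at the same time, and
then it holds a distance divided by `2 * Δ`. -/
def Scale (Δ r₀ : ℝ) (A : Finset ℕ) (s : Store) : Prop :=
  (s.rreg 2 = 0 ∧ ∀ e ∈ A, e = s.nreg 7) ∨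
    ∃ d₀, r₀ ≤ d₀ ∧ d₀ ≤ Δ * r₀ ∧ s.rreg 2 = d₀ / (2 * Δ)

theorem Scale.nonneg {Δ r₀ : ℝ} {A : Finset ℕ} {s : Store} (h : Scale Δ r₀ A s) (hr : 0 < r₀)
    (hΔ : 1 ≤ Δ) : 0 ≤ s.rreg 2 := by
  rcases h with h | ⟨d₀, h1, -, h3⟩
  · exact h.1.ge
  · rw [h3]
    have : 0 ≤ d₀ := hr.le.trans h1
    positivity

/-- With at most one active name every relevant comparison is of a name with itself, so all
reflexive relations agree. This permits the change of all thresholds at the moment when the scale is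
fixed. -/
theorem Good.congr_near {near near' : ℕ → ℕ → Prop} {k G N n : ℕ} {A : Finset ℕ} {slot : ℕ → ℕ}
    {s : Store} {g : ℕ} (h : Good near k G N n A slot s g) (hr : ∀ e, near e e)
    (hr' : ∀ e, near' e e) (hA : ∀ e ∈ A, ∀ f ∈ A, e = f) : Good near' k G N n A slot s g := by
  have hmem : ∀ w, 1 ≤ w → ∀ e, (DynKCenter.tree k G s g w).memU e → e ∈ A :=
    fun w hw e he => (h.tree.memU_under hw he).1
  refine ⟨⟨fun w hw => ?_, h.tree.empty, h.tree.mem, h.tree.fresh⟩, fun w hw i hi => ?_, h.overflow⟩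
  · refine (h.tree.weak w hw).congr_near fun e f he hf _ => ?_
    rw [hA e (hmem w hw e he) f (hmem w hw f hf)]
    exact hr f
  · rcases h.settled w hw i hi with ⟨h1, h2⟩ | h1
    · left
      refine ⟨h1, ?_⟩
      rw [hA _ (hmem w hw _ ⟨i, hi, rfl⟩) _
        (hmem w hw _ ((h.tree.weak w hw).sub _ ⟨_, h1, rfl⟩))]
      exact hr' _
    · exact .inr h1

theorem wp_allocate_erase {d D : ℕ → ℕ → ℝ} {s : Store} {k G n p : ℕ} {A : Finset ℕ} {Δ r₀ ρ : ℝ}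
    (h0 : s.nreg 0 = 1) (h1 : s.nreg 1 = p) (hp : p ∈ A) (hS : Slots k G n A s)
    (hsc : Scale Δ r₀ A s)
    (hgood : ∀ g < G, Good (Near D (s.rreg 2 * ρ ^ g)) k G (s.nreg 4) n A (s.narr 1) s g) :
    wp d allocate (fun t s' => t ≤ 100 ∧ Slots k G n (A.erase p) s' ∧ Scale Δ r₀ (A.erase p) s' ∧
      s.nreg 4 ≤ s'.nreg 4 ∧
      Change (s.nreg 0) p (s'.nreg 8) A (A.erase p) (s.narr 1) (s'.narr 1) ∧
      (1 ≤ s'.nreg 8 ∧ s'.nreg 8 ≤ s'.nreg 4) ∧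
      ∀ g < G, Good (Near D (s'.rreg 2 * ρ ^ g)) k G (s.nreg 4) n A (s.narr 1) s' g) s := by
  simp only [allocate, wp_seq, wp_setN, wp_putN, wp_ite]
  refine ⟨fun hb => absurd hb (by simp [h0]), fun _ => ?_⟩
  generalize hs' : Store.setN _ 5 _ = s'
  have htr : ∀ g, tree k G s' g = tree k G s g := fun g => by
    simp only [← hs', tree_setN, tree_putN _ _ (show 2 < 6 by norm_num)]
  have e1 : s'.narr 1 = s.narr 1 := by funext y; simp [← hs']
  have e3 : s'.narr 3 = s.narr 3 := by funext y; simp [← hs']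
  have e4 : s'.narr 4 = s.narr 4 := by funext y; simp [← hs']
  have e5 : s'.narr 5 = s.narr 5 := by funext y; simp [← hs']
  have e2 : ∀ i, s'.narr 2 i = if i = s.nreg 5 then s.narr 1 p else s.narr 2 i := fun i => by
    simp [← hs', h1]
  have n4 : s'.nreg 4 = s.nreg 4 := by simp [← hs']
  have n5 : s'.nreg 5 = s.nreg 5 + 1 := by simp [← hs']
  have n7 : s'.nreg 7 = s.nreg 7 := by simp [← hs']
  have n8 : s'.nreg 8 = s.narr 1 p := by simp [← hs', h1]
  have r2 : s'.rreg 2 = s.rreg 2 := by simp [← hs']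
  have hcard := hS.card
  have hpos := Finset.card_pos.2 ⟨p, hp⟩
  have hlt : ∀ i < s'.nreg 5, i < s.nreg 5 ∨ i = s.nreg 5 := fun i hi => by omega
  refine ⟨by simp, ?_, ?_, n4.ge, .inr ⟨h0, hp, rfl, e1, n8.symm⟩, ?_, ?_⟩
  · refine ⟨n4 ▸ hS.le, ?_, ?_, ?_, ?_, ?_, ?_, ?_, e3 ▸ hS.parent_zero, e4 ▸ hS.base_zero⟩
    · rw [Finset.card_erase_of_mem hp]; omega
    · intro i hi j hj hij
      rw [e2, e2] at hij
      rcases hlt i hi with hi | rfl <;> rcases hlt j hj with hj | rfl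
      · rw [if_neg (by omega), if_neg (by omega)] at hij
        exact hS.free_inj i hi j hj hij
      · rw [if_neg (by omega), if_pos rfl] at hij
        exact absurd hij.symm (hS.free_ne i hi p hp)
      · rw [if_pos rfl, if_neg (by omega)] at hij
        exact absurd hij (hS.free_ne j hj p hp)
      · rfl
    · intro i hi
      rw [e2, n4]
      rcases hlt i hi with hi | rfl
      · rw [if_neg (by omega)]; exact hS.free_range i hi
      · rw [if_pos rfl]; exact hS.slot_range p hp
    · intro i hi e he
      rw [e1, e2]
      rcases hlt i hi with hi | rfl
      · rw [if_neg (by omega)]; exact hS.free_ne i hi e (Finset.mem_of_mem_erase he)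
      · rw [if_pos rfl]
        exact fun h => Finset.ne_of_mem_erase he
          (hS.slot_inj (Finset.mem_of_mem_erase he) hp h)
    · rw [e1]; exact hS.slot_inj.mono (Finset.coe_subset.2 (Finset.erase_subset _ _))
    · rw [e1, n4]; exact fun e he => hS.slot_range e (Finset.mem_of_mem_erase he)
    · rw [n4]; exact hS.layout.congr e3 e4
  · unfold Scale at hsc ⊢
    rw [r2, n7]
    exact hsc.imp_left fun h => ⟨h.1, fun e he => h.2 e (Finset.mem_of_mem_erase he)⟩
  · rw [n8, n4]; exact hS.slot_range p hp
  · intro g hg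
    rw [r2]
    exact (hgood g hg).congr (fun w _ => by rw [htr]) (by rw [e5])

/-- A new node is opened only if none is free, so the number of nodes then equals the number of
active names and remains at most `n`. Parents and addresses are obtained by addition alone: the
parent of `v` is that of `v - 2` plus one, and the address grows by the stride that the previous
update left in register `6`. -/
theorem wp_allocate_insert {d D : ℕ → ℕ → ℝ} {s : Store} {k G n p : ℕ} {A : Finset ℕ} {Δ r₀ ρ : ℝ}
    (h0 : s.nreg 0 = 0) (h1 : s.nreg 1 = p) (hp : p ∉ A) (hS : Slots k G n A s)
    (hoff : (s.nreg 4 = 0 ∧ s.nreg 6 = 0) ∨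
      (1 ≤ s.nreg 4 ∧ s.nreg 6 = G * (k + k + 3)))
    (hn : (insert p A).card ≤ n) (hΔ : 1 ≤ Δ) (hr₀ : 0 < r₀) (hr1 : s.rreg 1 = Δ) (hρ : 0 < ρ)
    (hD0 : ∀ e, D e e = 0)
    (hD : ∀ e ∈ insert p A, ∀ f ∈ insert p A, e ≠ f → r₀ ≤ D e f ∧ D e f ≤ Δ * r₀)
    (hd : ∀ e f, d e f = if e ∈ insert p A ∧ f ∈ insert p A then D e f else 0)
    (hsc : Scale Δ r₀ A s)
    (hgood : ∀ g < G, Good (Near D (s.rreg 2 * ρ ^ g)) k G (s.nreg 4) n A (s.narr 1) s g) :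
    wp d allocate (fun t s' => t ≤ 100 ∧ Slots k G n (insert p A) s' ∧ Scale Δ r₀ (insert p A) s' ∧
      s.nreg 4 ≤ s'.nreg 4 ∧
      Change (s.nreg 0) p (s'.nreg 8) A (insert p A) (s.narr 1) (s'.narr 1) ∧
      (1 ≤ s'.nreg 8 ∧ s'.nreg 8 ≤ s'.nreg 4) ∧
      ∀ g < G, Good (Near D (s'.rreg 2 * ρ ^ g)) k G (s.nreg 4) n A (s.narr 1) s' g) s := by
  have hcard := hS.card
  rw [Finset.card_insert_of_notMem hp] at hn
  simp only [allocate, wp_seq, wp_ite]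
  refine ⟨fun _ => ?_, fun hb => absurd (show s.nreg 0 = 0 from h0) (by simpa using hb)⟩
  -- the choice of the node
  suffices H : ∀ (t : ℕ) (s' : Store), t ≤ 60 → (∀ g, tree k G s' g = tree k G s g) →
      s'.narr 1 = s.narr 1 → s'.narr 5 = s.narr 5 → s'.rreg = s.rreg → s'.nreg 0 = s.nreg 0 →
      s'.nreg 1 = s.nreg 1 → s'.nreg 7 = s.nreg 7 → s.nreg 4 ≤ s'.nreg 4 → s'.nreg 4 ≤ n →
      s'.nreg 5 + (A.card + 1) = s'.nreg 4 →
      (∀ i < s'.nreg 5, i < s.nreg 5 ∧ s'.narr 2 i = s.narr 2 i ∧ s.narr 2 i ≠ s'.nreg 8) →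
      (∀ e ∈ A, s.narr 1 e ≠ s'.nreg 8) → 1 ≤ s'.nreg 8 → s'.nreg 8 ≤ s'.nreg 4 →
      Layout k G (s'.nreg 4) s' → s'.narr 3 0 = 0 → s'.narr 4 0 = 0 →
      wp d recordSlot (fun t' s' => t + t' ≤ 90 ∧ Slots k G n (insert p A) s' ∧
            Scale Δ r₀ (insert p A) s' ∧ s.nreg 4 ≤ s'.nreg 4 ∧
            Change (s.nreg 0) p (s'.nreg 8) A (insert p A) (s.narr 1) (s'.narr 1) ∧
            (1 ≤ s'.nreg 8 ∧ s'.nreg 8 ≤ s'.nreg 4) ∧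
            ∀ g < G, Good (Near D (s'.rreg 2 * ρ ^ g)) k G (s.nreg 4) n A (s.narr 1) s' g) s' by
    constructor
    · intro hF
      have hF : 1 ≤ s.nreg 5 := by simpa using hF
      simp only [wp_setN]
      generalize hs' : Store.setN _ 8 _ = s'
      have n4 : s'.nreg 4 = s.nreg 4 := by simp [← hs']
      have n5 : s'.nreg 5 = s.nreg 5 - 1 := by simp [← hs']
      have n8 : s'.nreg 8 = s.narr 2 (s.nreg 5 - 1) := by simp [← hs']
      have ea : s'.narr = s.narr := by simp [← hs']
      have hfr := hS.free_range (s.nreg 5 - 1) (by omega)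
      have := H 20 s' (by norm_num) (fun g => by simp only [← hs', tree_setN]) (by rw [ea])
        (by rw [ea]) (by simp [← hs']) (by simp [← hs']) (by simp [← hs']) (by simp [← hs'])
        (by omega) (by have := hS.le; omega) (by omega)
        (fun i hi => ⟨by omega, by rw [ea], fun h => by
          have := hS.free_inj i (by omega) (s.nreg 5 - 1) (by omega) (h.trans n8)
          omega⟩)
        (fun e he => by rw [n8]; exact hS.free_ne _ (by omega) e he) (n8 ▸ hfr.1)
        (by rw [n8, n4]; exact hfr.2) (by rw [n4]; exact hS.layout.congr (by rw [ea]) (by rw [ea]))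
        (by rw [ea]; exact hS.parent_zero) (by rw [ea]; exact hS.base_zero)
      refine this.mono fun t1 s1 _ h => ⟨?_, h.2⟩
      have := h.1
      simp only [NExp.time, BExp.time]
      omega
    · intro hF
      have hF : s.nreg 5 = 0 := by
        have : ¬ 1 ≤ s.nreg 5 := by simpa using hF
        omega
      simp only [wp_setN, wp_putN]
      generalize hs' : Store.putN _ 4 _ _ = s'
      have n4 : s'.nreg 4 = s.nreg 4 + 1 := by simp [← hs']
      have n5 : s'.nreg 5 = 0 := by simp [← hs', hF]
      have n8 : s'.nreg 8 = s.nreg 4 + 1 := by simp [← hs']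
      have e1 : s'.narr 1 = s.narr 1 := by funext y; simp [← hs']
      have e5 : s'.narr 5 = s.narr 5 := by funext y; simp [← hs']
      have e3 : ∀ y, s'.narr 3 y = if y = s.nreg 4 + 1 then
          s.narr 3 (s.nreg 4 + 1 - 2) + (1 - (2 - (s.nreg 4 + 1))) else s.narr 3 y := fun y => by
        simp [← hs']
      have e4 : ∀ y, s'.narr 4 y = if y = s.nreg 4 + 1 then
          s.narr 4 (s.nreg 4) + s.nreg 6 else s.narr 4 y := fun y => by
        simp [← hs']
      -- The correction `1 - (2 - v)` vanishes only for the root. The stride is still unknown when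
      -- the root is opened, but its base is zero anyway.
      have hL : Layout k G (s'.nreg 4) s' := by
        rw [n4]
        constructor
        · intro v hv hvN
          rw [e3]
          split_ifs with h
          · by_cases h2 : 2 ≤ s.nreg 4
            · rw [hS.layout.parent _ (by omega) (by omega)]
              omega
            · rw [show s.nreg 4 + 1 - 2 = 0 by omega, hS.parent_zero]
              omega
          · exact hS.layout.parent v hv (by omega)
        · intro v hv hvN
          rw [e4]
          split_ifs with h
          · rw [h]
            simp only [Nat.add_sub_cancel]
            rcases hoff with ⟨hN, h6⟩ | ⟨hN, h6⟩
            · rw [hN, hS.base_zero, h6]; simp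
            · rw [h6, hS.layout.base _ hN le_rfl]
              obtain ⟨N, hN'⟩ := Nat.exists_eq_succ_of_ne_zero (show s.nreg 4 ≠ 0 by omega)
              rw [hN']
              simp only [Nat.succ_eq_add_one, Nat.add_sub_cancel]
              ring
          · exact hS.layout.base v hv (by omega)
      have := H 50 s' (by norm_num) (fun g => by
          simp only [← hs', tree_setN, tree_putN _ _ (show 3 < 6 by norm_num),
            tree_putN _ _ (show 4 < 6 by norm_num)]) e1
        e5 (by simp [← hs']) (by simp [← hs']) (by simp [← hs']) (by simp [← hs'])
        (by omega) (by omega) (by omega)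
        (fun i hi => by omega)
        (fun e he => by have := (hS.slot_range e he).2; omega) (by omega)
        (by omega) hL (by rw [e3, if_neg (by omega)]; exact hS.parent_zero)
        (by rw [e4, if_neg (by omega)]; exact hS.base_zero)
      refine this.mono fun t1 s1 _ h => ⟨?_, h.2⟩
      have := h.1
      simp only [NExp.time, BExp.time]
      omega
  intro t s1 ht htr a1 a5 ar m0 m1 m7 hN4 hNn hcard' hfree hne h8 h8' hL h30 h40
  simp only [recordSlot, wp_seq, wp_putN, wp_ite, wp_setR, wp_setN, wp_skip]
  -- the bookkeeping, whatever the real registers and register `7` hold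
  have hslots : ∀ s2 : Store, s2.nreg 4 = s1.nreg 4 → s2.nreg 5 = s1.nreg 5 →
      s2.narr = (s1.putN 1 p (s1.nreg 8)).narr → Slots k G n (insert p A) s2 := by
    intro s2 n4 n5 na
    have e1 : ∀ e, s2.narr 1 e = if e = p then s1.nreg 8 else s.narr 1 e := fun e => by
      rw [na]; simp [a1]
    have e2 : s2.narr 2 = s1.narr 2 := by rw [na]; exact putN_narr_ne _ _ _ _ _ (by norm_num)
    have e3 : s2.narr 3 = s1.narr 3 := by rw [na]; exact putN_narr_ne _ _ _ _ _ (by norm_num)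
    have e4 : s2.narr 4 = s1.narr 4 := by rw [na]; exact putN_narr_ne _ _ _ _ _ (by norm_num)
    have hep : ∀ e ∈ A, e ≠ p := fun e he h => hp (h ▸ he)
    refine ⟨by omega, ?_, ?_, ?_, ?_, ?_, ?_, ?_, e3 ▸ h30, e4 ▸ h40⟩
    · rw [Finset.card_insert_of_notMem hp]; omega
    · intro i hi j hj hij
      rw [n5] at hi hj
      obtain ⟨h1, h2, -⟩ := hfree i hi
      obtain ⟨h3, h4, -⟩ := hfree j hj
      rw [e2, h2, h4] at hij
      exact hS.free_inj i h1 j h3 hij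
    · intro i hi
      obtain ⟨h1, h2, -⟩ := hfree i (n5 ▸ hi)
      rw [e2, h2, n4]
      have := hS.free_range i h1
      omega
    · intro i hi e he
      obtain ⟨h1, h2, h3⟩ := hfree i (n5 ▸ hi)
      rw [e1, e2, h2]
      rcases Finset.mem_insert.1 he with rfl | he
      · rw [if_pos rfl]; exact h3.symm
      · rw [if_neg (hep e he)]; exact hS.free_ne i h1 e he
    · intro e he f hf hef
      rw [e1, e1] at hef
      rw [Finset.mem_coe, Finset.mem_insert] at he hf
      rcases he with rfl | he <;> rcases hf with rfl | hf
      · rfl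
      · rw [if_pos rfl, if_neg (hep f hf)] at hef
        exact absurd hef.symm (hne f hf)
      · rw [if_pos rfl, if_neg (hep e he)] at hef
        exact absurd hef (hne e he)
      · rw [if_neg (hep e he), if_neg (hep f hf)] at hef
        exact hS.slot_inj he hf hef
    · intro e he
      rw [e1, n4]
      rcases Finset.mem_insert.1 he with rfl | he
      · rw [if_pos rfl]; exact ⟨h8, h8'⟩
      · rw [if_neg (hep e he)]
        have := hS.slot_range e he
        omega
    · rw [n4]; exact hL.congr e3 e4
  have hchange : ∀ s2 : Store, s2.nreg 8 = s1.nreg 8 →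
      s2.narr = (s1.putN 1 p (s1.nreg 8)).narr →
      Change (s.nreg 0) p (s2.nreg 8) A (insert p A) (s.narr 1) (s2.narr 1) := by
    intro s2 n8 na
    refine .inl ⟨h0, hp, rfl, ?_⟩
    funext e
    rw [na, n8]
    simp [a1, Function.update_apply]
  have hgood' : ∀ s2 : Store, s2.narr = (s1.putN 1 p (s1.nreg 8)).narr → ∀ (l : ℝ),
      (∀ g < G, Good (Near D (l * ρ ^ g)) k G (s.nreg 4) n A (s.narr 1) s g) →
      ∀ g < G, Good (Near D (l * ρ ^ g)) k G (s.nreg 4) n A (s.narr 1) s2 g := by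
    intro s2 na l hl g hg
    refine (hl g hg).congr (fun w _ => ?_) ?_
    · have : tree k G s2 g = tree k G (s1.putN 1 p (s1.nreg 8)) g := by
        funext w; simp only [tree, blk, na]
      rw [this, tree_putN _ _ (by norm_num), htr]
    · rw [na, putN_narr_ne _ _ _ _ _ (by norm_num), a5]
  have hs1 : s1.nreg 1 = p := m1.trans h1
  simp only [NExp.eval, hs1]
  refine ⟨fun hb => ?_, fun hb => ?_⟩
  · have hl : s.rreg 2 ≤ 0 := by simpa [ar] using hb
    have hl0 : s.rreg 2 = 0 := le_antisymm hl (hsc.nonneg hr₀ hΔ)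
    have hA : ∀ e ∈ A, e = s.nreg 7 := by
      rcases hsc with h | ⟨d₀, h2, -, h4⟩
      · exact h.2
      · exfalso
        have : 0 < d₀ / (2 * Δ) := by
          have : 0 < d₀ := hr₀.trans_le h2
          positivity
        linarith
    generalize hs2 : Store.setN _ 7 _ = s2
    have na : s2.narr = (s1.putN 1 p (s1.nreg 8)).narr := by simp [← hs2]
    have n4 : s2.nreg 4 = s1.nreg 4 := by simp [← hs2]
    have n5 : s2.nreg 5 = s1.nreg 5 := by simp [← hs2]
    have n7 : s2.nreg 7 = p := by simp [← hs2, hs1]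
    have n8 : s2.nreg 8 = s1.nreg 8 := by simp [← hs2]
    have r2 : s2.rreg 2 = d p (s.nreg 7) / (2 * Δ) := by simp [← hs2, hs1, m7, ar, hr1]
    have hscale : Scale Δ r₀ (insert p A) s2 := by
      -- If register `7` does not name an active point other than `p`, the oracle returns zero, the
      -- scale remains zero, and `p` is the only active name.
      by_cases h7 : s.nreg 7 ∈ A
      · have hne7 : p ≠ s.nreg 7 := fun h => hp (h ▸ h7)
        right
        refine ⟨D p (s.nreg 7), ?_, ?_, ?_⟩
        · exact (hD _ (Finset.mem_insert_self _ _) _ (Finset.mem_insert_of_mem h7) hne7).1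
        · exact (hD _ (Finset.mem_insert_self _ _) _ (Finset.mem_insert_of_mem h7) hne7).2
        · rw [r2, hd, if_pos ⟨Finset.mem_insert_self _ _, Finset.mem_insert_of_mem h7⟩]
      · left
        refine ⟨?_, fun e he => ?_⟩
        · rw [r2, hd]
          split_ifs with h
          · rw [(Finset.mem_insert.1 h.2).resolve_right h7, hD0]
            simp
          · simp
        · rw [n7]
          rcases Finset.mem_insert.1 he with h | h
          · exact h
          · exact absurd (hA e h ▸ h) h7
    refine ⟨?_, hslots s2 n4 n5 na, hscale, n4 ▸ hN4, hchange s2 n8 na, by rw [n8, n4]; exact ⟨h8, h8'⟩,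
      ?_⟩
    · simp only [NExp.time, RExp.time, BExp.time]; omega
    · refine hgood' s2 na _ fun g hg => ?_
      refine (hgood g hg).congr_near (fun e => ?_) (fun e => ?_)
        (fun e he f hf => (hA e he).trans (hA f hf).symm)
      · unfold Near; rw [hD0, hl0]; simp
      · unfold Near; rw [hD0]
        have := hscale.nonneg hr₀ hΔ
        positivity
  · generalize hs2 : Store.putN _ 1 _ _ = s2 at hb ⊢
    have na : s2.narr = (s1.putN 1 p (s1.nreg 8)).narr := by simp [← hs2]
    have nn : s2.nreg = s1.nreg := by simp [← hs2]
    have r2 : s2.rreg 2 = s.rreg 2 := by simp [← hs2, ar]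
    refine ⟨?_, hslots s2 (by rw [nn]) (by rw [nn]) na, ?_, nn ▸ hN4, hchange s2 (by rw [nn]) na,
      by rw [nn]; exact ⟨h8, h8'⟩, ?_⟩
    · simp only [NExp.time, RExp.time, BExp.time]; omega
    · right
      rcases hsc with h | ⟨d₀, h2, h3, h4⟩
      · exact absurd (show s2.rreg 2 ≤ ((0 : ℕ) : ℝ) by rw [r2, h.1]; simp) hb
      · exact ⟨d₀, h2, h3, r2.trans h4⟩
    · rw [r2]
      exact hgood' s2 na _ hgood

end DynKCenter

/-! ### The loop over the guesses and the output. -/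

namespace DynKCenter
open RAM

/-- Updates the trees of all guesses. -/
def guessLoop : Cmd :=
  .while (.rle (.reg 3) (.mul (.mul (.mul (.lit 2) (.reg 1)) (.reg 1))
      (.add (.lit 1) (.div (.reg 0) (.lit 2))))) guessBody

/-- The number of centers in the trees of all guesses. -/
def centerTotal (k G n : ℕ) (s : Store) : ℕ :=
  ∑ g ∈ Finset.range G, centerCount n (tree k G s g)

/-- The number of comparisons that may still be made in the trees of all guesses. -/
def pendingTotal (k G n : ℕ) (s : Store) : ℕ :=
  ∑ g ∈ Finset.range G, pendingCount n (tree k G s g)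

theorem sum_add_eq_of_ne {G g : ℕ} {f f' : ℕ → ℕ} (hg : g < G)
    (h : ∀ g' < G, g' ≠ g → f' g' = f g') :
    ∑ i ∈ Finset.range G, f' i + f g = ∑ i ∈ Finset.range G, f i + f' g := by
  have hg' := Finset.mem_range.2 hg
  rw [← Finset.add_sum_erase _ f hg', ← Finset.add_sum_erase _ f' hg',
    Finset.sum_congr rfl (g := fun i => f i)]
  · omega
  · intro i hi
    exact h i (Finset.mem_range.1 (Finset.mem_of_mem_erase hi)) (Finset.ne_of_mem_erase hi)

/-- The trees of all guesses have been updated in time `t`. -/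
def AllUpdated (D : ℕ → ℕ → ℝ) (k G n : ℕ) (A : Finset ℕ) (ρ : ℝ) (r : ℕ) (s : Store)
    (t : ℕ) (s' : Store) : Prop :=
  ∃ c, t ≤ G * (r * (700 * (k + k + 3)) + 120) + 40 * c + 20 ∧
    (∀ g < G, Good (Near D (s.rreg 2 * ρ ^ g)) k G (s.nreg 4) n A (s.narr 1) s' g) ∧
    c ≤ G * (r * ((k + 1) * workFactor k (s.nreg 0))) ∧
    c + pendingTotal k G n s' + 2 * ((k + k + 3) * centerTotal k G n s) ≤
      pendingTotal k G n s + 2 * ((k + k + 3) * centerTotal k G n s') +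
        G * (2 * ((k + k + 3) * (r + 1))) ∧
    s'.nreg 6 = G * (k + k + 3)

/-- `G` is never computed: the test on the real register `3`, which holds `ρ ^ g`, ends the loop. In
between, guesses below `g` satisfy the invariants for the new active set and the others still those
for the old one. -/
theorem wp_guessLoop {d D : ℕ → ℕ → ℝ} {s : Store} {k G N n p r : ℕ}
    {A A' : Finset ℕ} {slot : ℕ → ℕ} {ρ : ℝ}
    (hD0 : ∀ e, D e e = 0) (hDs : ∀ e f, D e f = D f e)
    (hD : ∀ e ∈ A', ∀ f ∈ A', d e f = D e f) (hlam : 0 ≤ s.rreg 2) (hρ : 0 ≤ ρ)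
    (hε : 1 + s.rreg 0 / 2 = ρ)
    (hG : ∀ g, ρ ^ g ≤ 2 * s.rreg 1 * s.rreg 1 * ρ ↔ g < G)
    (hk : s.nreg 2 = k) (hoff : s.nreg 6 = 0) (h3 : s.rreg 3 = 1) (hp : s.nreg 1 = p)
    (hu : Change (s.nreg 0) p (s.nreg 8) A A' slot (s.narr 1))
    (hL : Layout k G (s.nreg 4) s) (hxN : s.nreg 8 ≤ s.nreg 4) (hNN : N ≤ s.nreg 4)
    (hNn : s.nreg 4 ≤ n) (hxr : s.nreg 8 < 2 ^ r)
    (hslot : Set.InjOn slot A) (hslot' : Set.InjOn (s.narr 1) A')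
    (hT : ∀ g < G, Good (Near D (s.rreg 2 * ρ ^ g)) k G N n A slot s g) :
    wp d guessLoop (AllUpdated D k G n A' ρ r s) s := by
  refine wp_while (fun t s' => ∃ g c, g ≤ G ∧ s'.nreg 6 = g * (k + k + 3) ∧ s'.rreg 3 = ρ ^ g ∧
    t ≤ g * (r * (700 * (k + k + 3)) + 120) + 40 * c ∧
    (∀ g' < g, Good (Near D (s.rreg 2 * ρ ^ g')) k G (s.nreg 4) n A' (s.narr 1) s' g') ∧
    (∀ g' < G, g ≤ g' → Good (Near D (s.rreg 2 * ρ ^ g')) k G N n A slot s' g') ∧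
    c ≤ g * (r * ((k + 1) * workFactor k (s.nreg 0))) ∧
    c + pendingTotal k G n s' + 2 * ((k + k + 3) * centerTotal k G n s) ≤
      pendingTotal k G n s + 2 * ((k + k + 3) * centerTotal k G n s') +
        g * (2 * ((k + k + 3) * (r + 1)))) (fun s' => G * (k + k + 3) - s'.nreg 6) ?_ ?_ ?_
  · exact ⟨0, 0, by omega, by simpa using hoff, by simpa using h3, by omega, by simp,
      fun g' hg' _ => hT g' hg', by omega, by omega⟩
  · rintro t s1 f ⟨g, c, hgG, h6, h3', ht, hnew, hold, hc, hpot⟩ hb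
    have n0 := f.nreg 0 (by decide)
    have n1 := f.nreg 1 (by decide)
    have n2 := f.nreg 2 (by decide)
    have n8 := f.nreg 8 (by decide)
    have r0 := f.rreg 0 (by decide)
    have r1 := f.rreg 1 (by decide)
    have r2 := f.rreg 2 (by decide)
    have a3 := f.narr 3 (by decide)
    have a4 := f.narr 4 (by decide)
    have hg : g < G := by
      rw [← hG g]
      simpa [h3', r0, r1, hε] using hb
    have hthr : s1.rreg 2 * s1.rreg 3 = s.rreg 2 * ρ ^ g := by rw [r2, h3']
    refine (wp_guessBody (k := k) (G := G) (g := g) (n := n) (p := p) (x := s.nreg 8) (r := r)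
      (A := A) (A' := A') (slot := slot) (slot' := s.narr 1) (N := N) (N' := s.nreg 4)
      hD0 hDs hD (by rw [hthr]; positivity) (n2.trans hk) hg h6 (n1.trans hp) n8 (n0 ▸ hu)
      (hL.congr a3 a4) hxN hNN hNn hxr hslot hslot' (hthr ▸ hold g hg le_rfl)).mono ?_
    rintro t2 s2 f2 ⟨c2, ht2, hgood2, hoth, h52, hc2, hpot2, h62, h32⟩
    rw [hthr] at hgood2
    rw [n0] at hc2
    have hsame : ∀ g' < G, g' ≠ g → ∀ {near N A slot}, Good near k G N n A slot s1 g' →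
        Good near k G N n A slot s2 g' := fun g' hg' hne _ _ _ _ h =>
      h.congr (hoth g' hg' hne) (h52 _ fun h' => hne (Nat.eq_of_mul_eq_mul_right (by omega) h'))
    have hsum : ∀ φ : Blk → ℕ, ∀ g' < G, g' ≠ g →
        ∑ w ∈ Finset.Icc 1 n, φ (tree k G s2 g' w) = ∑ w ∈ Finset.Icc 1 n, φ (tree k G s1 g' w) :=
      fun φ g' hg' hne => sum_congr_tree φ (hoth g' hg' hne)
    have hP : pendingTotal k G n s2 + pendingCount n (tree k G s1 g) =
        pendingTotal k G n s1 + pendingCount n (tree k G s2 g) :=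
      sum_add_eq_of_ne hg (hsum Blk.pending)
    have hC : centerTotal k G n s2 + centerCount n (tree k G s1 g) =
        centerTotal k G n s1 + centerCount n (tree k G s2 g) :=
      sum_add_eq_of_ne hg (hsum Blk.nC)
    refine ⟨⟨g + 1, c + c2, hg, h62, ?_, ?_, ?_, ?_, ?_, ?_⟩, ?_⟩
    · rw [h32, h3', r0, hε, pow_succ]
    · simp only [BExp.time, RExp.time]
      rw [Nat.add_mul g 1]
      omega
    · intro g' hg'
      rcases Nat.lt_succ_iff_lt_or_eq.1 hg' with h | rfl
      · exact hsame g' (by omega) (by omega) (hnew g' h)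
      · exact hgood2
    · exact fun g' hg' hle => hsame g' hg' (by omega) (hold g' hg' (by omega))
    · rw [Nat.add_mul g 1]; omega
    · rw [Nat.add_mul g 1]
      have hC' := congrArg (fun x => (k + k + 3) * x) hC
      simp only [Nat.mul_add] at hC'
      simp only [Nat.mul_add] at *
      omega
    · rw [h62, h6]
      have := Nat.mul_le_mul_right (k + k + 3) hg
      rw [Nat.succ_eq_add_one, Nat.add_mul] at this
      rw [Nat.add_mul]
      omega
  · rintro t s1 f ⟨g, c, hgG, h6, h3', ht, hnew, hold, hc, hpot⟩ hb
    have r0 := f.rreg 0 (by decide)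
    have r1 := f.rreg 1 (by decide)
    have hg : g = G := by
      refine le_antisymm hgG (not_lt.1 fun h => hb ?_)
      rw [← hG g] at h
      simpa [h3', r0, r1, hε] using h
    subst hg
    refine ⟨c, ?_, hnew, hc, hpot, h6⟩
    simp only [BExp.time, RExp.time]
    omega

/-- Moves to the first guess without an overflow, and copies the centers at the root of its tree to
the output. -/
def report : Cmd :=
  .setN 18 (.lit 0) ;;
  .while (.nle (.lit 1) (.get 5 (.reg 18)))
    (.setN 18 (.add (.reg 18) (.add (.add (.reg 2) (.reg 2)) (.lit 3)))) ;;
  .setN 3 (.get 6 (.add (.reg 18) (.lit 1))) ;;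
  .setN 11 (.lit 0) ;;
  .while (.nle (.add (.reg 11) (.lit 1)) (.reg 3))
    (.putN 0 (.reg 11) (.get 7 (.add (.add (.reg 18) (.lit 1)) (.reg 11))) ;;
      .setN 11 (.add (.reg 11) (.lit 1)))

/-- Minimality of the reported guess is kept, since the overflow of the guess before it yields the
lower bound on the optimum. -/
theorem wp_report {d : ℕ → ℕ → ℝ} {s : Store} {k G : ℕ} (hk : s.nreg 2 = k)
    (hnC : ∀ g < G, (tree k G s g 1).nC ≤ k + 1)
    (hG : ∃ g < G, s.narr 5 (g * (k + k + 3)) = 0) :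
    wp d report (fun t s' => ∃ g < G, s.narr 5 (g * (k + k + 3)) = 0 ∧
      (∀ g' < g, s.narr 5 (g' * (k + k + 3)) ≠ 0) ∧
      t ≤ 20 * G + 20 * (tree k G s g 1).nC + 40 ∧ s'.nreg 3 = (tree k G s g 1).nC ∧
      ∀ j < (tree k G s g 1).nC, s'.narr 0 j = (tree k G s g 1).C j) s := by
  classical
  obtain ⟨hlt, hz⟩ := Nat.find_spec hG
  have hmin : ∀ g' < Nat.find hG, s.narr 5 (g' * (k + k + 3)) ≠ 0 := fun g' hg' h =>
    Nat.find_min hG hg' ⟨hg'.trans hlt, h⟩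
  generalize Nat.find hG = g at *
  have haddr : addr k G g 1 = g * (k + k + 3) + 1 := by simp [addr]
  simp only [report, wp_seq, wp_setN]
  refine wp_while (fun t s' => ∃ i ≤ g, s'.nreg 18 = i * (k + k + 3) ∧ t ≤ 15 * i)
    (fun s' => g * (k + k + 3) - s'.nreg 18) ⟨0, by simp⟩ ?_ ?_
  · rintro t s1 f ⟨i, hi, h18, ht⟩ hb
    have n2 := f.nreg 2 (by decide)
    have a5 := f.narr 5 (by decide)
    simp at n2 a5
    simp only [BExp.Holds, NExp.eval, a5, h18] at hb
    have hig : i < g := lt_of_le_of_ne hi fun h => by rw [h, hz] at hb; omega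
    simp only [wp_setN, NExp.eval, NExp.time, BExp.time, setN_nreg, h18, n2, hk, if_true]
    have := Nat.mul_le_mul_right (k + k + 3) hig
    rw [Nat.succ_mul] at this
    exact ⟨⟨i + 1, hig, by ring, by omega⟩, by omega⟩
  · rintro t s1 f ⟨i, hi, h18, ht⟩ hb
    have a5 := f.narr 5 (by decide)
    have a6 := f.narr 6 (by decide)
    have a7 := f.narr 7 (by decide)
    simp at a5 a6 a7
    simp only [BExp.Holds, NExp.eval, a5, h18] at hb
    have hig : i = g := le_antisymm hi (not_lt.1 fun h => hmin i h (by omega))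
    subst hig
    have hC : s.narr 6 (i * (k + k + 3) + 1) = (tree k G s i 1).nC := by
      simp [tree, blk, haddr]
    refine wp_while (fun t s' => ∃ j, s'.nreg 11 = j ∧ j ≤ (tree k G s i 1).nC ∧ t ≤ 20 * j ∧
      ∀ j' < j, s'.narr 0 j' = (tree k G s i 1).C j')
      (fun s' => (tree k G s i 1).nC - s'.nreg 11) ⟨0, by simp⟩ ?_ ?_
    · rintro t' s2 f2 ⟨j, h11, hj, ht', hout⟩ hb'
      have n3 := f2.nreg 3 (by decide)
      have n18 := f2.nreg 18 (by decide)
      have b7 := f2.narr 7 (by decide)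
      simp [h18, a6, hC] at n3 n18 b7
      simp only [BExp.Holds, NExp.eval, h11, n3] at hb'
      simp only [wp_seq, wp_setN, wp_putN]
      refine ⟨⟨j + 1, by simp [h11], hb', ?_, ?_⟩, ?_⟩
      · simp; omega
      · intro j' hj'
        rcases Nat.lt_succ_iff_lt_or_eq.1 hj' with h | rfl
        · simp [h11, h.ne, hout j' h]
        · have := hnC i hlt
          simp [h11, n18, b7, a7, tree, blk, haddr, show j' < k + k + 3 by omega]
      · simp [h11]; omega
    · rintro t' s2 f2 ⟨j, h11, hj, ht', hout⟩ hb'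
      have n3 := f2.nreg 3 (by decide)
      simp [h18, a6, hC] at n3
      simp only [BExp.Holds, NExp.eval, h11, n3] at hb'
      have : j = (tree k G s i 1).nC := by omega
      subst this
      refine ⟨i, hlt, hz, hmin, ?_, n3, hout⟩
      simp
      omega

end DynKCenter

namespace DynKCenter
open RAM

/-! ## The program -/

/-- The program that processes one update. -/
def program : Cmd :=
  allocate ;; .setN 6 (.lit 0) ;; .setR 3 (.lit 1) ;; guessLoop ;; report

theorem tree_congr {k G : ℕ} {s s' : Store} (h : ∀ a, 6 ≤ a → a ≤ 10 → s'.narr a = s.narr a)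
    (g : ℕ) : tree k G s' g = tree k G s g := by
  funext w
  simp [tree, blk, h 6 (by omega) (by omega), h 7 (by omega) (by omega),
    h 8 (by omega) (by omega), h 9 (by omega) (by omega), h 10 (by omega) (by omega)]

theorem Slots.congr {k G n : ℕ} {A : Finset ℕ} {s s' : Store} (h : Slots k G n A s)
    (n4 : s'.nreg 4 = s.nreg 4) (n5 : s'.nreg 5 = s.nreg 5) (a1 : s'.narr 1 = s.narr 1)
    (a2 : s'.narr 2 = s.narr 2) (a3 : s'.narr 3 = s.narr 3) (a4 : s'.narr 4 = s.narr 4) :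
    Slots k G n A s' where
  le := n4 ▸ h.le
  card := by rw [n4, n5]; exact h.card
  free_inj := by rw [n5, a2]; exact h.free_inj
  free_range := by rw [n5, a2, n4]; exact h.free_range
  free_ne := by rw [n5, a1, a2]; exact h.free_ne
  slot_inj := a1 ▸ h.slot_inj
  slot_range := by rw [a1, n4]; exact h.slot_range
  layout := n4 ▸ h.layout.congr a3 a4
  parent_zero := a3 ▸ h.parent_zero
  base_zero := a4 ▸ h.base_zero

theorem Scale.congr {Δ r₀ : ℝ} {A : Finset ℕ} {s s' : Store} (h : Scale Δ r₀ A s)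
    (n7 : s'.nreg 7 = s.nreg 7) (r2 : s'.rreg 2 = s.rreg 2) : Scale Δ r₀ A s' := by
  unfold Scale at *
  rwa [n7, r2]

/-! ### The invariant between two updates. -/

/-- The distances of the names in `A` are in the interval `[r₀, Δ * r₀]`. -/
def Spread (D : ℕ → ℕ → ℝ) (Δ r₀ : ℝ) (A : Finset ℕ) : Prop :=
  ∀ e ∈ A, ∀ f ∈ A, e ≠ f → r₀ ≤ D e f ∧ D e f ≤ Δ * r₀

/-- There are `G` guesses, whose ratio is `ρ`. -/
def Guesses (Δ ρ : ℝ) (G : ℕ) : Prop := ∀ g : ℕ, ρ ^ g ≤ 2 * Δ * Δ * ρ ↔ g < G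

/-- The invariants of the memory between two updates. -/
structure Inv (D : ℕ → ℕ → ℝ) (k G n : ℕ) (ε Δ r₀ : ℝ) (A : Finset ℕ) (s : Store) : Prop where
  reg_k : s.nreg 2 = k
  reg_eps : s.rreg 0 = ε
  reg_delta : s.rreg 1 = Δ
  slots : Slots k G n A s
  scale : Scale Δ r₀ A s
  stride : (s.nreg 4 = 0 ∧ s.nreg 6 = 0) ∨ (1 ≤ s.nreg 4 ∧ s.nreg 6 = G * (k + k + 3))
  good : ∀ g < G, Good (Near D (s.rreg 2 * (1 + ε / 2) ^ g)) k G (s.nreg 4) n A (s.narr 1) s g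

/-- The output consists of the centers at the root of the first tree without an overflow. -/
def Reported (k G : ℕ) (s : Store) : Prop :=
  ∃ g < G, s.narr 5 (g * (k + k + 3)) = 0 ∧ (∀ g' < g, s.narr 5 (g' * (k + k + 3)) ≠ 0) ∧
    s.nreg 3 = (tree k G s g 1).nC ∧
    ∀ j < (tree k G s g 1).nC, s.narr 0 j = (tree k G s g 1).C j

/-- If all active names are near each other, no block has two centers, and `1 ≤ k`. -/
theorem Good.overflow_eq_zero {near : ℕ → ℕ → Prop} {k G N n : ℕ} {A : Finset ℕ} {slot : ℕ → ℕ}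
    {s : Store} {g : ℕ} (h : Good near k G N n A slot s g) (hk : 1 ≤ k)
    (hA : ∀ e ∈ A, ∀ f ∈ A, near e f) : s.narr 5 (g * (k + k + 3)) = 0 := by
  rw [h.overflow]
  refine Finset.sum_eq_zero fun w hw => ?_
  have hw1 := (Finset.mem_Icc.1 hw).1
  by_contra hne
  refine (h.tree.weak w hw1).farC 1 (by omega) 0 (by omega) (hA _ ?_ _ ?_)
  · exact (h.tree.memC_under hw1 ⟨0, by omega, rfl⟩).1
  · exact (h.tree.memC_under hw1 ⟨1, by omega, rfl⟩).1

/-- The last guess serves: `λ ≥ r₀ / (2Δ)` and `ρ ^ (G - 1) > 2Δ²` give a threshold of at least `Δ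
r₀`, which no distance exceeds. If the scale is still zero, at most one name is active. -/
theorem exists_no_overflow {D : ℕ → ℕ → ℝ} {k G N n : ℕ} {Δ r₀ ρ : ℝ} {A : Finset ℕ}
    {slot : ℕ → ℕ} {s : Store} (hk : 1 ≤ k) (hΔ : 1 ≤ Δ) (hr₀ : 0 < r₀) (hρ : 1 ≤ ρ)
    (hG : Guesses Δ ρ G) (hD0 : ∀ e, D e e = 0) (hD : Spread D Δ r₀ A) (hsc : Scale Δ r₀ A s)
    (h : ∀ g < G, Good (Near D (s.rreg 2 * ρ ^ g)) k G N n A slot s g) :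
    ∃ g < G, s.narr 5 (g * (k + k + 3)) = 0 := by
  have hG1 : 0 < G := (hG 0).1 (by rw [pow_zero]; nlinarith [mul_le_mul hΔ hΔ (by norm_num) (by linarith)])
  have hbig : 2 * Δ * Δ < ρ ^ (G - 1) := by
    have h1 : ¬ ρ ^ G ≤ 2 * Δ * Δ * ρ := fun h => lt_irrefl _ ((hG G).1 h)
    have h2 : ρ ^ G = ρ ^ (G - 1) * ρ := by rw [← pow_succ]; congr 1; omega
    rw [h2, not_le] at h1
    exact lt_of_mul_lt_mul_right h1 (by linarith)
  refine ⟨G - 1, by omega, (h _ (by omega)).overflow_eq_zero hk fun e he f hf => ?_⟩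
  unfold Near
  by_cases hef : e = f
  · rw [hef, hD0]
    have := hsc.nonneg hr₀ hΔ
    positivity
  rcases hsc with h' | ⟨d₀, h1, -, h3⟩
  · exact absurd ((h'.2 e he).trans (h'.2 f hf).symm) hef
  · refine (hD e he f hf hef).2.trans ?_
    have hΔ0 : 0 < Δ := by linarith
    have h4 : r₀ / (2 * Δ) ≤ s.rreg 2 := by rw [h3]; gcongr
    calc Δ * r₀ = r₀ / (2 * Δ) * (2 * Δ * Δ) := by field_simp
      _ ≤ s.rreg 2 * ρ ^ (G - 1) := by
        have h5 : 0 ≤ r₀ / (2 * Δ) := by positivity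
        exact mul_le_mul h4 hbig.le (by positivity) (h5.trans h4)

/-- An update has been processed in time `t`. -/
def Updated (D : ℕ → ℕ → ℝ) (k G n : ℕ) (ε Δ r₀ : ℝ) (A : Finset ℕ) (r : ℕ) (s : Store) (t : ℕ)
    (s' : Store) : Prop :=
  Inv D k G n ε Δ r₀ A s' ∧ Reported k G s' ∧
    ∃ c, t ≤ G * (r * (700 * (k + k + 3)) + 140) + 40 * c + 20 * k + 200 ∧
      c ≤ G * (r * ((k + 1) * workFactor k (s.nreg 0))) ∧
      c + pendingTotal k G n s' + 2 * ((k + k + 3) * centerTotal k G n s) ≤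
        pendingTotal k G n s + 2 * ((k + k + 3) * centerTotal k G n s') +
          G * (2 * ((k + k + 3) * (r + 1)))

theorem wp_program {d D : ℕ → ℕ → ℝ} {s : Store} {k G n p r : ℕ} {ε Δ r₀ : ℝ}
    {A A' : Finset ℕ} (hk : 1 ≤ k) (hε : 0 < ε) (hΔ : 1 ≤ Δ) (hr₀ : 0 < r₀)
    (hG : Guesses Δ (1 + ε / 2) G) (hr : n < 2 ^ r)
    (hD0 : ∀ e, D e e = 0) (hDs : ∀ e f, D e f = D f e) (hD : Spread D Δ r₀ A')
    (hd : ∀ e f, d e f = if e ∈ insert p A ∧ f ∈ insert p A then D e f else 0)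
    (h1 : s.nreg 1 = p) (hn : A'.card ≤ n)
    (hu : (s.nreg 0 = 0 ∧ p ∉ A ∧ A' = insert p A) ∨ (s.nreg 0 = 1 ∧ p ∈ A ∧ A' = A.erase p))
    (h : Inv D k G n ε Δ r₀ A s) :
    wp d program (Updated D k G n ε Δ r₀ A' r s) s := by
  have hA' : A' ⊆ insert p A := by
    rcases hu with ⟨-, -, rfl⟩ | ⟨-, -, rfl⟩
    · exact subset_rfl
    · exact (Finset.erase_subset _ _).trans (Finset.subset_insert _ _)
  have halloc : wp d allocate (fun t s' => t ≤ 100 ∧ Slots k G n A' s' ∧ Scale Δ r₀ A' s' ∧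
      s.nreg 4 ≤ s'.nreg 4 ∧
      Change (s.nreg 0) p (s'.nreg 8) A A' (s.narr 1) (s'.narr 1) ∧
      (1 ≤ s'.nreg 8 ∧ s'.nreg 8 ≤ s'.nreg 4) ∧
      ∀ g < G, Good (Near D (s'.rreg 2 * (1 + ε / 2) ^ g)) k G (s.nreg 4) n A (s.narr 1) s' g)
      s := by
    rcases hu with ⟨h0, hp, rfl⟩ | ⟨h0, hp, rfl⟩
    · exact wp_allocate_insert h0 h1 hp h.slots h.stride hn hΔ hr₀ h.reg_delta (by positivity)
        hD0 hD hd h.scale h.good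
    · exact wp_allocate_erase h0 h1 hp h.slots h.scale h.good
  simp only [program, wp_seq, wp_setN, wp_setR]
  refine halloc.mono ?_
  rintro t1 s1 f1 ⟨ht1, hS1, hsc1, h4, hch, ⟨h8, h8'⟩, hgood1⟩
  have n0 := f1.nreg 0 (by decide)
  have n1 := f1.nreg 1 (by decide)
  have n2 := f1.nreg 2 (by decide)
  have r0 := f1.rreg 0 (by decide)
  have r1 := f1.rreg 1 (by decide)
  have htr1 : ∀ g, tree k G s1 g = tree k G s g := tree_congr fun a ha ha' =>
    f1.narr a (by have : a ∉ [1, 2, 3, 4] := by { simp; omega }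
                  exact fun hm => this (by revert hm; simp [allocate, recordSlot, Cmd.narrs]; omega))
  generalize hs2 : Store.setR _ 3 _ = s2
  have m : ∀ x, x ≠ 6 → s2.nreg x = s1.nreg x := fun x hx => by simp [← hs2, hx]
  have mr : ∀ x, x ≠ 3 → s2.rreg x = s1.rreg x := fun x hx => by simp [← hs2, hx]
  have ma : s2.narr = s1.narr := by simp [← hs2]
  have htr2 : ∀ g, tree k G s2 g = tree k G s1 g := tree_congr fun a _ _ => by rw [ma]
  have hS2 : Slots k G n A' s2 := hS1.congr (m 4 (by decide)) (m 5 (by decide)) (by rw [ma])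
    (by rw [ma]) (by rw [ma]) (by rw [ma])
  have hx : s2.nreg 8 ≤ s2.nreg 4 := by rw [m 8 (by decide), m 4 (by decide)]; exact h8'
  refine (wp_guessLoop (d := d) (D := D) (k := k) (G := G) (N := s.nreg 4) (n := n) (p := p)
    (r := r) (A := A) (A' := A') (slot := s.narr 1) (ρ := 1 + ε / 2) hD0 hDs ?_ ?_ (by positivity)
    ?_ ?_ ?_ (by simp [← hs2]) (by simp [← hs2]) ?_ ?_ hS2.layout hx ?_ hS2.le
    ((hx.trans hS2.le).trans_lt hr) h.slots.slot_inj hS2.slot_inj ?_).mono ?_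
  · exact fun e he f hf => by rw [hd, if_pos ⟨hA' he, hA' hf⟩]
  · rw [mr 2 (by decide)]; exact hsc1.nonneg hr₀ hΔ
  · rw [mr 0 (by decide), r0, h.reg_eps]
  · rw [mr 1 (by decide), r1, h.reg_delta]; exact hG
  · rw [m 2 (by decide), n2, h.reg_k]
  · rw [m 1 (by decide), n1, h1]
  · rw [m 0 (by decide), m 8 (by decide), n0, ma]; exact hch
  · rw [m 4 (by decide)]; exact h4
  · rw [mr 2 (by decide)]
    exact fun g hg => (hgood1 g hg).congr (fun w _ => by rw [htr2]) (by rw [ma])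
  rintro t3 s3 f3 ⟨c, ht3, hgood3, hc, hpot, h63⟩
  have p2 := f3.nreg 2 (by decide)
  have p4 := f3.nreg 4 (by decide)
  have p5 := f3.nreg 5 (by decide)
  have p7 := f3.nreg 7 (by decide)
  have q0 := f3.rreg 0 (by decide)
  have q1 := f3.rreg 1 (by decide)
  have q2 := f3.rreg 2 (by decide)
  have b1 := f3.narr 1 (by decide)
  have b2 := f3.narr 2 (by decide)
  have b3 := f3.narr 3 (by decide)
  have b4 := f3.narr 4 (by decide)
  have hsc3 : Scale Δ r₀ A' s3 := hsc1.congr (p7.trans (m 7 (by decide)))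
    (q2.trans (mr 2 (by decide)))
  refine (wp_report (k := k) (G := G) (by rw [p2, m 2 (by decide), n2, h.reg_k])
    (fun g hg => ((hgood3 g hg).tree.weak 1 le_rfl).nC_le)
    (exists_no_overflow hk hΔ hr₀ (by linarith) hG hD0 hD hsc3 (by rw [q2]; exact hgood3))).mono ?_
  rintro t4 s4 f4 ⟨g, hg, hz, hmin, ht4, h34, hout⟩
  have htr4 : ∀ g, tree k G s4 g = tree k G s3 g := tree_congr fun a ha _ =>
    f4.narr a (by simp [report, Cmd.narrs]; omega)
  have c5 := f4.narr 5 (by decide)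
  have w4 := f4.nreg 4 (by decide)
  have w2 := f4.rreg 2 (by decide)
  have v1 := f4.narr 1 (by decide)
  have hnC := ((hgood3 g hg).tree.weak 1 le_rfl).nC_le
  refine ⟨⟨?_, ?_, ?_, ?_, ?_, ?_, ?_⟩, ⟨g, hg, ?_, ?_, ?_, ?_⟩, c, ?_, ?_, ?_⟩
  · rw [f4.nreg 2 (by decide), p2, m 2 (by decide), n2, h.reg_k]
  · rw [f4.rreg 0 (by decide), q0, mr 0 (by decide), r0, h.reg_eps]
  · rw [f4.rreg 1 (by decide), q1, mr 1 (by decide), r1, h.reg_delta]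
  · exact (hS2.congr p4 p5 b1 b2 b3 b4).congr w4 (f4.nreg 5 (by decide)) v1
      (f4.narr 2 (by decide)) (f4.narr 3 (by decide)) (f4.narr 4 (by decide))
  · exact hsc3.congr (f4.nreg 7 (by decide)) w2
  · right
    rw [w4, p4, m 4 (by decide), f4.nreg 6 (by decide), h63]
    exact ⟨h8.trans h8', rfl⟩
  · rw [w4, w2, v1, p4, q2, b1]
    exact fun g' hg' => (hgood3 g' hg').congr (fun w _ => by rw [htr4]) (by rw [c5])
  · rw [c5]; exact hz
  · rw [c5]; exact hmin
  · rw [htr4]; exact h34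
  · rw [htr4]; exact hout
  · simp only [NExp.time, RExp.time]
    rw [Nat.mul_add] at ht3 ⊢
    omega
  · rw [m 0 (by decide), n0] at hc; exact hc
  · have e1 : pendingTotal k G n s4 = pendingTotal k G n s3 := by
      unfold pendingTotal; simp only [htr4]
    have e2 : centerTotal k G n s4 = centerTotal k G n s3 := by
      unfold centerTotal; simp only [htr4]
    have e3 : pendingTotal k G n s2 = pendingTotal k G n s := by
      unfold pendingTotal; simp only [htr2, htr1]
    have e4 : centerTotal k G n s2 = centerTotal k G n s := by
      unfold centerTotal; simp only [htr2, htr1]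
    rw [e1, e2, ← e3, ← e4]
    exact hpot

theorem Inv.feed {D : ℕ → ℕ → ℝ} {k G n : ℕ} {ε Δ r₀ : ℝ} {A : Finset ℕ} {s : Store}
    (h : Inv D k G n ε Δ r₀ A s) (u : Dynamic.Update) :
    Inv D k G n ε Δ r₀ A (Dynamic.feed u s) := by
  have m : ∀ x, 2 ≤ x → (Dynamic.feed u s).nreg x = s.nreg x := fun x hx => by
    simp [Dynamic.feed, show x ≠ 0 by omega, show x ≠ 1 by omega]
  have htr : ∀ g, tree k G (Dynamic.feed u s) g = tree k G s g := tree_congr fun a _ _ => rfl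
  refine ⟨?_, h.reg_eps, h.reg_delta, ?_, ?_, ?_, ?_⟩
  · rw [m 2 le_rfl, h.reg_k]
  · exact h.slots.congr (m 4 (by norm_num)) (m 5 (by norm_num)) rfl rfl rfl rfl
  · exact h.scale.congr (m 7 (by norm_num)) rfl
  · rw [m 4 (by norm_num), m 6 (by norm_num)]; exact h.stride
  · rw [m 4 (by norm_num)]
    exact fun g hg => (h.good g hg).congr (fun w _ => by rw [htr]) rfl

theorem inv_initStore {D : ℕ → ℕ → ℝ} (k G n : ℕ) (ε Δ r₀ : ℝ) :
    Inv D k G n ε Δ r₀ ∅ (Dynamic.initStore k ε Δ) := by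
  have hb : ∀ g w, tree k G (Dynamic.initStore k ε Δ) g w =
      ⟨0, fun _ => 0, 0, fun _ => 0, fun _ => 0⟩ := fun g w => by
    simp [tree, blk, Dynamic.initStore]
  refine ⟨rfl, rfl, rfl, ?_, .inl ⟨rfl, by simp⟩, .inl ⟨rfl, rfl⟩, fun g _ => ⟨⟨?_, ?_, ?_, ?_⟩, ?_, ?_⟩⟩
  · refine ⟨?_, ?_, ?_, ?_, ?_, ?_, ?_, ⟨?_, ?_⟩, rfl, rfl⟩ <;>
      simp [Dynamic.initStore] <;> omega
  · intro w _
    rw [hb]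
    refine ⟨?_, ?_, ?_, ?_, ?_, ?_⟩ <;> simp [Blk.memC]
  · intro w _; rw [hb]
  · intro w _ e
    simp [Blk.memU, Blk.memC, hb]
  · intro _ e he; exact he.elim
  · intro w _ i hi
    rw [hb] at hi
    simp at hi
  · simp only [overflow, hb]
    simp [Dynamic.initStore]

end DynKCenter

namespace DynKCenter
open RAM

/-! ## The quality of the output -/

theorem Good.nC_le {near : ℕ → ℕ → Prop} {k G N n : ℕ} {A : Finset ℕ} {slot : ℕ → ℕ}
    {s : Store} {g : ℕ} (h : Good near k G N n A slot s g) (hN : N ≤ n)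
    (h0 : s.narr 5 (g * (k + k + 3)) = 0) {w : ℕ} (hw : 1 ≤ w) :
    (DynKCenter.tree k G s g w).nC ≤ k := by
  by_cases hwN : w ≤ N
  · have := h.overflow.symm.trans h0
    have := Finset.sum_eq_zero_iff.1 this w (Finset.mem_Icc.2 ⟨hw, hwN.trans hN⟩)
    omega
  · by_contra hlt
    obtain ⟨j, hj, -⟩ := (h.tree.weak w hw).sub _ ⟨0, by omega, rfl⟩
    rw [h.tree.empty w (by omega)] at hj
    omega

/-- Climb from `w` to the root. Without overflow every element of a block has a near center, which
is an element of the parent, so each level adds at most `θ`. `θ` is separate from the threshold so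
that it can be `0` for the first guess. -/
theorem Good.exists_center {near : ℕ → ℕ → Prop} {D : ℕ → ℕ → ℝ} {k G N n : ℕ} {A : Finset ℕ}
    {slot : ℕ → ℕ} {s : Store} {g : ℕ} {θ : ℝ} (h : Good near k G N n A slot s g) (hN : N ≤ n)
    (h0 : s.narr 5 (g * (k + k + 3)) = 0) (hθ : 0 ≤ θ) (hD : ∀ e f f', D e f' ≤ D e f + D f f')
    (hnear : ∀ e ∈ A, ∀ f ∈ A, near e f → D e f ≤ θ) {m w e : ℕ} (hw : 1 ≤ w) (hwm : w < 2 ^ m)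
    (he : (DynKCenter.tree k G s g w).memU e) :
    ∃ c, (DynKCenter.tree k G s g 1).memC c ∧ D e c ≤ m * θ := by
  induction m generalizing w e with
  | zero => simp at hwm; omega
  | succ m ih =>
    obtain ⟨i, hi, rfl⟩ := he
    have hle := h.nC_le hN h0 hw
    rcases h.settled w hw i hi with ⟨h1, h2⟩ | ⟨-, h2⟩
    · set b := DynKCenter.tree k G s g w with hb
      have hc : b.memC (b.C (b.P i)) := ⟨_, h1, rfl⟩
      have hd := hnear _ (h.tree.memU_under hw ⟨i, hi, rfl⟩).1 _ (h.tree.memC_under hw hc).1 h2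
      by_cases hw1 : w = 1
      · subst hw1
        refine ⟨_, hc, hd.trans ?_⟩
        push_cast
        nlinarith [mul_nonneg (Nat.cast_nonneg (α := ℝ) m) hθ]
      · have hmem : (DynKCenter.tree k G s g (w / 2)).memU (b.C (b.P i)) := by
          have := (h.tree.mem (w / 2) (by omega) (b.C (b.P i))).2 (.inr ?_)
          · exact this.resolve_right fun h => h.2
          · rcases Nat.even_or_odd' w with ⟨u, rfl | rfl⟩
            · left
              rwa [show 2 * (2 * u / 2) = 2 * u by omega]
            · right
              rwa [show 2 * ((2 * u + 1) / 2) + 1 = 2 * u + 1 by omega]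
        obtain ⟨c, hc1, hc2⟩ := ih (by omega) (by rw [pow_succ] at hwm; omega) hmem
        refine ⟨c, hc1, (hD _ _ _).trans ((add_le_add hd hc2).trans ?_)⟩
        push_cast
        linarith
    · omega

/-- Pigeonhole: `k` centers at distances below `θ / 2` would serve two of the `k + 1` points by the
same center, and these two would be closer than `θ`. The centers may be arbitrary points, hence the
factor `2`. -/
theorem le_opt_of_separated {X : Type*} [MetricSpace X] {k : ℕ} {P : Finset X} {f : ℕ → X} {θ : ℝ}
    (hf : ∀ i < k + 1, f i ∈ P) (hsep : ∀ j < k + 1, ∀ i < j, θ < dist (f i) (f j)) :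
    ENNReal.ofReal (θ / 2) ≤ KCenter.opt k P := by
  refine le_iInf₂ fun C hC => ?_
  by_contra hlt
  rw [not_le] at hlt
  have h1 : ∀ i ∈ Finset.range (k + 1), ∃ c ∈ C, edist (f i) c < ENNReal.ofReal (θ / 2) := by
    intro i hi
    have : Metric.infEDist (f i) (C : Set X) < ENNReal.ofReal (θ / 2) :=
      (le_iSup₂ (f := fun p (_ : p ∈ P) => Metric.infEDist p (C : Set X)) (f i)
        (hf i (Finset.mem_range.1 hi))).trans_lt hlt
    obtain ⟨c, hc, h⟩ := Metric.infEDist_lt_iff.1 this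
    exact ⟨c, by simpa using hc, h⟩
  have : Nonempty X := ⟨f 0⟩
  choose! c hc hd using h1
  obtain ⟨i, hi, j, hj, hij, hcc⟩ := Finset.exists_ne_map_eq_of_card_lt_of_maps_to
    (s := Finset.range (k + 1)) (t := C) (by rw [Finset.card_range]; omega)
    (f := c) (fun i hi => hc i hi)
  have hdist : ∀ i ∈ Finset.range (k + 1), dist (f i) (c i) < θ / 2 := fun i hi => by
    have := hd i hi
    rw [edist_dist] at this
    exact (ENNReal.ofReal_lt_ofReal_iff_of_nonneg dist_nonneg).1 this
  have key : dist (f i) (f j) < θ := by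
    calc dist (f i) (f j) ≤ dist (f i) (c i) + dist (f j) (c i) := dist_triangle_right _ _ _
      _ < θ / 2 + θ / 2 := add_lt_add (hdist i hi) (hcc ▸ hdist j hj)
      _ = θ := by ring
  rw [Finset.mem_range] at hi hj
  rcases lt_or_gt_of_ne hij with h | h
  · exact lt_asymm key (hsep j hj i h)
  · rw [dist_comm] at key
    exact lt_asymm key (hsep i hi j h)

theorem Good.le_opt {X : Type*} [MetricSpace X] [DecidableEq X] {pt : ℕ → X} {k G N n : ℕ}
    {A : Finset ℕ} {slot : ℕ → ℕ} {s : Store} {g : ℕ} {θ : ℝ}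
    (h : Good (Near (fun e f => dist (pt e) (pt f)) θ) k G N n A slot s g)
    (h0 : s.narr 5 (g * (k + k + 3)) ≠ 0) :
    ENNReal.ofReal (θ / 2) ≤ KCenter.opt k (A.image pt) := by
  rw [h.overflow] at h0
  obtain ⟨w, hw, hne⟩ := Finset.exists_ne_zero_of_sum_ne_zero h0
  have hw1 := (Finset.mem_Icc.1 hw).1
  have hW := h.tree.weak w hw1
  refine le_opt_of_separated (f := fun i => pt ((DynKCenter.tree k G s g w).C i)) ?_ ?_
  · intro i hi
    exact Finset.mem_image_of_mem _ (h.tree.memC_under hw1 ⟨i, by omega, rfl⟩).1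
  · intro j hj i hij
    exact not_le.1 (hW.farC j (by omega) i hij)

/-- Since `1 + ε > 1`, the logarithm strictly exceeds the integer `⌊log₂ n⌋`, so its ceiling is at
least one larger, even if `n` is a power of two. -/
theorem log_succ_le_ceil {n : ℕ} {ε : ℝ} (hn : 1 ≤ n) (hε : 0 < ε) :
    ((Nat.log 2 n + 1 : ℕ) : ℝ) ≤ (⌈Real.logb 2 (n * (1 + ε))⌉ : ℤ) := by
  have hn' : (1 : ℝ) ≤ n := by exact_mod_cast hn
  have h1 : (Nat.log 2 n : ℝ) < Real.logb 2 (n * (1 + ε)) := by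
    rw [Real.lt_logb_iff_rpow_lt (by norm_num) (by positivity), Real.rpow_natCast]
    have : ((2 ^ Nat.log 2 n : ℕ) : ℝ) ≤ n := by exact_mod_cast Nat.pow_log_le_self 2 (by omega)
    push_cast at this
    nlinarith
  have h2 : ((Nat.log 2 n : ℤ)) < ⌈Real.logb 2 (n * (1 + ε))⌉ := Int.lt_ceil.2 (by exact_mod_cast h1)
  have h3 : ((Nat.log 2 n : ℤ)) + 1 ≤ ⌈Real.logb 2 (n * (1 + ε))⌉ := h2
  have h4 : (((Nat.log 2 n : ℤ) + 1 : ℤ) : ℝ) ≤ (⌈Real.logb 2 (n * (1 + ε))⌉ : ℤ) := by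
    exact_mod_cast h3
  simpa using h4

theorem cost_le {X : Type*} [MetricSpace X] [DecidableEq X] {pt : ℕ → X} {A C : Finset ℕ} {R : ℝ}
    (h : ∀ e ∈ A, ∃ c ∈ C, dist (pt e) (pt c) ≤ R) :
    KCenter.cost (A.image pt) (C.image pt) ≤ ENNReal.ofReal R := by
  refine iSup₂_le fun p hp => ?_
  obtain ⟨e, he, rfl⟩ := Finset.mem_image.1 hp
  obtain ⟨c, hc, hd⟩ := h e he
  refine (Metric.infEDist_le_edist_of_mem
    (y := pt c) (by simpa using ⟨c, hc, rfl⟩)).trans ?_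
  rw [edist_dist]
  exact ENNReal.ofReal_le_ofReal hd

theorem Inv.quality {X : Type*} [MetricSpace X] [DecidableEq X] {pt : ℕ → X} {k G n : ℕ}
    {ε Δ r₀ : ℝ} {A : Finset ℕ} {s : Store}
    (h : Inv (fun e f => dist (pt e) (pt f)) k G n ε Δ r₀ A s) (hrep : Reported k G s)
    (hD : Spread (fun e f => dist (pt e) (pt f)) Δ r₀ A) (hε : 0 < ε) (hΔ : 1 ≤ Δ) (hr₀ : 0 < r₀) :
    (Dynamic.centers s).length ≤ k ∧ (Dynamic.centers s).toFinset ⊆ A ∧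
      KCenter.cost (A.image pt) ((Dynamic.centers s).toFinset.image pt) ≤
        ENNReal.ofReal ((2 + ε) * (⌈Real.logb 2 (n * (1 + ε))⌉ : ℤ)) *
          KCenter.opt k (A.image pt) := by
  obtain ⟨g, hg, h0, hmin, h3, hout⟩ := hrep
  have hgood := h.good g hg
  have hmem : ∀ e, e ∈ (Dynamic.centers s).toFinset ↔ (tree k G s g 1).memC e := by
    intro e
    simp only [Dynamic.centers, List.mem_toFinset, List.mem_map, List.mem_range, h3]
    exact ⟨fun ⟨j, hj, hje⟩ => ⟨j, hj, (hout j hj).symm.trans hje⟩,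
      fun ⟨j, hj, hje⟩ => ⟨j, hj, (hout j hj).trans hje⟩⟩
  have hlam := h.scale.nonneg hr₀ hΔ
  have cover : ∀ θ : ℝ, 0 ≤ θ → (∀ e ∈ A, ∀ f ∈ A,
      Near (fun e f => dist (pt e) (pt f)) (s.rreg 2 * (1 + ε / 2) ^ g) e f →
        dist (pt e) (pt f) ≤ θ) →
      KCenter.cost (A.image pt) ((Dynamic.centers s).toFinset.image pt) ≤
        ENNReal.ofReal ((Nat.log 2 n + 1 : ℕ) * θ) := by
    intro θ hθ hnear
    refine cost_le fun e he => ?_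
    obtain ⟨hs1, hs2⟩ := h.slots.slot_range e he
    obtain ⟨c, hc, hd⟩ := hgood.exists_center (D := fun e f => dist (pt e) (pt f))
      h.slots.le h0 hθ
      (fun e f f' => dist_triangle _ _ _) hnear hs1
      ((hs2.trans h.slots.le).trans_lt (Nat.lt_pow_succ_log_self (by norm_num) n))
      (((hgood.tree.mem _ hs1 e).2 (.inl ⟨he, rfl⟩)).resolve_right fun h => h.2)
    exact ⟨c, (hmem c).2 hc, hd⟩
  refine ⟨?_, fun e he => (hgood.tree.memC_under le_rfl ((hmem e).1 he)).1, ?_⟩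
  · rw [Dynamic.centers, List.length_map, List.length_range, h3]
    exact hgood.nC_le h.slots.le h0 le_rfl
  rcases Nat.eq_zero_or_pos g with rfl | hgpos
  -- For the first guess the threshold is `d₀ / (2Δ) ≤ r₀ / 2`, so distinct active points are never
  -- near and the cost is zero.
  · refine (cover 0 le_rfl fun e he f hf hef => ?_).trans (by simp)
    by_cases hne : e = f
    · simp [hne]
    · exfalso
      rcases h.scale with h' | ⟨d₀, h1, h2, h4⟩
      · exact hne ((h'.2 e he).trans (h'.2 f hf).symm)
      · have h5 : dist (pt e) (pt f) ≤ s.rreg 2 := by simpa [Near] using hef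
        have h6 := (hD e he f hf hne).1
        rw [h4, le_div_iff₀ (by positivity)] at h5
        nlinarith
  · rcases A.eq_empty_or_nonempty with rfl | ⟨e, he⟩
    · simp [KCenter.cost]
    have hn : 1 ≤ n := by
      have := h.slots.slot_range e he
      have := h.slots.le
      omega
    -- The threshold of the preceding, overflowing guess; the factor `1 + ε / 2` to the current one
    -- and the `2` of the lower bound make `2 + ε`.
    set θ := s.rreg 2 * (1 + ε / 2) ^ (g - 1) with hθ
    have hθ0 : 0 ≤ θ := by positivity
    have hθg : s.rreg 2 * (1 + ε / 2) ^ g = θ * (1 + ε / 2) := by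
      rw [hθ, mul_assoc, ← pow_succ, Nat.sub_add_cancel hgpos]
    have hlow := (h.good (g - 1) (by omega)).le_opt (hmin (g - 1) (by omega))
    refine (cover (θ * (1 + ε / 2)) (by positivity) fun e _ f _ hef => hθg ▸ hef).trans ?_
    refine le_trans ?_ (mul_le_mul_right hlow _)
    have hlog := log_succ_le_ceil hn hε
    have hc0 : (0 : ℝ) ≤ (⌈Real.logb 2 (n * (1 + ε))⌉ : ℤ) := le_trans (by positivity) hlog
    rw [← ENNReal.ofReal_mul (by positivity)]
    refine ENNReal.ofReal_le_ofReal ?_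
    calc ((Nat.log 2 n + 1 : ℕ) : ℝ) * (θ * (1 + ε / 2))
        ≤ (⌈Real.logb 2 (n * (1 + ε))⌉ : ℤ) * (θ * (1 + ε / 2)) := by gcongr
      _ = _ := by ring

end DynKCenter

namespace DynKCenter
open RAM

/-! ## The running time -/

/-- From `ρ ^ (G - 1) ≤ 2Δ²ρ` follows `(G - 2) log ρ ≤ log 2 + 2 log Δ ≤ 3 log (Δ + 1)`. The
remaining `2` is absorbed by `log (Δ + 1) ≥ log 2`. -/
theorem exists_guesses {ρ : ℝ} (hρ : 1 < ρ) : ∃ K : ℝ, 0 < K ∧ ∀ Δ : ℝ, 1 ≤ Δ →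
    ∃ G : ℕ, Guesses Δ ρ G ∧ 1 ≤ G ∧ (G : ℝ) ≤ K * Real.log (Δ + 1) := by
  classical
  have hlρ : 0 < Real.log ρ := Real.log_pos hρ
  have hl2 : 0 < Real.log 2 := Real.log_pos (by norm_num)
  refine ⟨2 / Real.log 2 + 3 / Real.log ρ, by positivity, fun Δ hΔ => ?_⟩
  have hex : ∃ g : ℕ, 2 * Δ * Δ * ρ < ρ ^ g := pow_unbounded_of_one_lt _ hρ
  have hG : Guesses Δ ρ (Nat.find hex) := by
    intro g
    refine ⟨fun h => ?_, fun h => not_lt.1 (Nat.find_min hex h)⟩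
    by_contra hg
    exact lt_irrefl _ ((Nat.find_spec hex).trans_le
      ((pow_le_pow_right₀ hρ.le (not_lt.1 hg)).trans h))
  generalize Nat.find hex = G at hG
  have h1 : 1 ≤ G := (hG 0).1 (by
    rw [pow_zero]; nlinarith [mul_le_mul hΔ hΔ (by norm_num) (by linarith)])
  refine ⟨G, hG, h1, ?_⟩
  have h2 := Real.log_le_log (by positivity) ((hG (G - 1)).2 (by omega))
  rw [Real.log_pow, Real.log_mul (by positivity) (by positivity),
    Real.log_mul (by positivity) (by positivity), Real.log_mul (by positivity) (by positivity),
    Nat.cast_sub h1] at h2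
  have h3 : Real.log Δ ≤ Real.log (Δ + 1) := Real.log_le_log (by linarith) (by linarith)
  have h4 : Real.log 2 ≤ Real.log (Δ + 1) := Real.log_le_log (by norm_num) (by linarith)
  have h5 : 2 ≤ 2 / Real.log 2 * Real.log (Δ + 1) := by
    rw [div_mul_eq_mul_div, le_div_iff₀ hl2]; linarith
  have h6 : (G : ℝ) - 2 ≤ 3 / Real.log ρ * Real.log (Δ + 1) := by
    rw [div_mul_eq_mul_div, le_div_iff₀ hlρ]
    push_cast at h2
    nlinarith
  linarith

theorem log_succ_le {n : ℕ} (hn : 1 ≤ n) : ((Nat.log 2 n + 1 : ℕ) : ℝ) ≤ 3 * Real.log (n + 1) := by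
  have hn' : (1 : ℝ) ≤ n := by exact_mod_cast hn
  have h2 := Real.log_two_gt_d9
  have h1 : (Nat.log 2 n : ℝ) * Real.log 2 ≤ Real.log (n + 1) := by
    rw [← Real.log_pow]
    refine Real.log_le_log (by positivity) ?_
    have : ((2 ^ Nat.log 2 n : ℕ) : ℝ) ≤ n := by exact_mod_cast Nat.pow_log_le_self 2 (by omega)
    push_cast at this
    linarith
  have h3 : Real.log 2 ≤ Real.log (n + 1) := Real.log_le_log (by norm_num) (by linarith)
  push_cast
  nlinarith

/-- `⌊log₂ n⌋ + 1 ≤ 3 log (n + 1)` and `1 ≤ 2 log (k + 1)` turn `6000` into `36000`. The factor `log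
(k + 1)` enters only here. -/
theorem work_le {k n G a : ℕ} {K L : ℝ} (hk : 1 ≤ k) (hn : 1 ≤ n) (hK : 0 ≤ K) (hL : 0 ≤ L)
    (hG : (G : ℝ) ≤ K * L) :
    ((6000 * (G * (Nat.log 2 n + 1) * a) : ℕ) : ℝ) ≤
      36000 * K * (a * L * Real.log (n + 1) * Real.log (k + 1)) := by
  have h1 := log_succ_le hn
  have hk' : (1 : ℝ) ≤ k := by exact_mod_cast hk
  have h2 : Real.log 2 ≤ Real.log (k + 1) := Real.log_le_log (by norm_num) (by linarith)
  have h3 : 1 ≤ 2 * Real.log (k + 1) := by linarith [Real.log_two_gt_d9]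
  have h4 : 0 ≤ Real.log ((n : ℝ) + 1) := Real.log_nonneg (by linarith [Nat.cast_nonneg (α := ℝ) n])
  push_cast at h1 ⊢
  calc (6000 : ℝ) * (G * (Nat.log 2 n + 1) * a)
      ≤ 6000 * ((K * L) * (3 * Real.log (n + 1)) * a) := by gcongr
    _ = 6000 * ((K * L) * (3 * Real.log (n + 1)) * a) * 1 := by ring
    _ ≤ 6000 * ((K * L) * (3 * Real.log (n + 1)) * a) * (2 * Real.log (k + 1)) := by gcongr
    _ = _ := by ring

/-- `2k + 3 ≤ 5a` gives `3500`, and the lower-order terms add `140 + 20 + 200`. -/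
theorem le_of_base {k G r a c t : ℕ} (hG : 1 ≤ G) (hr : 1 ≤ r) (hk : 1 ≤ k) (hka : k ≤ a)
    (ht : t ≤ G * (r * (700 * (k + k + 3)) + 140) + 40 * c + 20 * k + 200) :
    t ≤ 3860 * (G * r * a) + 40 * c := by
  have h1 : G * (r * (700 * (k + k + 3))) ≤ 3500 * (G * r * a) := by
    calc G * (r * (700 * (k + k + 3))) ≤ G * (r * (700 * (5 * a))) := by gcongr; omega
      _ = _ := by ring
  have h2 : G * 1 * 1 ≤ G * r * a := by gcongr; omega
  have h3 : 1 * 1 * k ≤ G * r * a := by gcongr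
  rw [Nat.mul_add] at ht
  omega

theorem Inv.centerTotal_le {D : ℕ → ℕ → ℝ} {k G n r : ℕ} {ε Δ r₀ : ℝ} {A : Finset ℕ} {s : Store}
    (h : Inv D k G n ε Δ r₀ A s) (hD0 : ∀ e, D e e = 0) (hε : 0 < ε) (hΔ : 1 ≤ Δ) (hr₀ : 0 < r₀)
    (hr : n < 2 ^ r) : centerTotal k G n s ≤ G * (A.card * r) := by
  have hlam := h.scale.nonneg hr₀ hΔ
  have : centerTotal k G n s ≤ ∑ _g ∈ Finset.range G, A.card * r := by
    refine Finset.sum_le_sum fun g hg => ?_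
    refine (h.good g (Finset.mem_range.1 hg)).tree.centerCount_le (fun e => ?_) fun e he => ?_
    · unfold Near
      rw [hD0]
      positivity
    · exact ((h.slots.slot_range e he).2.trans h.slots.le).trans_lt hr
  simpa using this

/-- Telescoping: the potential `φ` starts at zero and is never negative, and the credit `w` per
center sums to at most `w ψ m`. -/
theorem sum_le_of_potential {m w C r : ℕ} {c φ ψ : ℕ → ℕ} (h0 : φ 0 = 0)
    (h : ∀ t < m, c t + φ (t + 1) + w * ψ t ≤ φ t + w * ψ (t + 1) + C) (hψ : ψ m ≤ m * r) :
    ∑ t ∈ Finset.range m, c t ≤ m * (w * r + C) := by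
  have key : ∀ j ≤ m, ∑ t ∈ Finset.range j, c t + φ j ≤ w * ψ j + j * C := by
    intro j hj
    induction j with
    | zero => simp [h0]
    | succ j ih =>
      rw [Finset.sum_range_succ, Nat.succ_mul]
      have := ih (by omega)
      have := h j (by omega)
      omega
  have h1 := key m le_rfl
  have h2 : w * ψ m ≤ w * (m * r) := Nat.mul_le_mul_left _ hψ
  have h3 : m * (w * r + C) = w * (m * r) + m * C := by ring
  omega

theorem active_succ {us : List Dynamic.Update} {t : ℕ} (ht : t < us.length) :
    Dynamic.active us (t + 1) = us[t].apply (Dynamic.active us t) := by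
  rw [Dynamic.active, List.take_add_one, List.getElem?_eq_getElem ht, List.foldl_append]
  rfl

theorem card_active_le {us : List Dynamic.Update} {t : ℕ} (ht : t ≤ us.length) :
    (Dynamic.active us t).card ≤ t := by
  induction t with
  | zero => simp [Dynamic.active]
  | succ t ih =>
    rw [active_succ ht]
    have := ih (by omega)
    cases us[t] with
    | ins i => exact (Finset.card_insert_le _ _).trans (by omega)
    | del i => exact (Finset.card_erase_le).trans (by omega)

/-- The first update of a valid stream must be an insertion. This excludes `n = 0`, for which the
right-hand sides of the time bounds would vanish. -/
theorem one_le_of_valid {us : List Dynamic.Update} {t n : ℕ} (hv : Dynamic.Valid us)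
    (ht : t < us.length) (hn : ∀ t ≤ us.length, (Dynamic.active us t).card ≤ n) : 1 ≤ n := by
  have h1 := hn 1 (by omega)
  have h0 := hv 0 (by omega)
  rw [active_succ (t := 0) (by omega)] at h1
  revert h0 h1
  cases us[0] <;> simp [Dynamic.active, Dynamic.Update.Legal, Dynamic.Update.apply]

end DynKCenter

namespace DynKCenter
open RAM

/-! ## Streams of updates -/

theorem exists_step {X : Type*} [MetricSpace X] [DecidableEq X] {pt : ℕ → X} {k n G r : ℕ}
    {ε Δ r₀ : ℝ} {us : List Dynamic.Update} (hk : 1 ≤ k) (hε : 0 < ε) (hΔ : 1 ≤ Δ)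
    (hv : Dynamic.Valid us) (hr₀ : 0 < r₀)
    (hD : ∀ t ≤ us.length,
      Spread (fun e f => dist (pt e) (pt f)) Δ r₀ (Dynamic.active us t))
    (hn : ∀ t ≤ us.length, (Dynamic.active us t).card ≤ n) (hG : Guesses Δ (1 + ε / 2) G)
    (hr : n < 2 ^ r) {t : ℕ} (ht : t < us.length) {s : Store}
    (h : Inv (fun e f => dist (pt e) (pt f)) k G n ε Δ r₀ (Dynamic.active us t) s) :
    wp (Dynamic.oracle pt (insert us[t].name (Dynamic.active us t))) program
      (Updated (fun e f => dist (pt e) (pt f)) k G n ε Δ r₀ (Dynamic.active us (t + 1)) r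
        (Dynamic.feed us[t] s)) (Dynamic.feed us[t] s) := by
  refine wp_program (p := us[t].name) hk hε hΔ hr₀ hG hr (fun e => dist_self _)
    (fun e f => dist_comm _ _) (hD _ ht) (fun e f => rfl) (by simp [Dynamic.feed]) (hn _ ht) ?_
    (h.feed us[t])
  have hl := hv t ht
  rw [active_succ ht]
  cases hu : us[t] with
  | ins i =>
    rw [hu] at hl
    exact .inl ⟨by simp [Dynamic.feed, Dynamic.Update.code], hl, rfl⟩
  | del i =>
    rw [hu] at hl
    exact .inr ⟨by simp [Dynamic.feed, Dynamic.Update.code], hl, rfl⟩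

/-- The memory and the running times on a whole stream. -/
theorem exists_run {X : Type*} [MetricSpace X] [DecidableEq X] {pt : ℕ → X} {k n G r : ℕ}
    {ε Δ r₀ : ℝ} {us : List Dynamic.Update} (hk : 1 ≤ k) (hε : 0 < ε) (hΔ : 1 ≤ Δ)
    (hv : Dynamic.Valid us) (hr₀ : 0 < r₀)
    (hD : ∀ t ≤ us.length,
      Spread (fun e f => dist (pt e) (pt f)) Δ r₀ (Dynamic.active us t))
    (hn : ∀ t ≤ us.length, (Dynamic.active us t).card ≤ n) (hG : Guesses Δ (1 + ε / 2) G)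
    (hr : n < 2 ^ r) :
    ∃ (σ : ℕ → Store) (τ : ℕ → ℕ), Dynamic.IsRun program pt k ε Δ us σ τ ∧
      (∀ t ≤ us.length,
        Inv (fun e f => dist (pt e) (pt f)) k G n ε Δ r₀ (Dynamic.active us t) (σ t)) ∧
      ∀ (t : ℕ) (ht : t < us.length),
        Updated (fun e f => dist (pt e) (pt f)) k G n ε Δ r₀ (Dynamic.active us (t + 1)) r
          (Dynamic.feed us[t] (σ t)) (τ t) (σ (t + 1)) := by
  -- Termination is known only under the invariant. A default value elsewhere makes the step a total
  -- function, so that the sequence of stores can be defined by recursion before its invariants are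
  -- proved.
  have step : ∀ (t : ℕ) (s : Store), ∃ q : ℕ × Store, ∀ ht : t < us.length,
      Inv (fun e f => dist (pt e) (pt f)) k G n ε Δ r₀ (Dynamic.active us t) s →
      Exec (Dynamic.oracle pt (insert us[t].name (Dynamic.active us t))) program
        (Dynamic.feed us[t] s) q.1 q.2 ∧
      Updated (fun e f => dist (pt e) (pt f)) k G n ε Δ r₀ (Dynamic.active us (t + 1)) r
        (Dynamic.feed us[t] s) q.1 q.2 := by
    intro t s
    by_cases h : ∃ _ : t < us.length,
        Inv (fun e f => dist (pt e) (pt f)) k G n ε Δ r₀ (Dynamic.active us t) s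
    · obtain ⟨ht, hI⟩ := h
      obtain ⟨t', s', he, hU⟩ := exists_step hk hε hΔ hv hr₀ hD hn hG hr ht hI
      exact ⟨(t', s'), fun _ _ => ⟨he, hU⟩⟩
    · exact ⟨(0, s), fun ht hI => absurd ⟨ht, hI⟩ h⟩
  choose F hF using step
  let σ : ℕ → Store := fun t => Nat.rec (Dynamic.initStore k ε Δ) (fun t s => (F t s).2) t
  have hI : ∀ t ≤ us.length,
      Inv (fun e f => dist (pt e) (pt f)) k G n ε Δ r₀ (Dynamic.active us t) (σ t) := by
    intro t ht
    induction t with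
    | zero => exact inv_initStore k G n ε Δ r₀
    | succ t ih => exact (hF t (σ t) ht (ih (by omega))).2.1
  exact ⟨σ, fun t => (F t (σ t)).1, ⟨rfl, fun t ht => (hF t (σ t) ht (hI t ht.le)).1⟩, hI,
    fun t ht => (hF t (σ t) ht (hI t ht.le)).2⟩

theorem Updated.time_le {D : ℕ → ℕ → ℝ} {k G n r a t : ℕ} {ε Δ r₀ : ℝ} {A : Finset ℕ}
    {s s' : Store} (h : Updated D k G n ε Δ r₀ A r s t s') (hG : 1 ≤ G) (hr : 1 ≤ r) (hk : 1 ≤ k)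
    (ha : k * (if s.nreg 0 = 0 then 1 else k) = a) : t ≤ 6000 * (G * r * a) := by
  obtain ⟨-, -, c, ht, hc, -⟩ := h
  have hka : k ≤ a := by
    rw [← ha]
    exact Nat.le_mul_of_pos_right k (by split_ifs <;> omega)
  have h1 := le_of_base hG hr hk hka ht
  have h2 : (k + 1) * workFactor k (s.nreg 0) ≤ 10 * a := by
    rw [← ha]
    unfold workFactor
    split_ifs
    · omega
    · nlinarith
  have h3 : c ≤ 10 * (G * r * a) := by
    calc c ≤ G * (r * (10 * a)) := hc.trans (by gcongr)
      _ = _ := by ring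
  omega

/-- The single bound on `c` is dropped in favour of the potential inequality. The comparisons
average to `30 G r k` per update, and `3860 + 40 * 30 = 5060`. -/
theorem sum_time_le {D : ℕ → ℕ → ℝ} {k G n r : ℕ} {ε Δ r₀ : ℝ} {us : List Dynamic.Update}
    {σ : ℕ → Store} {τ : ℕ → ℕ} (hG : 1 ≤ G) (hr : 1 ≤ r) (hk : 1 ≤ k)
    (h0 : σ 0 = Dynamic.initStore k ε Δ) (hψ : centerTotal k G n (σ us.length) ≤
      us.length * (G * r))
    (h : ∀ (t : ℕ) (ht : t < us.length), Updated D k G n ε Δ r₀ (Dynamic.active us (t + 1)) r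
      (Dynamic.feed us[t] (σ t)) (τ t) (σ (t + 1))) :
    ∑ t ∈ Finset.range us.length, τ t ≤ us.length * (6000 * (G * r * k)) := by
  have h' : ∀ t, ∃ c, t < us.length → τ t ≤ 3860 * (G * r * k) + 40 * c ∧
      c + pendingTotal k G n (σ (t + 1)) + 2 * (k + k + 3) * centerTotal k G n (σ t) ≤
        pendingTotal k G n (σ t) + 2 * (k + k + 3) * centerTotal k G n (σ (t + 1)) +
          G * (2 * ((k + k + 3) * (r + 1))) := by
    intro t
    by_cases ht : t < us.length
    · obtain ⟨-, -, c, h1, -, h2⟩ := h t ht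
      refine ⟨c, fun _ => ⟨le_of_base hG hr hk le_rfl h1, ?_⟩⟩
      rw [mul_assoc, mul_assoc]
      exact h2
    · exact ⟨0, fun h => absurd h ht⟩
  choose c hc using h'
  have hφ0 : pendingTotal k G n (σ 0) = 0 := by
    rw [h0]
    refine Finset.sum_eq_zero fun g _ => Finset.sum_eq_zero fun w _ => ?_
    simp [tree, blk, Blk.pending, Dynamic.initStore]
  have hsum := sum_le_of_potential (φ := fun t => pendingTotal k G n (σ t))
    (ψ := fun t => centerTotal k G n (σ t)) hφ0 (fun t ht => (hc t ht).2) hψ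
  have hone : 2 * (k + k + 3) * (G * r) + G * (2 * ((k + k + 3) * (r + 1))) ≤
      30 * (G * r * k) := by
    calc 2 * (k + k + 3) * (G * r) + G * (2 * ((k + k + 3) * (r + 1)))
        ≤ 2 * (5 * k) * (G * r) + G * (2 * ((5 * k) * (2 * r))) := by gcongr <;> omega
      _ = _ := by ring
  calc ∑ t ∈ Finset.range us.length, τ t
      ≤ ∑ t ∈ Finset.range us.length, (3860 * (G * r * k) + 40 * c t) :=
        Finset.sum_le_sum fun t ht => (hc t (Finset.mem_range.1 ht)).1
    _ = us.length * (3860 * (G * r * k)) + 40 * ∑ t ∈ Finset.range us.length, c t := by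
        rw [Finset.sum_add_distrib, Finset.mul_sum]; simp
    _ ≤ us.length * (3860 * (G * r * k)) + 40 * (us.length * (30 * (G * r * k))) := by
        gcongr
        exact hsum.trans (Nat.mul_le_mul_left _ hone)
    _ = us.length * (5060 * (G * r * k)) := by ring
    _ ≤ _ := by gcongr; norm_num

end DynKCenter

theorem mainTheorem4 :
    ∃ P : RAM.Cmd, ∀ ε : ℝ, 0 < ε → ∃ K : ℝ, 0 < K ∧
      ∀ (X : Type*) [MetricSpace X] [DecidableEq X] (pt : ℕ → X) (k n : ℕ) (Δ : ℝ)
        (us : List Dynamic.Update),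
        1 ≤ k → 1 ≤ Δ →
        Dynamic.Valid us →
        Dynamic.AspectRatioLE pt us Δ →
        (∀ t ≤ us.length, (Dynamic.active us t).card ≤ n) →
        ∃ (σ : ℕ → RAM.Store) (τ : ℕ → ℕ),
          Dynamic.IsRun P pt k ε Δ us σ τ ∧
          -- after every update the memory holds at most `k` centers of the claimed quality
          (∀ t < us.length,
            (Dynamic.centers (σ (t + 1))).length ≤ k ∧
            (Dynamic.centers (σ (t + 1))).toFinset ⊆ Dynamic.active us (t + 1) ∧
            KCenter.cost ((Dynamic.active us (t + 1)).image pt)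
                ((Dynamic.centers (σ (t + 1))).toFinset.image pt) ≤
              ENNReal.ofReal ((2 + ε) * (⌈Real.logb 2 (n * (1 + ε))⌉ : ℤ)) *
                KCenter.opt k ((Dynamic.active us (t + 1)).image pt)) ∧
          -- amortized update time
          (((∑ t ∈ Finset.range us.length, τ t : ℕ) : ℝ) ≤
            K * us.length *
              (k * Real.log (Δ + 1) * Real.log (n + 1) * Real.log (k + 1))) ∧
          -- worst-case update time of insertions
          (∀ (t : ℕ) (ht : t < us.length), (∃ i, us[t] = Dynamic.Update.ins i) →
            (τ t : ℝ) ≤ K * (k * Real.log (Δ + 1) * Real.log (n + 1) * Real.log (k + 1))) ∧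
          -- worst-case update time of deletions
          (∀ (t : ℕ) (ht : t < us.length), (∃ i, us[t] = Dynamic.Update.del i) →
            (τ t : ℝ) ≤
              K * (k ^ 2 * Real.log (Δ + 1) * Real.log (n + 1) * Real.log (k + 1))) := by
  refine ⟨DynKCenter.program, fun ε hε => ?_⟩
  obtain ⟨K, hK, hguess⟩ := DynKCenter.exists_guesses (ρ := 1 + ε / 2) (by linarith)
  refine ⟨36000 * K, by positivity, ?_⟩
  intro X _ _ pt k n Δ us hk hΔ hv hasp hn
  obtain ⟨r₀, hr₀, hD⟩ := hasp
  obtain ⟨G, hG, hG1, hGle⟩ := hguess Δ hΔ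
  have hL : 0 ≤ Real.log (Δ + 1) := Real.log_nonneg (by linarith)
  obtain ⟨σ, τ, hrun, hI, hU⟩ := DynKCenter.exists_run hk hε hΔ hv hr₀ hD hn hG
    (Nat.lt_pow_succ_log_self (by norm_num) n)
  refine ⟨σ, τ, hrun, fun t ht => ?_, ?_, ?_, ?_⟩
  · exact (hI (t + 1) ht).quality (hU t ht).2.1 (hD (t + 1) ht) hε hΔ hr₀
  · rcases Nat.eq_zero_or_pos us.length with h0 | hpos
    · simp [h0]
    -- At the end there are at most `|A| r` centers per guess, and `|A|` is at most the number of
    -- updates.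
    have hψ := (hI _ le_rfl).centerTotal_le (fun e => dist_self _) hε hΔ hr₀
      (Nat.lt_pow_succ_log_self (by norm_num) n)
    have hle := DynKCenter.sum_time_le hG1 (Nat.le_add_left 1 (Nat.log 2 n)) hk hrun.1
      (hψ.trans ((Nat.mul_le_mul_left G (Nat.mul_le_mul_right _
        (DynKCenter.card_active_le le_rfl))).trans_eq (Nat.mul_left_comm _ _ _))) hU
    have hw := DynKCenter.work_le (a := k) hk (DynKCenter.one_le_of_valid hv hpos hn) hK.le hL hGle
    calc ((∑ t ∈ Finset.range us.length, τ t : ℕ) : ℝ)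
        ≤ us.length * ((6000 * (G * (Nat.log 2 n + 1) * k) : ℕ) : ℝ) := by exact_mod_cast hle
      _ ≤ us.length * (36000 * K *
          (k * Real.log (Δ + 1) * Real.log (n + 1) * Real.log (k + 1))) := by gcongr
      _ = _ := by ring
  · rintro t ht ⟨i, hi⟩
    have hle := (hU t ht).time_le (a := k) hG1 (Nat.le_add_left 1 (Nat.log 2 n)) hk
      (by simp [hi, Dynamic.feed, Dynamic.Update.code])
    exact (Nat.cast_le.2 hle).trans
      (DynKCenter.work_le hk (DynKCenter.one_le_of_valid hv ht hn) hK.le hL hGle)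
  · rintro t ht ⟨i, hi⟩
    have hle := (hU t ht).time_le (a := k ^ 2) hG1 (Nat.le_add_left 1 (Nat.log 2 n)) hk
      (by simp [hi, Dynamic.feed, Dynamic.Update.code, sq])
    have hw := DynKCenter.work_le (a := k ^ 2) hk (DynKCenter.one_le_of_valid hv ht hn) hK.le hL
      hGle
    rw [Nat.cast_pow] at hw
    exact (Nat.cast_le.2 hle).trans hw
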